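/- Let $\Sigma$ be a closed surface (a compact smooth $2$-manifold without boundary) and $F:\Sigma\to\mathbb R^4$ a smooth immersion, with induced metric $g$, area measure $\mu_g$, second fundamental form $A=(h_{ij})$, mean curvature vector $H=g^{ij}h_{ij}$, traceless second fundamental form $\mathring A=A-\tfrac12 g\,H$, and normal curvature $K^\perp$ (so that $|\mathrm{Rm}^\perp|^2=4|K^\perp|^2$, where $R^\perp_{ij\alpha\beta}=h_{ip\alpha}h_{jp\beta}-h_{jp\alpha}h_{ip\beta}$). Let $$Z=\sum H_\alpha h_{ip\alpha}h_{ij\beta}h_{pj\beta}-\sum_{\alpha,\beta}\Big(\sum_{i,j}h_{ij\alpha}h_{ij\beta}\Big)^2-|\mathrm{Rm}^\perp|^2$$ be the nonlinearity in the contracted Simons identity. Let $\gamma\ge 0$ and $\kappa<\tfrac56$, assume that $H$ vanishes nowhere and that $|A|^2\le\kappa|H|^2$ on $\Sigma$, and put $$f_\sigma=\frac{|\mathring A|^2+2\gamma|K^\perp|}{|H|^{2(1-\sigma)}},\qquad \sigma\in(0,1).$$ (i) There is a constant $\epsilon_Z>0$ depending only on $\kappa$ and $\gamma$ (not on the surface)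 such that $$Z\ \ge\ \epsilon_Z\,\big(|\mathring A|^2+2\gamma|K^\perp|\big)\,|H|^2\quad\text{on every such }\Sigma.\tag{$*$}$$ (ii) For every such $\Sigma$, every constant $\epsilon_Z>0$ for which $(*)$ holds on $\Sigma$, every $\sigma\in(0,1)$, every real $p\ge2$ and every $\eta>0$, the three integrands below are integrable and $$\int_\Sigma f_\sigma^{p}|H|^2\,d\mu_g\ \le\ \frac{4p\eta+10}{\epsilon_Z}\int_\Sigma\frac{f_\sigma^{p-1}}{|H|^{2(1-\sigma)}}|\nabla A|^2\,d\mu_g+\frac{3(p-1)}{\epsilon_Z\,\eta}\int_\Sigma f_\sigma^{p-2}|\nabla f_\sigma|^2\,d\mu_g .$$ ($f_\sigma$ is Lipschitz, so $\nabla f_\sigma$ exists almost everywhere.) In particular this applies, with one $\epsilon_Z$ for all times, to the time slices of a mean curvature flow of closed surfaces in $\mathbb R^4$ that satisfy $H\neq0$ and $|A|^2+2\gamma|K^\perp|\le k|H|^2$ with $k\le\tfrac{29}{40}$ and $0\le\gamma\le1-\tfrac43k$. -/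

import Mathlib

open scoped Manifold ContDiff

noncomputable section

namespace SurfaceR4

/-- The coordinate plane. -/
abbrev E2 : Type := EuclideanSpace ℝ (Fin 2)

/-- The ambient Euclidean space `ℝ⁴`. -/
abbrev E4 : Type := EuclideanSpace ℝ (Fin 4)

/-! ### Pointwise algebra

`G` is the inverse `g^{ij}` of the metric and `h i j` is the (normal-valued) second fundamental form
in a basis of the tangent plane. Greek indices are components in the standard
orthonormal basis of `ℝ⁴`; since `h i j` is normal, sums over Greek indices of an orthonormal
basis of `ℝ⁴` agree with sums over an orthonormal basis of the normal plane. -/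

/-- Squared norm `g^{ik} g^{jl} ⟨T_ij, T_kl⟩` of an `ℝ⁴`-valued 2-tensor. -/
def normSq2 (G : Matrix (Fin 2) (Fin 2) ℝ) (T : Fin 2 → Fin 2 → E4) : ℝ :=
  ∑ i, ∑ j, ∑ k, ∑ l, G i k * G j l * inner ℝ (T i j) (T k l)

/-- Squared norm `g^{ia} g^{jb} g^{kc} ⟨T_ijk, T_abc⟩` of an `ℝ⁴`-valued 3-tensor. -/
def normSq3 (G : Matrix (Fin 2) (Fin 2) ℝ) (T : Fin 2 → Fin 2 → Fin 2 → E4) : ℝ :=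
  ∑ i, ∑ j, ∑ k, ∑ a, ∑ b, ∑ c, G i a * G j b * G k c * inner ℝ (T i j k) (T a b c)

/-- Mean curvature vector `H = g^{ij} h_ij`. -/
def trace2 (G : Matrix (Fin 2) (Fin 2) ℝ) (h : Fin 2 → Fin 2 → E4) : E4 :=
  ∑ i, ∑ j, G i j • h i j

/-- Normal curvature tensor
`R⊥_{ijαβ} = g^{pq} (h_{ipα} h_{jqβ} - h_{jpα} h_{iqβ})`. -/
def normalCurv (G : Matrix (Fin 2) (Fin 2) ℝ) (h : Fin 2 → Fin 2 → E4)
    (i j : Fin 2) (α β : Fin 4) : ℝ :=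
  ∑ p, ∑ q, G p q * (h i p α * h j q β - h j p α * h i q β)

/-- `|Rm⊥|²`, the full squared norm of the normal curvature tensor. -/
def normalCurvNormSq (G : Matrix (Fin 2) (Fin 2) ℝ) (h : Fin 2 → Fin 2 → E4) : ℝ :=
  ∑ i, ∑ j, ∑ k, ∑ l, G i k * G j l *
    ∑ α, ∑ β, normalCurv G h i j α β * normalCurv G h k l α β

/-- The nonlinearity in the contracted Simons identity,
`Z = H_α h_{ipα} h_{ijβ} h_{pjβ} - ∑_{αβ} (∑_{ij} h_{ijα} h_{ijβ})² - |Rm⊥|²`. -/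
def simonsZ (G : Matrix (Fin 2) (Fin 2) ℝ) (h : Fin 2 → Fin 2 → E4) : ℝ :=
  (∑ i, ∑ i', ∑ p, ∑ p', ∑ j, ∑ j', G i i' * G p p' * G j j' *
      (inner ℝ (trace2 G h) (h i p) * inner ℝ (h i' j) (h p' j')))
    - (∑ α, ∑ β, (∑ i, ∑ j, ∑ k, ∑ l, G i k * G j l * (h i j α * h k l β)) ^ 2)
    - normalCurvNormSq G h

/-! ### Geometry of a local parametrization `u : ℝ² → ℝ⁴` -/

/-- Partial derivative `∂_i w` of a map on the coordinate plane. -/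
def pd {V : Type*} [NormedAddCommGroup V] [NormedSpace ℝ V] (i : Fin 2) (w : E2 → V) : E2 → V :=
  fun y => fderiv ℝ w y (EuclideanSpace.single i 1)

/-- Induced metric `g_ij = ⟨∂_i u, ∂_j u⟩`. -/
def metric (u : E2 → E4) (y : E2) : Matrix (Fin 2) (Fin 2) ℝ :=
  Matrix.of fun i j => inner ℝ (pd i u y) (pd j u y)

/-- Inverse metric `g^{ij}`. -/
def invMetric (u : E2 → E4) (y : E2) : Matrix (Fin 2) (Fin 2) ℝ := (metric u y)⁻¹

/-- Normal component of an ambient vector, `v - g^{kl} ⟨v, ∂_k u⟩ ∂_l u`. -/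
def normalPart (u : E2 → E4) (y : E2) (v : E4) : E4 :=
  v - ∑ k, ∑ l, (invMetric u y k l * inner ℝ v (pd k u y)) • pd l u y

/-- Christoffel symbols `Γ^k_{ij}` of the Levi-Civita connection of the induced metric. -/
def christoffel (u : E2 → E4) (k i j : Fin 2) (y : E2) : ℝ :=
  (1 / 2 : ℝ) * ∑ l, invMetric u y k l *
    (pd i (fun z => metric u z j l) y + pd j (fun z => metric u z i l) y
      - pd l (fun z => metric u z i j) y)

/-- Second fundamental form `h_ij = (∂_i ∂_j u)^⊥`. -/
def secondFF (u : E2 → E4) (i j : Fin 2) (y : E2) : E4 :=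
  normalPart u y (pd i (pd j u) y)

/-- Covariant derivative `∇_k h_ij = (∂_k h_ij)^⊥ - Γ^l_{ki} h_lj - Γ^l_{kj} h_il` of the second
fundamental form, with the normal connection on the normal bundle. -/
def covSecondFF (u : E2 → E4) (k i j : Fin 2) (y : E2) : E4 :=
  normalPart u y (pd k (secondFF u i j) y)
    - ∑ l, christoffel u l k i y • secondFF u l j y
    - ∑ l, christoffel u l k j y • secondFF u i l y

/-! ### Immersed surfaces -/

variable {M : Type*} [TopologicalSpace M] [ChartedSpace E2 M]

/-- `F : M → ℝ⁴` is a smooth immersion. -/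
def IsSmoothImmersion (F : M → E4) : Prop :=
  ContMDiff (𝓡 2) 𝓘(ℝ, E4) ∞ F ∧
    ∀ x : M, Function.Injective (mfderiv (𝓡 2) 𝓘(ℝ, E4) F x)

/-- A map on `M` read in the preferred chart around `x`. -/
def localRep {V : Type*} (F : M → V) (x : M) : E2 → V := fun y => F ((chartAt E2 x).symm y)

/-- Coordinates of `x` in its preferred chart. -/
def coord (x : M) : E2 := chartAt E2 x x

/-- Inverse metric at `x`, in the preferred chart around `x`. -/
def invMetricAt (F : M → E4) (x : M) : Matrix (Fin 2) (Fin 2) ℝ :=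
  invMetric (localRep F x) (coord x)

/-- Second fundamental form at `x`, in the preferred chart around `x`. -/
def secondFFAt (F : M → E4) (x : M) (i j : Fin 2) : E4 :=
  secondFF (localRep F x) i j (coord x)

/-- Mean curvature vector `H`. -/
def meanCurv (F : M → E4) (x : M) : E4 := trace2 (invMetricAt F x) (secondFFAt F x)

/-- `|A|²`. -/
def normSqA (F : M → E4) (x : M) : ℝ := normSq2 (invMetricAt F x) (secondFFAt F x)

/-- `|Å|²`, where `Å_ij = h_ij - (1/2) g_ij H` is the traceless second fundamental form. -/
def normSqTracelessA (F : M → E4) (x : M) : ℝ :=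
  normSq2 (invMetricAt F x) fun i j =>
    secondFFAt F x i j - ((1 / 2 : ℝ) * metric (localRep F x) (coord x) i j) • meanCurv F x

/-- `|∇A|²`. -/
def normSqGradA (F : M → E4) (x : M) : ℝ :=
  normSq3 (invMetricAt F x) fun k i j => covSecondFF (localRep F x) k i j (coord x)

/-- `|K⊥|`. In orthonormal frames the only nonzero components of `R⊥` are
`R⊥_1212 = R⊥_2121 = K⊥` and `R⊥_1221 = R⊥_2112 = -K⊥` (tangent indices first, then normal ones),
hence `|Rm⊥|² = 4 |K⊥|²`. -/
def absNormalCurv (F : M → E4) (x : M) : ℝ :=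
  Real.sqrt (normalCurvNormSq (invMetricAt F x) (secondFFAt F x)) / 2

/-- The Simons nonlinearity `Z`. -/
def simonsZAt (F : M → E4) (x : M) : ℝ := simonsZ (invMetricAt F x) (secondFFAt F x)

/-- `|Å|² + 2 γ |K⊥|`. -/
def pinchQ (F : M → E4) (γ : ℝ) (x : M) : ℝ :=
  normSqTracelessA F x + 2 * γ * absNormalCurv F x

/-- `f_σ = (|Å|² + 2 γ |K⊥|) / |H|^{2 (1 - σ)}`. -/
def fSigma (F : M → E4) (γ σ : ℝ) (x : M) : ℝ :=
  pinchQ F γ x / ‖meanCurv F x‖ ^ (2 * (1 - σ))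

/-- `|∇f|² = g^{ij} ∂_i f ∂_j f`. (For a Lipschitz `f` this is the usual quantity at almost every
point; where `f` is not differentiable the value is `0`.) -/
def normSqGrad (F : M → E4) (f : M → ℝ) (x : M) : ℝ :=
  ∑ i, ∑ j, invMetricAt F x i j *
    (pd i (localRep f x) (coord x) * pd j (localRep f x) (coord x))

/-- The area measure of the induced metric on the domain of the preferred chart around `x`:
the image of `√(det g) dy` under the inverse chart. -/
def chartArea [MeasurableSpace M] (F : M → E4) (x : M) : MeasureTheory.Measure M :=
  ((MeasureTheory.volume.restrict (chartAt E2 x).target).withDensity fun y =>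
    ENNReal.ofReal (Real.sqrt (metric (localRep F x) y).det)).map (chartAt E2 x).symm

/-- The area measure `μ_g` of the induced metric. The measures `chartArea F x` are the restrictions
of one measure to the chart domains, and that measure is their supremum. -/
def area [MeasurableSpace M] (F : M → E4) : MeasureTheory.Measure M := ⨆ x : M, chartArea F x

/-- `ε > 0` is an admissible constant in the lower bound
`Z ≥ ε (|Å|² + 2 γ |K⊥|) |H|²` on the whole surface. -/
def IsSimonsConstant (F : M → E4) (γ ε : ℝ) : Prop :=
  0 < ε ∧ ∀ x : M, ε * pinchQ F γ x * ‖meanCurv F x‖ ^ 2 ≤ simonsZAt F x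

/-- The mean curvature vanishes nowhere and `|A|² ≤ κ |H|²`. -/
def IsPinched (F : M → E4) (κ : ℝ) : Prop :=
  ∀ x : M, meanCurv F x ≠ 0 ∧ normSqA F x ≤ κ * ‖meanCurv F x‖ ^ 2

end SurfaceR4

end

open SurfaceR4 MeasureTheory

/-! Part (i) is algebra in one tangent plane. In an orthonormal frame write h₁₁ = F + a, h₂₂ = F −
a, h₁₂ = b, so that H = 2F and |Å|² = 2(|a|² + |b|²). Then Z = 4|F|²(|a|² + |b|²) − 4(|a|⁴ + |b|⁴ +
4|a|²|b|² − 2⟨a,b⟩²), the pinching reads |a|² + |b|² ≤ (2κ − 1)|F|², and |K⊥| ≤ |a|² + |b|².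
Together these give ε_Z = (5/2 − 3κ)/(2(1 + γ)) (`simonsZ_ge`).

Part (ii) rests on the contracted Simons identity in divergence form, div X = Z + |∇A|² − |∇H|² with
X = ½∇|A|² − ⟨A, ∇H⟩ (`IsRegularAt.div_simonsFlux`). Both sides are compatible with changes of
parameters, so it suffices to check it at the centre of a graph over the tangent plane. There the
metric is Euclidean to first order, the Christoffel symbols vanish, and the identity becomes a
polynomial identity between Taylor coefficients of orders two, three and four (`simons_algebra`);
the Gauss, Codazzi and Ricci equations are never needed separately.

The identity is tested with w = f_σ^{p−1}/|H|^{2(1−σ)}. Since w(|Å|² + 2γ|K⊥|) = f_σ^p and |∇H|² ≤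
2|∇A|², the bound (∗) gives ε_Z ∫ f_σ^p |H|² ≤ −∫ ⟨∇w, X⟩ + ∫ w|∇A|². The field X sees only the
traceless part of A, so |X|² ≤ 6|Å|²|∇A|². In −⟨∇w, X⟩ the part with ∇f_σ is split by Young's
inequality, and the part with ∇|H|² is absorbed by means of |Å|² ≤ |H|²/3
(`weight_derivative_bound`).

The analytic difficulty is that |K⊥| is a square root, so f_σ and w are only Lipschitz. Integration
by parts is therefore done in charts against compactly supported Lipschitz functions, using
Rademacher's theorem, and patched with a partition of unity
(`IsSmoothImmersion.integral_mul_simonsDivAt`). -/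

noncomputable section

namespace SurfaceR4

/-! ### Contractions of tensors under a linear change of basis -/

section TensorAlgebra

variable {V : Type*} [NormedAddCommGroup V] [InnerProductSpace ℝ V]

/-- Components of a covector in the basis `∑ i, B i a • e i`. -/
def pull1 (B : Matrix (Fin 2) (Fin 2) ℝ) (x : Fin 2 → ℝ) (a : Fin 2) : ℝ :=
  ∑ i, B i a * x i

/-- Components of a 2-tensor in the basis `∑ i, B i a • e i`. -/
def pull2 (B : Matrix (Fin 2) (Fin 2) ℝ) (T : Fin 2 → Fin 2 → V) (a b : Fin 2) : V :=
  ∑ i, ∑ j, (B i a * B j b) • T i j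

/-- Components of a 3-tensor in the basis `∑ i, B i a • e i`. -/
def pull3 (B : Matrix (Fin 2) (Fin 2) ℝ) (T : Fin 2 → Fin 2 → Fin 2 → V) (a b c : Fin 2) : V :=
  ∑ i, ∑ j, ∑ k, (B i a * B j b * B k c) • T i j k

/-- Gradient of the mean curvature as a trace of the covariant derivative. -/
def gradTrace (G : Matrix (Fin 2) (Fin 2) ℝ) (D : Fin 2 → Fin 2 → Fin 2 → E4) (k : Fin 2) : E4 :=
  trace2 G (D k)

/-- Squared norm of an `ℝ⁴`-valued covector. -/
def normSq1 (G : Matrix (Fin 2) (Fin 2) ℝ) (v : Fin 2 → E4) : ℝ :=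
  ∑ i, ∑ k, G i k * inner ℝ (v i) (v k)

/-- Pairing of two real covectors. -/
def pairing (G : Matrix (Fin 2) (Fin 2) ℝ) (x y : Fin 2 → ℝ) : ℝ :=
  ∑ i, ∑ k, G i k * (x i * y k)

/-- The covector `½ ∇|A|² - ⟨A, ∇H⟩` whose divergence is given by the contracted Simons identity. -/
def simonsCovector (G : Matrix (Fin 2) (Fin 2) ℝ) (h : Fin 2 → Fin 2 → E4)
    (D : Fin 2 → Fin 2 → Fin 2 → E4) (l : Fin 2) : ℝ :=
  (∑ i, ∑ j, ∑ a, ∑ b, G i a * G j b * inner ℝ (h i j) (D l a b))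
    - ∑ j, ∑ k, G j k * inner ℝ (h l j) (gradTrace G D k)

variable {B G G' : Matrix (Fin 2) (Fin 2) ℝ}

/-- Every invariant in play is a full contraction with copies of G, so its invariance follows by
moving the factors B from one copy of G at a time onto the tensor slots. Two cases are used later: B
an orthonormal frame with G' = 1, and B the Jacobian of a change of parameters. -/
theorem contract1 (hG : G = B * G' * B.transpose) {W : Type*} [AddCommGroup W] [Module ℝ W]
    (φ : Fin 2 → Fin 2 → W) :
    ∑ i, ∑ k, G i k • φ i k = ∑ a, ∑ b, G' a b • ∑ i, ∑ k, (B i a * B k b) • φ i k := by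
  subst hG
  simp only [Matrix.mul_apply, Matrix.transpose_apply, Fin.sum_univ_two]
  module

theorem contract2 (hG : G = B * G' * B.transpose) (φ : Fin 2 → Fin 2 → Fin 2 → Fin 2 → ℝ) :
    ∑ i, ∑ j, ∑ k, ∑ l, G i k * G j l * φ i j k l =
      ∑ a, ∑ b, ∑ c, ∑ d, G' a c * G' b d *
        ∑ i, ∑ j, ∑ k, ∑ l, B i a * B j b * (B k c * B l d) * φ i j k l := by
  have h1 : ∀ (Q : Matrix (Fin 2) (Fin 2) ℝ) (ψ : Fin 2 → Fin 2 → Fin 2 → Fin 2 → ℝ),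
      ∑ i, ∑ j, ∑ k, ∑ l, Q i k * Q j l * ψ i j k l =
      ∑ i, ∑ k, Q i k • ∑ j, ∑ l, Q j l • ψ i j k l := by
    intro Q ψ
    simp only [Fin.sum_univ_two, smul_eq_mul]; ring
  rw [h1, h1, contract1 hG]
  refine Finset.sum_congr rfl fun a _ => Finset.sum_congr rfl fun c _ => ?_
  congr 1
  simp_rw [contract1 hG]
  simp only [Fin.sum_univ_two, smul_eq_mul]; ring

theorem contract3 (hG : G = B * G' * B.transpose)
    (φ : Fin 2 → Fin 2 → Fin 2 → Fin 2 → Fin 2 → Fin 2 → ℝ) :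
    ∑ i, ∑ j, ∑ k, ∑ a, ∑ b, ∑ c, G i a * G j b * G k c * φ i j k a b c =
      ∑ i', ∑ j', ∑ k', ∑ a', ∑ b', ∑ c', G' i' a' * G' j' b' * G' k' c' *
        ∑ i, ∑ a, B i i' * B a a' * ∑ j, ∑ k, ∑ b, ∑ c,
          B j j' * B k k' * (B b b' * B c c') * φ i j k a b c := by
  have h1 : ∀ (Q : Matrix (Fin 2) (Fin 2) ℝ)
      (ψ : Fin 2 → Fin 2 → Fin 2 → Fin 2 → Fin 2 → Fin 2 → ℝ),
      ∑ i, ∑ j, ∑ k, ∑ a, ∑ b, ∑ c, Q i a * Q j b * Q k c * ψ i j k a b c =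
      ∑ i, ∑ a, Q i a • ∑ j, ∑ k, ∑ b, ∑ c, Q j b * Q k c * ψ i j k a b c := by
    intro Q ψ
    simp only [Fin.sum_univ_two, smul_eq_mul]; ring
  rw [h1, h1, contract1 hG]
  refine Finset.sum_congr rfl fun i' _ => Finset.sum_congr rfl fun a' _ => ?_
  congr 1
  simp_rw [contract2 hG]
  simp only [Fin.sum_univ_two, smul_eq_mul]; ring

theorem inner_pull2 (x y : Fin 2 → Fin 2 → V) (a b c d : Fin 2) :
    inner ℝ (pull2 B x a b) (pull2 B y c d) =
      ∑ i, ∑ j, ∑ k, ∑ l, B i a * B j b * (B k c * B l d) * inner ℝ (x i j) (y k l) := by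
  simp only [pull2, sum_inner, inner_sum, real_inner_smul_left, real_inner_smul_right]
  simp only [Fin.sum_univ_two]; ring

theorem pull2_apply_coord (x : Fin 2 → Fin 2 → E4) (a b : Fin 2) (α : Fin 4) :
    pull2 B x a b α = ∑ i, ∑ j, B i a * B j b * x i j α := by
  simp [pull2, Fin.sum_univ_two]

theorem trace2_pull (hG : G = B * G' * B.transpose) (h : Fin 2 → Fin 2 → E4) :
    trace2 G h = trace2 G' (pull2 B h) := contract1 hG h

theorem normSq2_pull (hG : G = B * G' * B.transpose) (h : Fin 2 → Fin 2 → E4) :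
    normSq2 G h = normSq2 G' (pull2 B h) := by
  simp only [normSq2, inner_pull2]
  exact contract2 hG fun i j k l => inner ℝ (h i j) (h k l)

theorem normSq3_pull (hG : G = B * G' * B.transpose) (D : Fin 2 → Fin 2 → Fin 2 → E4) :
    normSq3 G D = normSq3 G' (pull3 B D) := by
  have h1 : ∀ i' j' k' a' b' c', inner ℝ (pull3 B D i' j' k') (pull3 B D a' b' c') =
      ∑ i, ∑ a, B i i' * B a a' * ∑ j, ∑ k, ∑ b, ∑ c,
          B j j' * B k k' * (B b b' * B c c') * inner ℝ (D i j k) (D a b c) := by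
    intro i' j' k' a' b' c'
    have h2 : ∀ i j k, pull3 B D i j k = ∑ l, B l i • pull2 B (D l) j k := by
      intro i j k
      simp only [pull3, pull2, Fin.sum_univ_two]; module
    simp only [h2, sum_inner, inner_sum, real_inner_smul_left, real_inner_smul_right, inner_pull2]
    rw [Finset.sum_comm]
    refine Finset.sum_congr rfl fun i _ => Finset.sum_congr rfl fun a _ => ?_
    ring
  simp only [normSq3, h1]
  exact contract3 hG fun i j k a b c => inner ℝ (D i j k) (D a b c)

theorem normSq1_pull (hG : G = B * G' * B.transpose) (v : Fin 2 → E4) :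
    normSq1 G v = normSq1 G' (fun a => ∑ i, B i a • v i) := by
  have := contract1 hG fun i k => inner ℝ (v i) (v k)
  simp only [smul_eq_mul] at this
  rw [normSq1, this, normSq1]
  refine Finset.sum_congr rfl fun a _ => Finset.sum_congr rfl fun b _ => ?_
  simp only [Fin.sum_univ_two, inner_add_left, inner_add_right, real_inner_smul_left,
    real_inner_smul_right]
  ring

theorem pairing_pull (hG : G = B * G' * B.transpose) (x y : Fin 2 → ℝ) :
    pairing G x y = pairing G' (pull1 B x) (pull1 B y) := by
  have := contract1 hG fun i k => x i * y k
  simp only [smul_eq_mul] at this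
  rw [pairing, this, pairing]
  refine Finset.sum_congr rfl fun a _ => Finset.sum_congr rfl fun b _ => ?_
  simp only [pull1, Fin.sum_univ_two]
  ring

theorem gradTrace_pull (hG : G = B * G' * B.transpose) (D : Fin 2 → Fin 2 → Fin 2 → E4)
    (k : Fin 2) : gradTrace G' (pull3 B D) k = ∑ l, B l k • gradTrace G D l := by
  simp only [gradTrace, trace2_pull hG]
  simp only [trace2, pull2, pull3, Fin.sum_univ_two]
  module

theorem simonsCovector_pull (hG : G = B * G' * B.transpose) (h : Fin 2 → Fin 2 → E4)
    (D : Fin 2 → Fin 2 → Fin 2 → E4) (l : Fin 2) :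
    simonsCovector G' (pull2 B h) (pull3 B D) l = pull1 B (simonsCovector G h D) l := by
  have h2 : ∀ i j k, pull3 B D i j k = ∑ l, B l i • pull2 B (D l) j k := by
    intro i j k
    simp only [pull3, pull2, Fin.sum_univ_two]; module
  have e1 : ∀ m, ∑ i, ∑ j, ∑ a, ∑ b, G i a * G j b * inner ℝ (h i j) (D m a b) =
      ∑ i, ∑ j, ∑ a, ∑ b, G' i a * G' j b * inner ℝ (pull2 B h i j) (pull2 B (D m) a b) := by
    intro m
    simp only [inner_pull2]
    exact contract2 hG fun i j k l => inner ℝ (h i j) (D m k l)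
  have e2 : ∀ m, ∑ j, ∑ k, G j k * inner ℝ (h m j) (gradTrace G D k) =
      ∑ j, ∑ k, G' j k * inner ℝ (∑ i, B i j • h m i) (gradTrace G' (pull3 B D) k) := by
    intro m
    have := contract1 hG fun j k => inner ℝ (h m j) (gradTrace G D k)
    simp only [smul_eq_mul] at this
    rw [this]
    refine Finset.sum_congr rfl fun a _ => Finset.sum_congr rfl fun b _ => ?_
    simp only [gradTrace_pull hG, Fin.sum_univ_two, inner_add_left, inner_add_right,
      real_inner_smul_left, real_inner_smul_right]
    ring
  have e3 : ∀ l j, pull2 B h l j = ∑ m, B m l • ∑ i, B i j • h m i := by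
    intro l j
    simp only [pull2, Fin.sum_univ_two]; module
  simp only [pull1, simonsCovector, e1, e2]
  simp only [h2, e3 l, inner_sum, sum_inner, real_inner_smul_right, real_inner_smul_left]
  simp only [Fin.sum_univ_two]
  ring

theorem normalCurv_pull (hG : G = B * G' * B.transpose) (h : Fin 2 → Fin 2 → E4)
    (a b : Fin 2) (α β : Fin 4) :
    normalCurv G' (pull2 B h) a b α β =
      ∑ i, ∑ j, B i a * B j b * normalCurv G h i j α β := by
  have e : ∀ i j, normalCurv G h i j α β = ∑ p, ∑ q, G' p q •
      ∑ p', ∑ q', (B p' p * B q' q) • (h i p' α * h j q' β - h j p' α * h i q' β) := by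
    intro i j
    exact contract1 hG fun p q => h i p α * h j q β - h j p α * h i q β
  simp only [e]
  simp only [normalCurv, pull2_apply_coord, Fin.sum_univ_two, smul_eq_mul]
  ring

theorem normalCurvNormSq_pull (hG : G = B * G' * B.transpose) (h : Fin 2 → Fin 2 → E4) :
    normalCurvNormSq G h = normalCurvNormSq G' (pull2 B h) := by
  simp only [normalCurvNormSq]
  rw [contract2 hG fun i j k l => ∑ α, ∑ β, normalCurv G h i j α β * normalCurv G h k l α β]
  refine Finset.sum_congr rfl fun a _ => Finset.sum_congr rfl fun b _ =>
    Finset.sum_congr rfl fun c _ => Finset.sum_congr rfl fun d _ => ?_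
  congr 1
  simp only [Finset.mul_sum]
  simp only [Fin.sum_univ_two (f := fun i : Fin 2 => _), ← Finset.sum_add_distrib]
  refine Finset.sum_congr rfl fun α _ => Finset.sum_congr rfl fun β _ => ?_
  simp only [normalCurv_pull hG, Fin.sum_univ_two]
  ring

theorem simonsZ_pull (hG : G = B * G' * B.transpose) (h : Fin 2 → Fin 2 → E4) :
    simonsZ G h = simonsZ G' (pull2 B h) := by
  simp only [simonsZ, ← normalCurvNormSq_pull hG, ← trace2_pull hG]
  congr 2
  · have perm : ∀ (Q : Matrix (Fin 2) (Fin 2) ℝ)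
        (ψ : Fin 2 → Fin 2 → Fin 2 → Fin 2 → Fin 2 → Fin 2 → ℝ),
        ∑ i, ∑ i', ∑ p, ∑ p', ∑ j, ∑ j', Q i i' * Q p p' * Q j j' * ψ i p j i' p' j' =
        ∑ i, ∑ p, ∑ j, ∑ i', ∑ p', ∑ j', Q i i' * Q p p' * Q j j' * ψ i p j i' p' j' := by
      intro Q ψ
      simp only [Fin.sum_univ_two]; ring
    rw [perm G fun i p j i' p' j' => inner ℝ (trace2 G h) (h i p) *
        inner ℝ (h i' j) (h p' j'),
      perm G' fun i p j i' p' j' => inner ℝ (trace2 G h) (pull2 B h i p) *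
        inner ℝ (pull2 B h i' j) (pull2 B h p' j'), contract3 hG]
    refine Finset.sum_congr rfl fun a _ => Finset.sum_congr rfl fun b _ =>
      Finset.sum_congr rfl fun c _ => Finset.sum_congr rfl fun d _ =>
      Finset.sum_congr rfl fun e _ => Finset.sum_congr rfl fun f _ => ?_
    congr 1
    simp only [inner_pull2]
    simp only [pull2, inner_sum, real_inner_smul_right]
    simp only [Fin.sum_univ_two]
    ring
  · refine Finset.sum_congr rfl fun α _ => Finset.sum_congr rfl fun β _ => ?_
    congr 1
    rw [contract2 hG fun i j k l => h i j α * h k l β]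
    refine Finset.sum_congr rfl fun a _ => Finset.sum_congr rfl fun b _ =>
      Finset.sum_congr rfl fun c _ => Finset.sum_congr rfl fun d _ => ?_
    congr 1
    simp only [pull2_apply_coord, Fin.sum_univ_two]
    ring

end TensorAlgebra

/-! ### Pointwise inequalities -/

section PointwiseInequalities

variable {C G : Matrix (Fin 2) (Fin 2) ℝ}

theorem pull2_symm {h : Fin 2 → Fin 2 → E4} (hs : h 0 1 = h 1 0) (B : Matrix (Fin 2) (Fin 2) ℝ) :
    pull2 B h 0 1 = pull2 B h 1 0 := by
  simp only [pull2, Fin.sum_univ_two, hs]; module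

theorem normSq2_one (h : Fin 2 → Fin 2 → E4) :
    normSq2 1 h = ‖h 0 0‖ ^ 2 + ‖h 0 1‖ ^ 2 + ‖h 1 0‖ ^ 2 + ‖h 1 1‖ ^ 2 := by
  simp [normSq2, Fin.sum_univ_two]; ring

theorem normSq3_one (D : Fin 2 → Fin 2 → Fin 2 → E4) :
    normSq3 1 D = ∑ l, ∑ i, ∑ j, ‖D l i j‖ ^ 2 := by
  simp [normSq3, Fin.sum_univ_two]

theorem normSq1_one (v : Fin 2 → E4) : normSq1 1 v = ‖v 0‖ ^ 2 + ‖v 1‖ ^ 2 := by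
  simp [normSq1, Fin.sum_univ_two]

theorem pairing_one (x y : Fin 2 → ℝ) : pairing 1 x y = x 0 * y 0 + x 1 * y 1 := by
  simp [pairing, Fin.sum_univ_two]

theorem trace2_one (h : Fin 2 → Fin 2 → E4) : trace2 1 h = h 0 0 + h 1 1 := by
  simp [trace2, Fin.sum_univ_two]

/-- In an orthonormal frame R⊥₁₂ is the wedge (h₁₁ − h₂₂) ∧ h₁₂, and Lagrange's identity evaluates
its norm. -/
theorem normalCurvNormSq_one {h : Fin 2 → Fin 2 → E4} (hs : h 0 1 = h 1 0) :
    normalCurvNormSq 1 h = 4 * (‖h 0 0 - h 1 1‖ ^ 2 * ‖h 0 1‖ ^ 2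
      - inner ℝ (h 0 0 - h 1 1) (h 0 1) ^ 2) := by
  simp only [normalCurvNormSq, normalCurv, Fin.sum_univ_two, Matrix.one_apply_eq, ← hs]
  simp only [EuclideanSpace.norm_sq_eq, PiLp.inner_apply, Fin.sum_univ_four, PiLp.sub_apply]
  simp
  ring

theorem sum_sq_tensor_square (p q r : E4) :
    ∑ α, ∑ β, (p α * p β + 2 * (q α * q β) + r α * r β) ^ 2 =
      ‖p‖ ^ 4 + 4 * ‖q‖ ^ 4 + ‖r‖ ^ 4 + 4 * (inner ℝ p q) ^ 2 + 2 * (inner ℝ p r) ^ 2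
        + 4 * (inner ℝ q r) ^ 2 := by
  have h4 : ∀ v : E4, ‖v‖ ^ 4 = (‖v‖ ^ 2) ^ 2 := fun v => by ring
  simp only [h4, EuclideanSpace.norm_sq_eq, PiLp.inner_apply, Fin.sum_univ_four]
  simp
  ring

/-- The trace part F enters only through |F|²: the terms in ⟨F,a⟩ and ⟨F,b⟩ and the pure |F|⁴ terms
cancel between the cubic-trace sum and the sum of squares. -/
theorem simonsZ_one {h : Fin 2 → Fin 2 → E4} (hs : h 0 1 = h 1 0) {F a b : E4}
    (hF : h 0 0 + h 1 1 = (2 : ℝ) • F) (ha : h 0 0 - h 1 1 = (2 : ℝ) • a) (hb : h 0 1 = b) :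
    simonsZ 1 h = 4 * ‖F‖ ^ 2 * (‖a‖ ^ 2 + ‖b‖ ^ 2)
      - 4 * (‖a‖ ^ 4 + ‖b‖ ^ 4 + 4 * ‖a‖ ^ 2 * ‖b‖ ^ 2 - 2 * inner ℝ a b ^ 2) := by
  have h00 : h 0 0 = F + a := by
    have : (2 : ℝ) • h 0 0 = (2 : ℝ) • (F + a) := by
      rw [smul_add, ← hF, ← ha]; module
    exact smul_right_injective _ (two_ne_zero) this
  have h11 : h 1 1 = F - a := by
    have : (2 : ℝ) • h 1 1 = (2 : ℝ) • (F - a) := by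
      rw [smul_sub, ← hF, ← ha]; module
    exact smul_right_injective _ (two_ne_zero) this
  rw [simonsZ, normalCurvNormSq_one hs, ha, trace2_one, hF]
  have e : ∀ α β, (∑ i, ∑ j, ∑ k, ∑ l, (1 : Matrix (Fin 2) (Fin 2) ℝ) i k *
      (1 : Matrix (Fin 2) (Fin 2) ℝ) j l * (h i j α * h k l β)) =
      h 0 0 α * h 0 0 β + 2 * (h 0 1 α * h 0 1 β) + h 1 1 α * h 1 1 β := by
    intro α β
    simp [Fin.sum_univ_two, ← hs]; ring
  simp only [e, sum_sq_tensor_square]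
  have e2 : ∑ i, ∑ i', ∑ p, ∑ p', ∑ j, ∑ j', (1 : Matrix (Fin 2) (Fin 2) ℝ) i i' *
      (1 : Matrix (Fin 2) (Fin 2) ℝ) p p' * (1 : Matrix (Fin 2) (Fin 2) ℝ) j j' *
      (inner ℝ ((2 : ℝ) • F) (h i p) * inner ℝ (h i' j) (h p' j')) =
      ∑ i, ∑ p, ∑ j, inner ℝ ((2 : ℝ) • F) (h i p) * inner ℝ (h i j) (h p j) := by
    simp [Fin.sum_univ_two]
  have h4 : ∀ v : E4, ‖v‖ ^ 4 = (‖v‖ ^ 2) ^ 2 := fun v => by ring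
  rw [e2]
  simp only [Fin.sum_univ_two, ← hs, h00, h11, hb, h4]
  simp only [← real_inner_self_eq_norm_sq, inner_add_left, inner_add_right, inner_sub_left,
    inner_sub_right, real_inner_smul_left, real_inner_smul_right, real_inner_comm F a,
    real_inner_comm F b, real_inner_comm a b]
  ring

theorem normSq2_traceless (hG : G = C * 1 * C.transpose) {g : Matrix (Fin 2) (Fin 2) ℝ}
    (hg : C.transpose * g * C = 1) (h : Fin 2 → Fin 2 → E4) :
    normSq2 G (fun i j => h i j - ((1 / 2 : ℝ) * g i j) • trace2 G h) =
      normSq2 G h - 1 / 2 * ‖trace2 G h‖ ^ 2 := by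
  have e : pull2 C (fun i j => h i j - ((1 / 2 : ℝ) * g i j) • trace2 G h) =
      fun a b => pull2 C h a b - ((1 / 2 : ℝ) * (C.transpose * g * C) a b) • trace2 G h := by
    funext a b
    simp only [pull2, Matrix.mul_apply, Matrix.transpose_apply, Fin.sum_univ_two]
    module
  rw [normSq2_pull hG, e, hg, normSq2_pull hG, trace2_pull hG, normSq2_one, normSq2_one, trace2_one]
  simp only [Matrix.one_apply_eq, ne_eq, zero_ne_one, one_ne_zero, not_false_eq_true,
    Matrix.one_apply_ne, mul_zero, mul_one, zero_smul, sub_zero]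
  simp only [← real_inner_self_eq_norm_sq, inner_add_left, inner_add_right, inner_sub_left,
    inner_sub_right, real_inner_smul_left, real_inner_smul_right,
    real_inner_comm (pull2 C h 0 0) (pull2 C h 1 1)]
  ring

theorem normSq2_sub_trace_nonneg (hG : G = C * 1 * C.transpose) (h : Fin 2 → Fin 2 → E4) :
    0 ≤ normSq2 G h - 1 / 2 * ‖trace2 G h‖ ^ 2 := by
  rw [normSq2_pull hG, trace2_pull hG, normSq2_one, trace2_one]
  have h1 := parallelogram_law_with_norm ℝ (pull2 C h 0 0) (pull2 C h 1 1)
  nlinarith [sq_nonneg ‖pull2 C h 0 0 - pull2 C h 1 1‖, sq_nonneg ‖pull2 C h 0 1‖,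
    sq_nonneg ‖pull2 C h 1 0‖]

/-- With A = |a|², B = |b|², T = |F|² one has Z ≥ 4(A + B)(T − (3/2)(A + B)), and the pinching A + B
≤ (2κ − 1)T turns the last factor into at least (5/2 − 3κ)T. Dividing by 2(1 + γ) pays for the
curvature term in |Å|² + 2γ|K⊥|. -/
theorem simonsZ_ge (hG : G = C * 1 * C.transpose) {h : Fin 2 → Fin 2 → E4} (hs : h 0 1 = h 1 0)
    {κ γ : ℝ} (hκ : κ < 5 / 6) (hγ : 0 ≤ γ) (hp : normSq2 G h ≤ κ * ‖trace2 G h‖ ^ 2) :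
    (5 / 2 - 3 * κ) / (2 * (1 + γ)) * (normSq2 G h - 1 / 2 * ‖trace2 G h‖ ^ 2
      + 2 * γ * (Real.sqrt (normalCurvNormSq G h) / 2)) * ‖trace2 G h‖ ^ 2 ≤ simonsZ G h := by
  rw [normSq2_pull hG, trace2_pull hG] at *
  rw [normalCurvNormSq_pull hG, simonsZ_pull hG]
  have hs' := pull2_symm hs C
  generalize pull2 C h = k at *
  obtain ⟨F, hF⟩ : ∃ F, F = (1 / 2 : ℝ) • (k 0 0 + k 1 1) := ⟨_, rfl⟩
  obtain ⟨a, ha⟩ : ∃ a, a = (1 / 2 : ℝ) • (k 0 0 - k 1 1) := ⟨_, rfl⟩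
  have hF' : k 0 0 + k 1 1 = (2 : ℝ) • F := by rw [hF]; module
  have ha' : k 0 0 - k 1 1 = (2 : ℝ) • a := by rw [ha]; module
  rw [simonsZ_one hs' hF' ha' rfl]
  have hN : normalCurvNormSq 1 k = 16 * (‖a‖ ^ 2 * ‖k 0 1‖ ^ 2 - inner ℝ a (k 0 1) ^ 2) := by
    rw [normalCurvNormSq_one hs', ha', norm_smul, real_inner_smul_left]
    simp; ring
  have hS : normSq2 1 k - 1 / 2 * ‖trace2 1 k‖ ^ 2 = 2 * (‖a‖ ^ 2 + ‖k 0 1‖ ^ 2) := by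
    have h1 := parallelogram_law_with_norm ℝ (k 0 0) (k 1 1)
    rw [hF', ha', norm_smul, norm_smul] at h1
    rw [normSq2_one, trace2_one, hF', ← hs', norm_smul]
    simp at h1 ⊢
    nlinarith
  have hH : ‖trace2 1 k‖ ^ 2 = 4 * ‖F‖ ^ 2 := by
    rw [trace2_one, hF', norm_smul]; simp; ring
  rw [hS, hN]
  rw [hH] at hS hp ⊢
  have hc := sq_nonneg (inner ℝ a (k 0 1))
  generalize inner ℝ a (k 0 1) ^ 2 = c at *
  -- This is |K⊥| ≤ ½|Å|², from 2|a||b| ≤ |a|² + |b|².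
  have hsq : Real.sqrt (16 * (‖a‖ ^ 2 * ‖k 0 1‖ ^ 2 - c)) / 2 ≤ ‖a‖ ^ 2 + ‖k 0 1‖ ^ 2 := by
    rw [div_le_iff₀ two_pos, Real.sqrt_le_left (by positivity)]
    nlinarith [sq_nonneg (‖a‖ ^ 2 - ‖k 0 1‖ ^ 2)]
  have hP : (normSq2 1 k) = 2 * (‖a‖ ^ 2 + ‖k 0 1‖ ^ 2) + 2 * ‖F‖ ^ 2 := by linarith
  rw [hP] at hp
  have e4 : ∀ v : E4, ‖v‖ ^ 4 = (‖v‖ ^ 2) ^ 2 := fun v => by ring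
  rw [e4, e4]
  have ha0 := sq_nonneg ‖a‖
  have hb0 := sq_nonneg ‖k 0 1‖
  have hF0 := sq_nonneg ‖F‖
  generalize ‖a‖ ^ 2 = A at *
  generalize ‖k 0 1‖ ^ 2 = B at *
  generalize ‖F‖ ^ 2 = T at *
  generalize Real.sqrt (16 * (A * B - c)) / 2 = N at *
  have hε : 0 < (5 / 2 - 3 * κ) / (2 * (1 + γ)) := by
    apply div_pos <;> linarith
  have h1 : (5 / 2 - 3 * κ) / (2 * (1 + γ)) * (2 * (A + B) + 2 * γ * N) * (4 * T) ≤
      (5 / 2 - 3 * κ) * (A + B) * (4 * T) := by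
    have : (2 * (A + B) + 2 * γ * N) ≤ 2 * (1 + γ) * (A + B) := by nlinarith
    calc _ ≤ (5 / 2 - 3 * κ) / (2 * (1 + γ)) * (2 * (1 + γ) * (A + B)) * (4 * T) := by gcongr
      _ = _ := by field_simp
  refine h1.trans ?_
  -- Uses A² + B² + 4AB = (3/2)(A + B)² − ½(A − B)²; the term in ⟨a,b⟩² has a favourable sign and is
  -- dropped.
  nlinarith [sq_nonneg (A - B), mul_le_mul_of_nonneg_right hp (add_nonneg ha0 hb0)]

/-- One step of Cauchy–Schwarz for a sum: bounds for the summands combine into a bound for the sum.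
Iterating it handles the four-term contractions below. -/
theorem add_sq_le_of_sq_le {s t a b x y : ℝ} (ha : 0 ≤ a) (hb : 0 ≤ b) (hx : 0 ≤ x) (hy : 0 ≤ y)
    (hs : s ^ 2 ≤ a * x) (ht : t ^ 2 ≤ b * y) : (s + t) ^ 2 ≤ (a + b) * (x + y) := by
  have h1 : (2 * (s * t)) ≤ a * y + b * x := by
    refine abs_le_of_sq_le_sq' ?_ (by positivity) |>.2
    have : s ^ 2 * t ^ 2 ≤ (a * x) * (b * y) := by gcongr
    nlinarith [sq_nonneg (a * y - b * x)]
  nlinarith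

theorem real_inner_sq_le (x y : E4) : inner ℝ x y ^ 2 ≤ ‖x‖ ^ 2 * ‖y‖ ^ 2 := by
  rw [← mul_pow]
  exact sq_le_sq' (neg_le_of_abs_le (abs_real_inner_le_norm x y)) (real_inner_le_norm x y)

theorem pairing_sq_le (hG : G = C * 1 * C.transpose) (x y : Fin 2 → ℝ) :
    pairing G x y ^ 2 ≤ pairing G x x * pairing G y y := by
  simp only [pairing_pull hG, pairing_one]
  refine add_sq_le_of_sq_le (mul_self_nonneg _) (mul_self_nonneg _) (mul_self_nonneg _)
    (mul_self_nonneg _) ?_ ?_ <;> nlinarith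

theorem pairing_self_nonneg (hG : G = C * 1 * C.transpose) (x : Fin 2 → ℝ) :
    0 ≤ pairing G x x := by
  rw [pairing_pull hG, pairing_one]
  exact add_nonneg (mul_self_nonneg _) (mul_self_nonneg _)

theorem normSq3_nonneg (hG : G = C * 1 * C.transpose) (D : Fin 2 → Fin 2 → Fin 2 → E4) :
    0 ≤ normSq3 G D := by
  rw [normSq3_pull hG, normSq3_one]; positivity

theorem norm_add_sq_le (x y : E4) : ‖x + y‖ ^ 2 ≤ 2 * (‖x‖ ^ 2 + ‖y‖ ^ 2) := by
  nlinarith [parallelogram_law_with_norm ℝ x y, sq_nonneg ‖x - y‖]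

/-- In an orthonormal frame each ∇ₖH is a sum of two components of ∇A, whence the factor 2 in |∇H|²
≤ 2|∇A|². The Codazzi symmetry is not needed. -/
theorem normSq1_gradTrace_le (hG : G = C * 1 * C.transpose) (D : Fin 2 → Fin 2 → Fin 2 → E4) :
    normSq1 G (gradTrace G D) ≤ 2 * normSq3 G D := by
  have e : (fun a => ∑ i, C i a • gradTrace G D i) = gradTrace 1 (pull3 C D) := by
    funext a; rw [gradTrace_pull hG]
  rw [normSq1_pull hG, e, normSq3_pull hG]
  generalize pull3 C D = E
  simp only [normSq3_one, normSq1_one, gradTrace, trace2_one, Fin.sum_univ_two]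
  nlinarith [norm_add_sq_le (E 0 0 0) (E 0 1 1), norm_add_sq_le (E 1 0 0) (E 1 1 1),
    sq_nonneg ‖E 0 0 1‖, sq_nonneg ‖E 0 1 0‖, sq_nonneg ‖E 1 0 1‖, sq_nonneg ‖E 1 1 0‖]

theorem pairing_inner_le (hG : G = C * 1 * C.transpose) (F : E4) (v : Fin 2 → E4) :
    pairing G (fun l => inner ℝ F (v l)) (fun l => inner ℝ F (v l)) ≤ ‖F‖ ^ 2 * normSq1 G v := by
  have e : pull1 C (fun l => inner ℝ F (v l)) = fun a => inner ℝ F (∑ i, C i a • v i) := by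
    funext a
    simp only [pull1, inner_sum, real_inner_smul_right]
  rw [pairing_pull hG, e, normSq1_pull hG, pairing_one, normSq1_one]
  nlinarith [real_inner_sq_le F (∑ i, C i 0 • v i), real_inner_sq_le F (∑ i, C i 1 • v i)]

/-- The trace part of h contributes ½⟨H, ∇ₗH⟩ to both terms of X and cancels, so h may be replaced
by Å. Then (x − y)² ≤ 2x² + 2y² and Cauchy–Schwarz give 2|Å|²(|∇A|² + |∇H|²), and |∇H|² ≤ 2|∇A|²
makes the constant 2 + 4 = 6. -/
theorem pairing_simonsCovector_le (hG : G = C * 1 * C.transpose) (h : Fin 2 → Fin 2 → E4)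
    (D : Fin 2 → Fin 2 → Fin 2 → E4) :
    pairing G (simonsCovector G h D) (simonsCovector G h D) ≤
      6 * (normSq2 G h - 1 / 2 * ‖trace2 G h‖ ^ 2) * normSq3 G D := by
  have e : pull1 C (simonsCovector G h D) = simonsCovector 1 (pull2 C h) (pull3 C D) := by
    funext a; rw [simonsCovector_pull hG]
  have hgr := normSq1_gradTrace_le (C := 1) (G := 1) (by simp) (pull3 C D)
  rw [pairing_pull hG, e, normSq2_pull hG, trace2_pull hG, normSq3_pull hG]
  generalize pull3 C D = E at *
  generalize pull2 C h = k at *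
  obtain ⟨a, ha⟩ : ∃ a : Fin 2 → Fin 2 → E4, a = fun i j =>
    k i j - ((1 / 2 : ℝ) * (1 : Matrix (Fin 2) (Fin 2) ℝ) i j) • trace2 1 k := ⟨_, rfl⟩
  have hS : normSq2 1 k - 1 / 2 * ‖trace2 1 k‖ ^ 2 = normSq2 1 a := by
    rw [ha, normSq2_traceless (C := 1) (by simp) (by simp)]
  have hX : ∀ l, simonsCovector 1 k E l = (∑ i, ∑ j, inner ℝ (a i j) (E l i j)) -
      ∑ j, inner ℝ (a l j) (gradTrace 1 E j) := by
    intro l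
    rw [ha]
    simp only [simonsCovector, gradTrace, trace2_one, Fin.sum_univ_two]
    rcases Fin.exists_fin_two.1 ⟨l, rfl⟩ with rfl | rfl <;>
    · simp [inner_sub_left, inner_add_right, real_inner_smul_left, inner_add_left]
      ring
  rw [hS]
  generalize gradTrace 1 E = t at *
  rw [pairing_one, hX, hX, normSq2_one]
  rw [normSq1_one] at hgr
  rw [normSq3_one] at *
  simp only [Fin.sum_univ_two] at *
  have p1 : ∀ l, (inner ℝ (a 0 0) (E l 0 0) + inner ℝ (a 0 1) (E l 0 1) +
      (inner ℝ (a 1 0) (E l 1 0) + inner ℝ (a 1 1) (E l 1 1))) ^ 2 ≤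
      (‖a 0 0‖ ^ 2 + ‖a 0 1‖ ^ 2 + (‖a 1 0‖ ^ 2 + ‖a 1 1‖ ^ 2)) *
      (‖E l 0 0‖ ^ 2 + ‖E l 0 1‖ ^ 2 + (‖E l 1 0‖ ^ 2 + ‖E l 1 1‖ ^ 2)) := by
    intro l
    apply add_sq_le_of_sq_le <;> first | positivity | skip
    all_goals apply add_sq_le_of_sq_le <;> first | positivity | exact real_inner_sq_le _ _
  have p2 : ∀ l, (inner ℝ (a l 0) (t 0) + inner ℝ (a l 1) (t 1)) ^ 2 ≤
      (‖a l 0‖ ^ 2 + ‖a l 1‖ ^ 2) * (‖t 0‖ ^ 2 + ‖t 1‖ ^ 2) := by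
    intro l
    apply add_sq_le_of_sq_le <;> first | positivity | exact real_inner_sq_le _ _
  have q : ∀ x y : ℝ, (x - y) * (x - y) ≤ 2 * x ^ 2 + 2 * y ^ 2 := fun x y => by
    nlinarith [sq_nonneg (x + y)]
  refine (add_le_add (q _ _) (q _ _)).trans ?_
  have r := mul_le_mul_of_nonneg_left hgr
    (by positivity : 0 ≤ ‖a 0 0‖ ^ 2 + ‖a 0 1‖ ^ 2 + ‖a 1 0‖ ^ 2 + ‖a 1 1‖ ^ 2)
  linarith [p1 0, p1 1, p2 0, p2 1]

/-- A positive definite matrix has an orthonormal basis of positive determinant. -/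
theorem exists_orthonormal_basis_matrix {a b c : ℝ} (ha : 0 < a) (hd : 0 < a * c - b ^ 2) :
    ∃ C : Matrix (Fin 2) (Fin 2) ℝ, C.transpose * !![a, b; b, c] * C = 1 := by
  have hs : 0 < Real.sqrt a := Real.sqrt_pos.2 ha
  have ht : 0 < Real.sqrt (a * c - b ^ 2) := Real.sqrt_pos.2 hd
  have hs2 := Real.sq_sqrt ha.le
  have ht2 := Real.sq_sqrt hd.le
  set s := Real.sqrt a
  set t := Real.sqrt (a * c - b ^ 2)
  -- The columns are the Gram–Schmidt orthonormalization of the coordinate basis.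
  refine ⟨!![1 / s, -b / (s * t); 0, s / t], ?_⟩
  ext i j
  fin_cases i <;> fin_cases j <;> simp [Matrix.mul_apply, Fin.sum_univ_two] <;> field_simp
  · exact hs2.symm
  · rw [hs2]; ring
  · left; rw [hs2]; ring
  · rw [hs2, ht2]; ring

end PointwiseInequalities

open Filter Topology

/-! ### Calculus of partial derivatives -/

section PartialDerivatives

variable {V W : Type*} [NormedAddCommGroup V] [NormedSpace ℝ V]
  [NormedAddCommGroup W] [InnerProductSpace ℝ W] {y : E2} {i j : Fin 2}

/-- `w` is smooth in a neighbourhood of `y`. -/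
def SmoothNear (w : E2 → V) (y : E2) : Prop := ∀ᶠ z in 𝓝 y, ContDiffAt ℝ ∞ w z

theorem SmoothNear.contDiffAt {w : E2 → V} (h : SmoothNear w y) : ContDiffAt ℝ ∞ w y := h.self_of_nhds

theorem SmoothNear.differentiableAt {w : E2 → V} (h : SmoothNear w y) : DifferentiableAt ℝ w y :=
  h.contDiffAt.differentiableAt (by simp)

theorem SmoothNear.eventually {w : E2 → V} (h : SmoothNear w y) : ∀ᶠ z in 𝓝 y, SmoothNear w z :=
  eventually_eventually_nhds.2 h

theorem SmoothNear.congr {w v : E2 → V} (h : SmoothNear w y) (hv : v =ᶠ[𝓝 y] w) :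
    SmoothNear v y := by
  filter_upwards [h, eventually_eventually_nhds.2 hv] with z hz hz'
  exact hz.congr_of_eventuallyEq hz'

theorem SmoothNear.pd {w : E2 → V} (h : SmoothNear w y) (i : Fin 2) :
    SmoothNear (SurfaceR4.pd i w) y := by
  filter_upwards [h] with z hz
  exact (hz.fderiv_right (m := ∞) (by simp)).clm_apply contDiffAt_const

theorem smoothNear_const (c : V) : SmoothNear (fun _ => c) y :=
  Eventually.of_forall fun _ => contDiffAt_const

theorem SmoothNear.add {w v : E2 → V} (hw : SmoothNear w y) (hv : SmoothNear v y) :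
    SmoothNear (fun z => w z + v z) y := by
  filter_upwards [hw, hv] with z h1 h2 using h1.add h2

theorem SmoothNear.sub {w v : E2 → V} (hw : SmoothNear w y) (hv : SmoothNear v y) :
    SmoothNear (fun z => w z - v z) y := by
  filter_upwards [hw, hv] with z h1 h2 using h1.sub h2

theorem SmoothNear.smul {f : E2 → ℝ} {v : E2 → V} (hf : SmoothNear f y) (hv : SmoothNear v y) :
    SmoothNear (fun z => f z • v z) y := by
  filter_upwards [hf, hv] with z h1 h2 using h1.smul h2

theorem SmoothNear.mul {f v : E2 → ℝ} (hf : SmoothNear f y) (hv : SmoothNear v y) :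
    SmoothNear (fun z => f z * v z) y := by
  filter_upwards [hf, hv] with z h1 h2 using h1.mul h2

theorem SmoothNear.inv {f : E2 → ℝ} (hf : SmoothNear f y) (h0 : f y ≠ 0) :
    SmoothNear (fun z => (f z)⁻¹) y := by
  filter_upwards [hf, hf.contDiffAt.continuousAt.eventually_ne h0] with z h1 h2 using h1.inv h2

theorem SmoothNear.sqrt {f : E2 → ℝ} (hf : SmoothNear f y) (h0 : f y ≠ 0) :
    SmoothNear (fun z => Real.sqrt (f z)) y := by
  filter_upwards [hf, hf.contDiffAt.continuousAt.eventually_ne h0] with z h1 h2 using h1.sqrt h2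

theorem SmoothNear.rpow {f : E2 → ℝ} (hf : SmoothNear f y) (h0 : f y ≠ 0) (q : ℝ) :
    SmoothNear (fun z => f z ^ q) y := by
  filter_upwards [hf, hf.contDiffAt.continuousAt.eventually_ne h0] with z h1 h2
    using h1.rpow_const_of_ne h2

theorem SmoothNear.inner {w v : E2 → W} (hw : SmoothNear w y) (hv : SmoothNear v y) :
    SmoothNear (fun z => inner ℝ (w z) (v z)) y := by
  filter_upwards [hw, hv] with z h1 h2 using h1.inner ℝ h2

theorem SmoothNear.sum {ι : Type*} {s : Finset ι} {w : ι → E2 → V} (hw : ∀ k, SmoothNear (w k) y) :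
    SmoothNear (fun z => ∑ k ∈ s, w k z) y := by
  classical
  induction s using Finset.induction_on with
  | empty => simpa using smoothNear_const 0
  | insert a s ha ih => simpa [Finset.sum_insert ha] using (hw a).add ih

theorem SmoothNear.comp {w : E2 → V} {φ : E2 → E2} (hw : SmoothNear w (φ y))
    (hφ : SmoothNear φ y) : SmoothNear (fun z => w (φ z)) y := by
  filter_upwards [hφ.contDiffAt.continuousAt.eventually hw, hφ] with z h1 h2
  exact h1.comp z h2

theorem SmoothNear.apply {n : ℕ} {φ : E2 → EuclideanSpace ℝ (Fin n)} (hφ : SmoothNear φ y)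
    (a : Fin n) : SmoothNear (fun z => φ z a) y := by
  filter_upwards [hφ] with z h1
  exact (contDiffAt_piLp_apply (p := 2)).comp z h1

theorem pd_congr {w v : E2 → V} (h : w =ᶠ[𝓝 y] v) (i : Fin 2) :
    SurfaceR4.pd i w y = SurfaceR4.pd i v y := by
  simp only [pd, h.fderiv_eq]

theorem pd_congr_eventually {w v : E2 → V} (h : w =ᶠ[𝓝 y] v) (i : Fin 2) :
    SurfaceR4.pd i w =ᶠ[𝓝 y] SurfaceR4.pd i v := by
  filter_upwards [eventually_eventually_nhds.2 h] with z hz using pd_congr hz i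

theorem pd_const (c : V) : pd i (fun _ => c) y = 0 := by
  simp [pd]

theorem pd_add {w v : E2 → V} (hw : DifferentiableAt ℝ w y) (hv : DifferentiableAt ℝ v y) :
    pd i (fun z => w z + v z) y = pd i w y + pd i v y := by
  simp only [pd]; rw [fderiv_fun_add hw hv]; rfl

theorem pd_sub {w v : E2 → V} (hw : DifferentiableAt ℝ w y) (hv : DifferentiableAt ℝ v y) :
    pd i (fun z => w z - v z) y = pd i w y - pd i v y := by
  simp only [pd]; rw [fderiv_fun_sub hw hv]; rfl

theorem pd_smul {f : E2 → ℝ} {v : E2 → V} (hf : DifferentiableAt ℝ f y)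
    (hv : DifferentiableAt ℝ v y) :
    pd i (fun z => f z • v z) y = f y • pd i v y + pd i f y • v y := by
  simp only [pd]; rw [fderiv_fun_smul hf hv]; simp

theorem pd_mul {f v : E2 → ℝ} (hf : DifferentiableAt ℝ f y) (hv : DifferentiableAt ℝ v y) :
    pd i (fun z => f z * v z) y = f y * pd i v y + pd i f y * v y :=
  pd_smul hf hv

theorem pd_inner {w v : E2 → W} (hw : DifferentiableAt ℝ w y) (hv : DifferentiableAt ℝ v y) :
    pd i (fun z => inner ℝ (w z) (v z)) y = inner ℝ (w y) (pd i v y) + inner ℝ (pd i w y) (v y) := by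
  simp only [pd]; rw [fderiv_inner_apply ℝ hw hv]

theorem pd_sum {ι : Type*} {s : Finset ι} {w : ι → E2 → V}
    (hw : ∀ k ∈ s, DifferentiableAt ℝ (w k) y) :
    pd i (fun z => ∑ k ∈ s, w k z) y = ∑ k ∈ s, pd i (w k) y := by
  simp only [pd]; rw [fderiv_fun_sum hw]; simp

theorem pd_apply {n : ℕ} {φ : E2 → EuclideanSpace ℝ (Fin n)} (hφ : DifferentiableAt ℝ φ y)
    (a : Fin n) : pd i (fun z => φ z a) y = pd i φ y a := by
  have h := (EuclideanSpace.proj (𝕜 := ℝ) a).hasFDerivAt.comp y hφ.hasFDerivAt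
  simp only [pd]
  have h' : HasFDerivAt (fun z => φ z a) ((EuclideanSpace.proj (𝕜 := ℝ) a).comp (fderiv ℝ φ y)) y := h
  rw [h'.fderiv]; rfl

theorem two_le_infty : (2 : WithTop ℕ∞) ≤ ∞ := by
  exact (WithTop.coe_le_coe.2 (le_top : (2 : ℕ∞) ≤ ⊤))

theorem pd_comm {w : E2 → V} (hw : SmoothNear w y) (i j : Fin 2) :
    pd i (pd j w) y = pd j (pd i w) y := by
  have h1 : DifferentiableAt ℝ (fderiv ℝ w) y :=
    (hw.contDiffAt.fderiv_right (m := 1)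
      (by rw [one_add_one_eq_two]; exact two_le_infty)).differentiableAt (by simp)
  have h2 : ∀ i j : Fin 2, pd i (pd j w) y =
      fderiv ℝ (fderiv ℝ w) y (EuclideanSpace.single i 1) (EuclideanSpace.single j 1) := by
    intro i j
    have := (h1.hasFDerivAt.clm_apply
      (hasFDerivAt_const (EuclideanSpace.single j (1 : ℝ) : E2) y)).fderiv
    change fderiv ℝ (fun z => fderiv ℝ w z (EuclideanSpace.single j 1)) y _ = _
    rw [this]; simp
  rw [h2, h2]
  exact (hw.contDiffAt.isSymmSndFDerivAt (by simpa using two_le_infty)) _ _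

theorem fderiv_apply_eq_sum_pd (w : E2 → V) (y v : E2) :
    fderiv ℝ w y v = ∑ a, v a • pd a w y := by
  have : v = ∑ a, v a • (EuclideanSpace.single a (1 : ℝ) : E2) := by
    ext k; fin_cases k <;> simp
  conv_lhs => rw [this, map_sum]
  simp [pd]

theorem pd_comp {w : E2 → V} {φ : E2 → E2} (hw : DifferentiableAt ℝ w (φ y))
    (hφ : DifferentiableAt ℝ φ y) :
    pd i (fun z => w (φ z)) y = ∑ a, pd i φ y a • pd a w (φ y) := by
  have := fderiv_fun_comp y hw hφ
  simp only [pd] at this ⊢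
  rw [this, ContinuousLinearMap.comp_apply, fderiv_apply_eq_sum_pd]
  rfl

end PartialDerivatives

/-! ### Regular parametrizations -/

/-- `u` is a smooth immersion near `y`. -/
structure IsRegularAt (u : E2 → E4) (y : E2) : Prop where
  smooth : SmoothNear u y
  inj : Function.Injective (fderiv ℝ u y)

section Regular

variable {u : E2 → E4} {y : E2}

theorem metric_comm (u : E2 → E4) (y : E2) (i j : Fin 2) : metric u y i j = metric u y j i := by
  simp [metric, real_inner_comm]

theorem SmoothNear.metric (h : SmoothNear u y) (i j : Fin 2) :
    SmoothNear (fun z => SurfaceR4.metric u z i j) y := by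
  simp only [SurfaceR4.metric, Matrix.of_apply]
  exact (h.pd i).inner (h.pd j)

theorem SmoothNear.det_metric (h : SmoothNear u y) :
    SmoothNear (fun z => (SurfaceR4.metric u z).det) y := by
  simp only [Matrix.det_fin_two]
  exact ((h.metric 0 0).mul (h.metric 1 1)).sub ((h.metric 0 1).mul (h.metric 1 0))

theorem metric_zero_zero_pos (h : Function.Injective (fderiv ℝ u y)) : 0 < metric u y 0 0 := by
  simp only [metric, Matrix.of_apply]
  rw [real_inner_self_eq_norm_sq]
  have : pd 0 u y ≠ 0 := by
    intro h0
    have := h (h0.trans (map_zero _).symm)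
    simpa using congrArg (fun v : E2 => v 0) this
  positivity

/-- The vector g₀₀ ∂₁u − g₀₁ ∂₀u is nonzero by injectivity, and its squared norm is g₀₀ det g. -/
theorem det_metric_pos (h : Function.Injective (fderiv ℝ u y)) : 0 < (metric u y).det := by
  have h0 := metric_zero_zero_pos h
  have hv : fderiv ℝ u y (metric u y 0 0 • EuclideanSpace.single 1 (1 : ℝ)
      - metric u y 0 1 • EuclideanSpace.single 0 (1 : ℝ)) =
      metric u y 0 0 • pd 1 u y - metric u y 0 1 • pd 0 u y := by
    simp [pd]
  have hne : metric u y 0 0 • pd 1 u y - metric u y 0 1 • pd 0 u y ≠ 0 := by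
    rw [← hv]
    intro h1
    have := h (h1.trans (map_zero _).symm)
    have := congrArg (fun v : E2 => v 1) this
    simp at this
    exact h0.ne' this
  have hn : ‖metric u y 0 0 • pd 1 u y - metric u y 0 1 • pd 0 u y‖ ^ 2 =
      metric u y 0 0 * (metric u y).det := by
    rw [← real_inner_self_eq_norm_sq, Matrix.det_fin_two]
    simp only [metric, Matrix.of_apply, inner_sub_left, inner_sub_right, real_inner_smul_left,
      real_inner_smul_right, real_inner_comm (pd 0 u y) (pd 1 u y)]
    ring
  have : 0 < metric u y 0 0 * (metric u y).det := by rw [← hn]; positivity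
  exact (pos_iff_pos_of_mul_pos this).1 h0

/-- Together with `det_metric_pos` this expresses immersivity by the continuous function det g,
which makes regularity an open condition. -/
theorem injective_of_det_metric_ne_zero (h : (metric u y).det ≠ 0) :
    Function.Injective (fderiv ℝ u y) := by
  rw [injective_iff_map_eq_zero]
  intro v hv
  rw [fderiv_apply_eq_sum_pd, Fin.sum_univ_two] at hv
  have e : ∀ k, v 0 * metric u y 0 k + v 1 * metric u y 1 k = 0 := by
    intro k
    have := congrArg (fun z => inner ℝ z (pd k u y)) hv
    simpa [inner_add_left, real_inner_smul_left, metric] using this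
  rw [Matrix.det_fin_two] at h
  have h0 := e 0
  have h1 := e 1
  ext k
  fin_cases k
  · simp only [Fin.zero_eta, PiLp.zero_apply]
    have : v 0 * (metric u y 0 0 * metric u y 1 1 - metric u y 0 1 * metric u y 1 0) = 0 := by
      linear_combination metric u y 1 1 * h0 - metric u y 1 0 * h1
    exact (mul_eq_zero.1 this).resolve_right h
  · simp only [Fin.mk_one, PiLp.zero_apply]
    have : v 1 * (metric u y 0 0 * metric u y 1 1 - metric u y 0 1 * metric u y 1 0) = 0 := by
      linear_combination - metric u y 0 1 * h0 + metric u y 0 0 * h1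
    exact (mul_eq_zero.1 this).resolve_right h

namespace IsRegularAt

theorem det_pos (h : IsRegularAt u y) : 0 < (metric u y).det := det_metric_pos h.inj

theorem eventually (h : IsRegularAt u y) : ∀ᶠ z in 𝓝 y, IsRegularAt u z := by
  filter_upwards [h.smooth.eventually,
    h.smooth.det_metric.contDiffAt.continuousAt.eventually_ne h.det_pos.ne'] with z h1 h2
  exact ⟨h1, injective_of_det_metric_ne_zero h2⟩

theorem isUnit_det (h : IsRegularAt u y) : IsUnit (metric u y).det := h.det_pos.ne'.isUnit

theorem invMetric_mul (h : IsRegularAt u y) : invMetric u y * metric u y = 1 :=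
  Matrix.nonsing_inv_mul _ h.isUnit_det

theorem mul_invMetric (h : IsRegularAt u y) : metric u y * invMetric u y = 1 :=
  Matrix.mul_nonsing_inv _ h.isUnit_det

theorem exists_frame (h : IsRegularAt u y) : ∃ C : Matrix (Fin 2) (Fin 2) ℝ,
    C.transpose * metric u y * C = 1 ∧ invMetric u y = C * 1 * C.transpose := by
  have e : metric u y = !![metric u y 0 0, metric u y 0 1; metric u y 0 1, metric u y 1 1] := by
    ext i j; fin_cases i <;> fin_cases j <;> simp [metric_comm u y 1 0]
  have hd := h.det_pos
  rw [Matrix.det_fin_two, metric_comm u y 1 0] at hd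
  obtain ⟨C, hC⟩ := exists_orthonormal_basis_matrix (metric_zero_zero_pos h.inj)
    (c := metric u y 1 1) (b := metric u y 0 1) (by linarith)
  rw [← e] at hC
  refine ⟨C, hC, ?_⟩
  have h1 : C * (C.transpose * metric u y) = 1 := mul_eq_one_comm.1 hC
  rw [invMetric, mul_one]
  exact Matrix.inv_eq_left_inv (by rw [mul_assoc, h1])

end IsRegularAt

theorem invMetric_comm (u : E2 → E4) (y : E2) (i j : Fin 2) :
    invMetric u y i j = invMetric u y j i := by
  have : (invMetric u y).transpose = invMetric u y := by
    rw [invMetric, Matrix.transpose_nonsing_inv]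
    congr 1
    ext i j
    exact metric_comm u y j i
  exact congrFun (congrFun this j) i

theorem IsRegularAt.smooth_invMetric (h : IsRegularAt u y) (i j : Fin 2) :
    SmoothNear (fun z => invMetric u z i j) y := by
  have h2 := h.smooth.det_metric.inv h.det_pos.ne'
  have m1 : SmoothNear (fun _ => (-1 : ℝ)) y := smoothNear_const _
  simp only [invMetric, Matrix.inv_def, Matrix.adjugate_fin_two, Ring.inverse_eq_inv']
  fin_cases i <;> fin_cases j <;> simp
  · exact h2.mul (h.smooth.metric 1 1)
  · simpa using m1.mul (h2.mul (h.smooth.metric 0 1))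
  · simpa using m1.mul (h2.mul (h.smooth.metric 1 0))
  · exact h2.mul (h.smooth.metric 0 0)

theorem smooth_normalPart (h : IsRegularAt u y) {v : E2 → E4} (hv : SmoothNear v y) :
    SmoothNear (fun z => normalPart u z (v z)) y := by
  simp only [normalPart]
  exact hv.sub <| .sum fun k => .sum fun l =>
    ((h.smooth_invMetric k l).mul (hv.inner (h.smooth.pd k))).smul (h.smooth.pd l)

theorem IsRegularAt.smooth_secondFF (h : IsRegularAt u y) (i j : Fin 2) :
    SmoothNear (secondFF u i j) y :=
  smooth_normalPart h ((h.smooth.pd j).pd i)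

theorem IsRegularAt.smooth_christoffel (h : IsRegularAt u y) (k i j : Fin 2) :
    SmoothNear (christoffel u k i j) y := by
  unfold christoffel
  refine (smoothNear_const _).mul <| .sum fun l => (h.smooth_invMetric k l).mul ?_
  exact (((h.smooth.metric j l).pd i).add ((h.smooth.metric i l).pd j)).sub
    ((h.smooth.metric i j).pd l)

theorem IsRegularAt.smooth_covSecondFF (h : IsRegularAt u y) (k i j : Fin 2) :
    SmoothNear (covSecondFF u k i j) y := by
  unfold covSecondFF
  exact ((smooth_normalPart h ((h.smooth_secondFF i j).pd k)).sub
    (.sum fun l => (h.smooth_christoffel l k i).smul (h.smooth_secondFF l j))).sub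
    (.sum fun l => (h.smooth_christoffel l k j).smul (h.smooth_secondFF i l))

theorem normalPart_add (u : E2 → E4) (y : E2) (v w : E4) :
    normalPart u y (v + w) = normalPart u y v + normalPart u y w := by
  simp only [normalPart, inner_add_left, Fin.sum_univ_two]; module

theorem normalPart_sub (u : E2 → E4) (y : E2) (v w : E4) :
    normalPart u y (v - w) = normalPart u y v - normalPart u y w := by
  simp only [normalPart, inner_sub_left, Fin.sum_univ_two]; module

theorem normalPart_smul (u : E2 → E4) (y : E2) (c : ℝ) (v : E4) :
    normalPart u y (c • v) = c • normalPart u y v := by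
  simp only [normalPart, real_inner_smul_left, Fin.sum_univ_two]; module

theorem IsRegularAt.inner_normalPart (h : IsRegularAt u y) (v : E4) (k : Fin 2) :
    inner ℝ (normalPart u y v) (pd k u y) = 0 := by
  have h1 := h.invMetric_mul
  have e : ∀ i, ∑ l, invMetric u y i l * inner ℝ (pd l u y) (pd k u y) =
      (1 : Matrix (Fin 2) (Fin 2) ℝ) i k := by
    intro i; rw [← h1, Matrix.mul_apply]; rfl
  have e2 : inner ℝ (normalPart u y v) (pd k u y) = inner ℝ v (pd k u y) -
      ∑ i, inner ℝ v (pd i u y) * ∑ l, invMetric u y i l * inner ℝ (pd l u y) (pd k u y) := by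
    simp only [normalPart, inner_sub_left, sum_inner, real_inner_smul_left, Finset.mul_sum]
    congr 1
    refine Finset.sum_congr rfl fun _ _ => Finset.sum_congr rfl fun _ _ => ?_
    ring
  rw [e2]
  simp only [e]
  simp [Matrix.one_apply]

theorem normalPart_of_inner_eq_zero {v : E4} (h : ∀ k, inner ℝ v (pd k u y) = 0) :
    normalPart u y v = v := by
  simp [normalPart, h]

theorem IsRegularAt.normalPart_pd (h : IsRegularAt u y) (k : Fin 2) :
    normalPart u y (pd k u y) = 0 := by
  have h1 := h.mul_invMetric
  have e : ∀ l, ∑ i, inner ℝ (pd k u y) (pd i u y) * invMetric u y i l =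
      (1 : Matrix (Fin 2) (Fin 2) ℝ) k l := by
    intro l; rw [← h1, Matrix.mul_apply]; rfl
  have e2 : normalPart u y (pd k u y) = pd k u y -
      ∑ l, (∑ i, inner ℝ (pd k u y) (pd i u y) * invMetric u y i l) • pd l u y := by
    simp only [normalPart, Fin.sum_univ_two]; module
  rw [e2]
  simp only [e]
  simp [Matrix.one_apply]

theorem IsRegularAt.normalPart_secondFF (h : IsRegularAt u y) (i j : Fin 2) :
    normalPart u y (secondFF u i j y) = secondFF u i j y :=
  normalPart_of_inner_eq_zero fun k => h.inner_normalPart _ k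

theorem secondFF_comm (h : SmoothNear u y) (i j : Fin 2) :
    secondFF u i j y = secondFF u j i y := by
  simp only [secondFF, pd_comm h i j]

/-- For an induced metric the Koszul combination collapses, by symmetry of second derivatives, to
the tangential coefficients of ∂ᵢ∂ⱼu. The Gauss formula `secondFF_eq` follows. -/
theorem christoffel_eq (h : SmoothNear u y) (k i j : Fin 2) :
    christoffel u k i j y = ∑ l, invMetric u y k l * inner ℝ (pd i (pd j u) y) (pd l u y) := by
  have e : ∀ i j l, pd i (fun z => metric u z j l) y =
      inner ℝ (pd j u y) (pd i (pd l u) y) + inner ℝ (pd i (pd j u) y) (pd l u y) := by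
    intro i j l
    exact pd_inner (h.pd j).differentiableAt (h.pd l).differentiableAt
  simp only [christoffel, e]
  rw [Finset.mul_sum]
  refine Finset.sum_congr rfl fun l _ => ?_
  rw [pd_comm h j i, pd_comm h l i, pd_comm h l j, real_inner_comm (pd i (pd l u) y),
    real_inner_comm (pd j (pd l u) y)]
  ring

theorem secondFF_eq (h : SmoothNear u y) (i j : Fin 2) :
    secondFF u i j y = pd i (pd j u) y - ∑ m, christoffel u m i j y • pd m u y := by
  simp only [secondFF, normalPart, christoffel_eq h, Fin.sum_univ_two, invMetric_comm u y 1 0]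
  module

/-- Differentiate the Gauss formula and project: derivatives of Christoffel symbols multiply tangent
vectors and disappear. What is left involves third derivatives of u and undifferentiated Christoffel
symbols, so one further derivative is easy where these symbols vanish. -/
theorem IsRegularAt.covSecondFF_eq (h : IsRegularAt u y) (k i j : Fin 2) :
    covSecondFF u k i j y = normalPart u y (pd k (pd i (pd j u)) y) -
      ∑ m, (christoffel u m i j y • secondFF u k m y + christoffel u m k i y • secondFF u m j y
        + christoffel u m k j y • secondFF u i m y) := by
  have e : secondFF u i j =ᶠ[𝓝 y] fun z =>
      pd i (pd j u) z - ∑ m, christoffel u m i j z • pd m u z := by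
    filter_upwards [h.smooth.eventually] with z hz using secondFF_eq hz i j
  have d : ∀ m, SmoothNear (fun z => christoffel u m i j z • pd m u z) y := fun m =>
    (h.smooth_christoffel m i j).smul (h.smooth.pd m)
  rw [covSecondFF, pd_congr e, pd_sub ((h.smooth.pd j).pd i).differentiableAt
    (SmoothNear.sum d).differentiableAt, pd_sum fun m _ => (d m).differentiableAt]
  simp only [pd_smul (h.smooth_christoffel _ i j).differentiableAt (h.smooth.pd _).differentiableAt]
  simp only [Fin.sum_univ_two, normalPart_sub, normalPart_add, normalPart_smul, h.normalPart_pd]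
  simp only [secondFF]
  module

end Regular

section Reparametrization

/-! ### Change of parameters -/

/-- Jacobian matrix `J a i = ∂_i φ^a`. -/
def jac (φ : E2 → E2) (y : E2) : Matrix (Fin 2) (Fin 2) ℝ := Matrix.of fun a i => pd i φ y a

/-- `v` is the immersion `u` reparametrized by `φ` near `y`. -/
structure IsReparam (u v : E2 → E4) (φ : E2 → E2) (y : E2) : Prop where
  regular : IsRegularAt u (φ y)
  smooth : SmoothNear φ y
  regular' : IsRegularAt v y
  eq : v =ᶠ[𝓝 y] fun z => u (φ z)

namespace IsReparam

variable {u v : E2 → E4} {φ : E2 → E2} {y : E2}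

theorem eventually (h : IsReparam u v φ y) : ∀ᶠ z in 𝓝 y, IsReparam u v φ z := by
  filter_upwards [h.smooth.contDiffAt.continuousAt.eventually h.regular.eventually,
    h.smooth.eventually, h.regular'.eventually, eventually_eventually_nhds.2 h.eq] with z h1 h2 h3 h4
  exact ⟨h1, h2, h3, h4⟩

theorem jac_smooth (h : IsReparam u v φ y) (a i : Fin 2) : SmoothNear (fun z => jac φ z a i) y :=
  (h.smooth.pd i).apply a

theorem pd_comp (h : IsReparam u v φ y) {V : Type*} [NormedAddCommGroup V] [NormedSpace ℝ V]
    {w : E2 → V} (hw : DifferentiableAt ℝ w (φ y)) (i : Fin 2) :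
    pd i (fun z => w (φ z)) y = ∑ a, jac φ y a i • pd a w (φ y) :=
  SurfaceR4.pd_comp hw h.smooth.differentiableAt

theorem pd_eq (h : IsReparam u v φ y) (i : Fin 2) :
    pd i v y = ∑ a, jac φ y a i • pd a u (φ y) := by
  rw [pd_congr h.eq, h.pd_comp h.regular.smooth.differentiableAt]

theorem metric_eq (h : IsReparam u v φ y) :
    metric v y = (jac φ y).transpose * metric u (φ y) * jac φ y := by
  ext i j
  simp only [metric, Matrix.of_apply, h.pd_eq, Matrix.mul_apply, Matrix.transpose_apply,
    Fin.sum_univ_two, inner_add_left, inner_add_right, real_inner_smul_left, real_inner_smul_right]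
  ring

theorem det_metric_eq (h : IsReparam u v φ y) :
    (metric v y).det = (jac φ y).det ^ 2 * (metric u (φ y)).det := by
  rw [h.metric_eq, Matrix.det_mul, Matrix.det_mul, Matrix.det_transpose]; ring

theorem det_jac_ne_zero (h : IsReparam u v φ y) : (jac φ y).det ≠ 0 := by
  intro h0
  have := h.regular'.det_pos
  rw [h.det_metric_eq, h0] at this
  simp at this

theorem sqrt_det_metric_eq (h : IsReparam u v φ y) :
    Real.sqrt (metric v y).det = |(jac φ y).det| * Real.sqrt (metric u (φ y)).det := by
  rw [h.det_metric_eq, Real.sqrt_mul (sq_nonneg _), Real.sqrt_sq_eq_abs]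

theorem invMetric_eq (h : IsReparam u v φ y) :
    invMetric u (φ y) = jac φ y * invMetric v y * (jac φ y).transpose := by
  have hJ : IsUnit (jac φ y).det := h.det_jac_ne_zero.isUnit
  have hJt : IsUnit (jac φ y).transpose.det := by rwa [Matrix.det_transpose]
  rw [invMetric, invMetric, h.metric_eq, Matrix.mul_inv_rev, Matrix.mul_inv_rev]
  rw [← mul_assoc, Matrix.mul_nonsing_inv _ hJ, one_mul,
    Matrix.nonsing_inv_mul_cancel_right _ _ hJt]

theorem invMetric_mul_jac (h : IsReparam u v φ y) (a b : Fin 2) :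
    invMetric u (φ y) a b = ∑ l, ∑ m, jac φ y a l * jac φ y b m * invMetric v y l m := by
  simp only [h.invMetric_eq, Matrix.mul_apply, Matrix.transpose_apply, Fin.sum_univ_two]
  ring

theorem normalPart_eq (h : IsReparam u v φ y) (x : E4) :
    normalPart v y x = normalPart u (φ y) x := by
  simp only [normalPart, h.invMetric_mul_jac, h.pd_eq]
  simp only [Fin.sum_univ_two, inner_add_right, real_inner_smul_right]
  module

theorem pd_pd_eq (h : IsReparam u v φ y) (i j : Fin 2) :
    pd i (pd j v) y = ∑ a, pd i (fun z => jac φ z a j) y • pd a u (φ y) +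
      ∑ a, ∑ b, (jac φ y a i * jac φ y b j) • pd a (pd b u) (φ y) := by
  have e : pd j v =ᶠ[𝓝 y] fun z => ∑ a, jac φ z a j • pd a u (φ z) := by
    filter_upwards [h.eventually] with z hz using hz.pd_eq j
  have hu : ∀ a, SmoothNear (fun z => pd a u (φ z)) y := fun a =>
    (h.regular.smooth.pd a).comp h.smooth
  rw [pd_congr e, pd_sum fun a _ => ((h.jac_smooth a j).smul (hu a)).differentiableAt]
  simp only [pd_smul (h.jac_smooth _ j).differentiableAt (hu _).differentiableAt,
    h.pd_comp (h.regular.smooth.pd _).differentiableAt, Fin.sum_univ_two]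
  module

theorem pd_jac_comm (h : IsReparam u v φ y) (a i j : Fin 2) :
    pd i (fun z => jac φ z a j) y = pd j (fun z => jac φ z a i) y := by
  have e : ∀ i j, pd i (fun z => jac φ z a j) y = pd i (pd j φ) y a := fun i j =>
    pd_apply (h.smooth.pd j).differentiableAt a
  rw [e, e, pd_comm h.smooth]

theorem secondFF_eq (h : IsReparam u v φ y) (i j : Fin 2) :
    secondFF v i j y = pull2 (jac φ y) (fun a b => secondFF u a b (φ y)) i j := by
  simp only [secondFF, h.normalPart_eq, h.pd_pd_eq, pull2, Fin.sum_univ_two, normalPart_add,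
    normalPart_smul, h.regular.normalPart_pd]
  module

/-- The inhomogeneous transformation law of a connection. Its second-derivative term is the one that
cancels the derivatives of the Jacobian in `covSecondFF_eq`, which makes ∇A a tensor. -/
theorem christoffel_eq (h : IsReparam u v φ y) (a i j : Fin 2) :
    ∑ l, jac φ y a l * christoffel v l i j y = pd i (fun z => jac φ z a j) y +
      ∑ b, ∑ c, jac φ y b i * jac φ y c j * christoffel u a b c (φ y) := by
  have h1 := h.regular.mul_invMetric
  have e : ∀ c, ∑ b, invMetric u (φ y) a b * inner ℝ (pd c u (φ y)) (pd b u (φ y)) =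
      (1 : Matrix (Fin 2) (Fin 2) ℝ) c a := by
    intro c
    rw [← h1, Matrix.mul_apply]
    refine Finset.sum_congr rfl fun b _ => ?_
    rw [invMetric_comm, mul_comm]; rfl
  have e2 : ∑ l, jac φ y a l * christoffel v l i j y =
      ∑ b, invMetric u (φ y) a b * inner ℝ (pd i (pd j v) y) (pd b u (φ y)) := by
    simp only [SurfaceR4.christoffel_eq h.regular'.smooth, h.pd_eq, h.invMetric_mul_jac,
      Fin.sum_univ_two, inner_add_right, real_inner_smul_right]
    ring
  have e3 : ∑ c, pd i (fun z => jac φ z c j) y * (1 : Matrix (Fin 2) (Fin 2) ℝ) c a =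
      pd i (fun z => jac φ z a j) y := by
    simp [Matrix.one_apply]
  rw [e2, h.pd_pd_eq, ← e3]
  simp only [← e, SurfaceR4.christoffel_eq h.regular.smooth]
  simp only [Fin.sum_univ_two, inner_add_left, real_inner_smul_left]
  ring

theorem covSecondFF_eq (h : IsReparam u v φ y) (k i j : Fin 2) :
    covSecondFF v k i j y = pull3 (jac φ y) (fun c a b => covSecondFF u c a b (φ y)) k i j := by
  have e : secondFF v i j =ᶠ[𝓝 y] fun z =>
      ∑ a, ∑ b, (jac φ z a i * jac φ z b j) • secondFF u a b (φ z) := by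
    filter_upwards [h.eventually] with z hz using hz.secondFF_eq i j
  have hu : ∀ a b, SmoothNear (fun z => secondFF u a b (φ z)) y := fun a b =>
    (h.regular.smooth_secondFF a b).comp h.smooth
  have hJ : ∀ a b, SmoothNear (fun z => jac φ z a i * jac φ z b j) y := fun a b =>
    (h.jac_smooth a i).mul (h.jac_smooth b j)
  have e1 : pd k (secondFF v i j) y = ∑ a, ∑ b,
      ((jac φ y a i * jac φ y b j) • (∑ c, jac φ y c k • pd c (secondFF u a b) (φ y)) +
      (jac φ y a i * pd k (fun z => jac φ z b j) y + pd k (fun z => jac φ z a i) y * jac φ y b j) •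
        secondFF u a b (φ y)) := by
    rw [pd_congr e, pd_sum fun a _ => (SmoothNear.sum fun b => (hJ a b).smul (hu a b)).differentiableAt]
    refine Finset.sum_congr rfl fun a _ => ?_
    rw [pd_sum fun b _ => ((hJ a b).smul (hu a b)).differentiableAt]
    refine Finset.sum_congr rfl fun b _ => ?_
    rw [pd_smul (hJ a b).differentiableAt (hu a b).differentiableAt,
      pd_mul (h.jac_smooth a i).differentiableAt (h.jac_smooth b j).differentiableAt,
      h.pd_comp (h.regular.smooth_secondFF a b).differentiableAt]
  have e2 : ∀ i j, ∑ l, christoffel v l k i y • secondFF v l j y =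
      ∑ b, jac φ y b j • ∑ a, (∑ l, jac φ y a l * christoffel v l k i y) •
        secondFF u a b (φ y) := by
    intro i j
    simp only [h.secondFF_eq, pull2, Fin.sum_univ_two]
    module
  have e3 : ∑ l, christoffel v l k j y • secondFF v i l y =
      ∑ a, jac φ y a i • ∑ b, (∑ l, jac φ y b l * christoffel v l k j y) •
        secondFF u a b (φ y) := by
    simp only [h.secondFF_eq, pull2, Fin.sum_univ_two]
    module
  rw [covSecondFF, e2, e3, e1, h.normalPart_eq]
  simp only [h.christoffel_eq, covSecondFF, pull3]
  simp only [Fin.sum_univ_two, normalPart_add, normalPart_smul, h.regular.normalPart_secondFF]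
  module

end IsReparam

end Reparametrization

/-! ### The divergence form of the contracted Simons identity -/

/-- The covector `½ ∇|A|² - ⟨A, ∇H⟩` of a parametrization. -/
def simonsField (u : E2 → E4) (l : Fin 2) (y : E2) : ℝ :=
  simonsCovector (invMetric u y) (fun i j => secondFF u i j y)
    (fun k i j => covSecondFF u k i j y) l

/-- Density of the vector field dual to `simonsField`. -/
def simonsFlux (u : E2 → E4) (i : Fin 2) (y : E2) : ℝ :=
  Real.sqrt (metric u y).det * ∑ l, invMetric u y i l * simonsField u l y

/-- `Z + |∇A|² - |∇H|²`. -/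
def simonsDiv (u : E2 → E4) (y : E2) : ℝ :=
  simonsZ (invMetric u y) (fun i j => secondFF u i j y)
    + normSq3 (invMetric u y) (fun k i j => covSecondFF u k i j y)
    - normSq1 (invMetric u y) (gradTrace (invMetric u y) fun k i j => covSecondFF u k i j y)

section Flux

variable {u v : E2 → E4} {φ : E2 → E2} {y : E2}

theorem IsRegularAt.smooth_gradTrace (h : IsRegularAt u y) (k : Fin 2) :
    SmoothNear (fun z => gradTrace (invMetric u z) (fun k i j => covSecondFF u k i j z) k) y := by
  unfold gradTrace trace2
  exact .sum fun i => .sum fun j => (h.smooth_invMetric i j).smul (h.smooth_covSecondFF k i j)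

theorem IsRegularAt.smooth_simonsField (h : IsRegularAt u y) (l : Fin 2) :
    SmoothNear (simonsField u l) y := by
  unfold simonsField simonsCovector
  refine SmoothNear.sub (.sum fun i => .sum fun j => .sum fun a => .sum fun b => ?_)
    (.sum fun j => .sum fun k => ?_)
  · exact ((h.smooth_invMetric i a).mul (h.smooth_invMetric j b)).mul
      ((h.smooth_secondFF i j).inner (h.smooth_covSecondFF l a b))
  · exact (h.smooth_invMetric j k).mul ((h.smooth_secondFF l j).inner (h.smooth_gradTrace k))

theorem IsRegularAt.smooth_sqrt_det (h : IsRegularAt u y) :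
    SmoothNear (fun z => Real.sqrt (metric u z).det) y :=
  h.smooth.det_metric.sqrt h.det_pos.ne'

theorem IsRegularAt.smooth_simonsFlux (h : IsRegularAt u y) (i : Fin 2) :
    SmoothNear (simonsFlux u i) y :=
  h.smooth_sqrt_det.mul <| .sum fun l => (h.smooth_invMetric i l).mul (h.smooth_simonsField l)

namespace IsReparam

theorem simonsField_eq (h : IsReparam u v φ y) (l : Fin 2) :
    simonsField v l y = pull1 (jac φ y) (fun m => simonsField u m (φ y)) l := by
  have := simonsCovector_pull h.invMetric_eq (fun i j => secondFF u i j (φ y))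
    (fun k i j => covSecondFF u k i j (φ y)) l
  simp only [simonsField, ← this]
  congr 1
  · funext i j; exact h.secondFF_eq i j
  · funext k i j; exact h.covSecondFF_eq k i j

theorem secondFF_fun_eq (h : IsReparam u v φ y) : (fun i j => secondFF v i j y) =
    pull2 (jac φ y) (fun i j => secondFF u i j (φ y)) := by
  funext i j; exact h.secondFF_eq i j

theorem covSecondFF_fun_eq (h : IsReparam u v φ y) : (fun k i j => covSecondFF v k i j y) =
    pull3 (jac φ y) (fun k i j => covSecondFF u k i j (φ y)) := by
  funext k i j; exact h.covSecondFF_eq k i j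

theorem simonsDiv_eq (h : IsReparam u v φ y) : simonsDiv v y = simonsDiv u (φ y) := by
  have e : gradTrace (invMetric v y) (pull3 (jac φ y) (fun k i j => covSecondFF u k i j (φ y))) =
      fun a => ∑ i, jac φ y i a •
        gradTrace (invMetric u (φ y)) (fun k i j => covSecondFF u k i j (φ y)) i := by
    funext k; rw [gradTrace_pull h.invMetric_eq]
  rw [simonsDiv, simonsDiv, simonsZ_pull h.invMetric_eq, normSq3_pull h.invMetric_eq,
    normSq1_pull h.invMetric_eq, h.secondFF_fun_eq, h.covSecondFF_fun_eq, e]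

/-- The flux is a vector field times the area density, so it transforms as a vector density of
weight one. -/
theorem jac_mul_simonsFlux (h : IsReparam u v φ y) (a : Fin 2) :
    ∑ i, jac φ y a i * simonsFlux v i y = |(jac φ y).det| * simonsFlux u a (φ y) := by
  simp only [simonsFlux, h.sqrt_det_metric_eq, h.simonsField_eq, h.invMetric_mul_jac, pull1,
    Fin.sum_univ_two]
  ring

/-- Piola's identity: the cofactor matrix of a Jacobian is divergence free, so the coordinate
divergence of a vector density only picks up the factor |det Dφ|. -/
theorem div_simonsFlux (h : IsReparam u v φ y) :
    ∑ i, pd i (simonsFlux v i) y = |(jac φ y).det| * ∑ a, pd a (simonsFlux u a) (φ y) := by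
  have hdet : SmoothNear (fun z => (jac φ z).det) y := by
    simp only [Matrix.det_fin_two]
    exact ((h.jac_smooth 0 0).mul (h.jac_smooth 1 1)).sub
      ((h.jac_smooth 0 1).mul (h.jac_smooth 1 0))
  -- The sign of the Jacobian is locally constant, which removes the absolute value before
  -- differentiating. Orientability of the charts is not assumed.
  obtain ⟨s, hs⟩ : ∃ s : ℝ, ∀ᶠ z in 𝓝 y, |(jac φ z).det| = s * (jac φ z).det := by
    rcases h.det_jac_ne_zero.lt_or_gt with h0 | h0
    · refine ⟨-1, ?_⟩
      filter_upwards [hdet.contDiffAt.continuousAt.eventually_lt continuousAt_const h0] with z hz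
      rw [abs_of_neg hz]; ring
    · refine ⟨1, ?_⟩
      filter_upwards [continuousAt_const.eventually_lt hdet.contDiffAt.continuousAt h0] with z hz
      rw [abs_of_pos hz]; ring
  have hY : ∀ a, SmoothNear (fun z => simonsFlux u a (φ z)) y := fun a =>
    (h.regular.smooth_simonsFlux a).comp h.smooth
  -- The transformation law solved for the flux of v by Cramer's rule, giving cofactors of Dφ. After
  -- differentiation the second derivatives of φ cancel by `pd_jac_comm`.
  have e0 : simonsFlux v 0 =ᶠ[𝓝 y] fun z => s * (jac φ z 1 1 * simonsFlux u 0 (φ z) -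
      jac φ z 0 1 * simonsFlux u 1 (φ z)) := by
    filter_upwards [h.eventually, hs] with z hz hsz
    have h0 := hz.jac_mul_simonsFlux 0
    have h1 := hz.jac_mul_simonsFlux 1
    rw [hsz, Fin.sum_univ_two] at h0 h1
    apply mul_left_cancel₀ hz.det_jac_ne_zero
    rw [Matrix.det_fin_two] at *
    linear_combination jac φ z 1 1 * h0 - jac φ z 0 1 * h1
  have e1 : simonsFlux v 1 =ᶠ[𝓝 y] fun z => s * (jac φ z 0 0 * simonsFlux u 1 (φ z) -
      jac φ z 1 0 * simonsFlux u 0 (φ z)) := by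
    filter_upwards [h.eventually, hs] with z hz hsz
    have h0 := hz.jac_mul_simonsFlux 0
    have h1 := hz.jac_mul_simonsFlux 1
    rw [hsz, Fin.sum_univ_two] at h0 h1
    apply mul_left_cancel₀ hz.det_jac_ne_zero
    rw [Matrix.det_fin_two] at *
    linear_combination jac φ z 0 0 * h1 - jac φ z 1 0 * h0
  have d : ∀ a i b, SmoothNear (fun z => jac φ z a i * simonsFlux u b (φ z)) y := fun a i b =>
    (h.jac_smooth a i).mul (hY b)
  rw [Fin.sum_univ_two, pd_congr e0, pd_congr e1,
    pd_mul (differentiableAt_const s) ((d 1 1 0).sub (d 0 1 1)).differentiableAt,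
    pd_mul (differentiableAt_const s) ((d 0 0 1).sub (d 1 0 0)).differentiableAt,
    pd_sub (d 1 1 0).differentiableAt (d 0 1 1).differentiableAt,
    pd_sub (d 0 0 1).differentiableAt (d 1 0 0).differentiableAt, hs.self_of_nhds]
  simp only [pd_mul (h.jac_smooth _ _).differentiableAt (hY _).differentiableAt, pd_const,
    h.pd_comp (h.regular.smooth_simonsFlux _).differentiableAt, Fin.sum_univ_two, smul_eq_mul,
    Matrix.det_fin_two, h.pd_jac_comm _ 1 0]
  ring

end IsReparam

end Flux

/-! ### Graph coordinates -/

/-- Near `y`, the immersion `v` is a graph over its tangent plane at `y`, parametrized by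
orthonormal coordinates of that plane. -/
structure IsGraphAt (v : E2 → E4) (y : E2) : Prop where
  regular : IsRegularAt v y
  inner_eq : ∀ᶠ z in 𝓝 y, ∀ i j,
    inner ℝ (pd j v z) (pd i v y) = (1 : Matrix (Fin 2) (Fin 2) ℝ) i j

theorem pd_coord (i j : Fin 2) (y : E2) :
    pd j (fun z : E2 => z i) y = (1 : Matrix (Fin 2) (Fin 2) ℝ) i j := by
  have h : HasFDerivAt (fun z : E2 => z i) (EuclideanSpace.proj (𝕜 := ℝ) i : E2 →L[ℝ] ℝ) y :=
    (EuclideanSpace.proj (𝕜 := ℝ) i : E2 →L[ℝ] ℝ).hasFDerivAt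
  rw [pd, h.fderiv]
  simp [Matrix.one_apply]

theorem IsRegularAt.exists_graph {u : E2 → E4} {y : E2} (h : IsRegularAt u y) :
    ∃ (φ : E2 → E2) (v : E2 → E4), φ 0 = y ∧ IsReparam u v φ 0 ∧ IsGraphAt v 0 := by
  obtain ⟨C, hC, -⟩ := h.exists_frame
  set e : Fin 2 → E4 := fun i => ∑ a, C a i • pd a u y with he
  have hCi : ∃ C', C * C' = 1 := ⟨C.transpose * metric u y, mul_eq_one_comm.1 hC⟩
  obtain ⟨C', hC'⟩ := hCi
  have hue : ∀ a, pd a u y = ∑ i, C' i a • e i := by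
    intro a
    have h2 : C * C' = 1 := hC'
    have h3 : ∀ b, C b 0 * C' 0 a + C b 1 * C' 1 a = (1 : Matrix (Fin 2) (Fin 2) ℝ) b a := by
      intro b; rw [← h2, Matrix.mul_apply, Fin.sum_univ_two]
    have : ∑ i, C' i a • e i = ∑ b, (C b 0 * C' 0 a + C b 1 * C' 1 a) • pd b u y := by
      simp only [he, Fin.sum_univ_two]; module
    rw [this]; simp only [h3]
    simp [Matrix.one_apply]
  have hee : ∀ i j, inner ℝ (e j) (e i) = (1 : Matrix (Fin 2) (Fin 2) ℝ) i j := by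
    intro i j
    rw [← hC]
    simp only [he, Matrix.mul_apply, Matrix.transpose_apply, Fin.sum_univ_two, metric,
      Matrix.of_apply, inner_add_left, inner_add_right, real_inner_smul_left, real_inner_smul_right,
      real_inner_comm (pd 0 u y) (pd 1 u y)]
    ring
  -- a tangent vector orthogonal to the frame vanishes
  have hzero : ∀ x : E4, (∃ c : Fin 2 → ℝ, x = ∑ a, c a • pd a u y) →
      (∀ i, inner ℝ x (e i) = 0) → x = 0 := by
    rintro x ⟨c, hc⟩ hx
    have h1 : ∀ a, inner ℝ x (pd a u y) = 0 := by
      intro a; rw [hue, inner_sum]; simp [real_inner_smul_right, hx]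
    have : inner ℝ x x = 0 := by
      nth_rw 2 [hc]; rw [inner_sum]; simp [real_inner_smul_right, h1]
    exact inner_self_eq_zero.1 this
  -- Orthogonal projection of the surface to its tangent plane at y, in the orthonormal basis e. Its
  -- local inverse is the required change of parameters.
  set P : E2 → E2 := fun z => WithLp.toLp 2 fun i => inner ℝ (u z - u y) (e i) with hP
  have hPs : SmoothNear P y := by
    filter_upwards [h.smooth] with z hz
    rw [contDiffAt_euclidean]
    intro i
    exact (hz.sub contDiffAt_const).inner ℝ contDiffAt_const
  have hPd : ∀ z, DifferentiableAt ℝ u z → DifferentiableAt ℝ P z → ∀ j i,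
      pd j P z i = inner ℝ (pd j u z) (e i) := by
    intro z hz hz' j i
    rw [← pd_apply hz']
    change pd j (fun z => inner ℝ (u z - u y) (e i)) z = _
    rw [pd_inner (hz.sub_const _) (differentiableAt_const _), pd_const,
      pd_sub hz (differentiableAt_const _), pd_const]
    simp
  have hinj : Function.Injective (fderiv ℝ P y) := by
    rw [injective_iff_map_eq_zero]
    intro w hw
    apply h.inj
    rw [map_zero]
    apply hzero
    · exact ⟨fun a => w a, fderiv_apply_eq_sum_pd u y w⟩
    · intro i
      have := congrArg (fun q : E2 => q i) hw
      rw [fderiv_apply_eq_sum_pd] at this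
      simp only [Fin.sum_univ_two, PiLp.add_apply, PiLp.smul_apply, PiLp.zero_apply,
        hPd y h.smooth.differentiableAt hPs.differentiableAt] at this
      rw [fderiv_apply_eq_sum_pd]
      simpa [Fin.sum_univ_two, inner_add_left, real_inner_smul_left] using this
  let L : E2 ≃L[ℝ] E2 := (LinearEquiv.ofInjectiveEndo (fderiv ℝ P y).toLinearMap hinj).toContinuousLinearEquiv
  have hL : (L : E2 →L[ℝ] E2) = fderiv ℝ P y := by ext w; rfl
  have hPL : HasFDerivAt P (L : E2 →L[ℝ] E2) y := by rw [hL]; exact hPs.differentiableAt.hasFDerivAt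
  set Q := hPs.contDiffAt.toOpenPartialHomeomorph P hPL (by simp) with hQ
  have hQP : ∀ z, Q z = P z := fun z => rfl
  have hy : y ∈ Q.source := hPs.contDiffAt.mem_toOpenPartialHomeomorph_source hPL (by simp)
  have hPy : P y = 0 := by ext i; simp [hP]
  have h0 : (0 : E2) ∈ Q.target := by
    have := Q.map_source hy
    rwa [hQP, hPy] at this
  have hQ0 : Q.symm 0 = y := by
    have := Q.left_inv hy
    rwa [hQP, hPy] at this
  have hcont : ContinuousAt Q.symm 0 := Q.continuousAt_symm h0
  -- `SmoothNear` asks for smoothness of the inverse on a whole neighbourhood, so the derivative of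
  -- P must be invertible near y and not only at y.
  have hinv : ∀ᶠ z in 𝓝 y, fderiv ℝ P z ∈ Set.range ((↑) : (E2 ≃L[ℝ] E2) → (E2 →L[ℝ] E2)) := by
    have hc : ContinuousAt (fderiv ℝ P) y :=
      (hPs.contDiffAt.fderiv_right (m := 0) (by simp)).continuousAt
    apply hc.eventually
    rw [← hL]
    exact ContinuousLinearEquiv.nhds L
  have hsm : SmoothNear Q.symm 0 := by
    have := hcont.eventually (by rw [hQ0]; exact hinv.and (hPs.and (Q.open_source.mem_nhds hy)))
    filter_upwards [this, Q.open_target.mem_nhds h0] with z hz hzt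
    obtain ⟨⟨Lz, hLz⟩, hPz, -⟩ := hz
    refine Q.contDiffAt_symm (f₀' := Lz) hzt ?_ hPz
    rw [hLz]
    exact (hPz.differentiableAt (by simp)).hasFDerivAt
  have hreg : IsRegularAt u (Q.symm 0) := by rwa [hQ0]
  have hvs : SmoothNear (fun z => u (Q.symm z)) 0 := hreg.smooth.comp hsm
  have hvi : ∀ᶠ z in 𝓝 (0 : E2), ∀ i j, inner ℝ (pd j (fun z => u (Q.symm z)) z) (e i) =
      (1 : Matrix (Fin 2) (Fin 2) ℝ) i j := by
    have h1 : ∀ᶠ z in 𝓝 (0 : E2), ∀ i, inner ℝ (u (Q.symm z) - u y) (e i) = z i := by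
      filter_upwards [Q.open_target.mem_nhds h0] with z hz i
      have := Q.right_inv hz
      rw [hQP] at this
      conv_rhs => rw [← this]
    filter_upwards [eventually_eventually_nhds.2 h1, hvs] with z hz hvz i j
    have hz' : (fun z => inner ℝ (u (Q.symm z) - u y) (e i)) =ᶠ[𝓝 z] fun z => z i := by
      filter_upwards [hz] with x hx using hx i
    have := pd_congr hz' j
    have hd := hvz.differentiableAt (by simp)
    rw [pd_coord, pd_inner (hd.sub_const _) (differentiableAt_const _), pd_const,
      pd_sub hd (differentiableAt_const _), pd_const] at this
    simpa using this
  have hve : ∀ j, pd j (fun z => u (Q.symm z)) 0 = e j := by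
    intro j
    rw [← sub_eq_zero]
    apply hzero
    · refine ⟨fun a => pd j Q.symm 0 a - C a j, ?_⟩
      rw [pd_comp hreg.smooth.differentiableAt hsm.differentiableAt, hQ0, he]
      simp only [Fin.sum_univ_two]; module
    · intro i
      rw [inner_sub_left, hvi.self_of_nhds, hee, sub_self]
  have hreg' : IsRegularAt (fun z => u (Q.symm z)) 0 := by
    refine ⟨hvs, ?_⟩
    rw [injective_iff_map_eq_zero]
    intro w hw
    rw [fderiv_apply_eq_sum_pd] at hw
    ext i
    have := congrArg (fun q => inner ℝ q (e i)) hw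
    simp only [sum_inner, real_inner_smul_left, hvi.self_of_nhds] at this
    simpa [Matrix.one_apply] using this
  refine ⟨Q.symm, fun z => u (Q.symm z), hQ0, ⟨hreg, hsm, hreg', .rfl⟩, ⟨hreg', ?_⟩⟩
  filter_upwards [hvi] with z hz i j
  rw [hve, hz]

/-! ### The Simons identity at the centre of a graph -/

section GraphIdentity

/-- The algebraic identity behind the contracted Simons identity: `f`, `c`, `q` play the role of the
derivatives of order two, three and four of a graph. -/
theorem simons_algebra {f : Fin 2 → Fin 2 → E4} {c : Fin 2 → Fin 2 → Fin 2 → E4}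
    {q : Fin 2 → Fin 2 → Fin 2 → Fin 2 → E4} (hf : f 1 0 = f 0 1)
    (hc : ∀ i j k, c i j k = c j i k) (hc' : ∀ i j k, c i j k = c i k j)
    (hq : ∀ i j k l, q i j k l = q j i k l) (hq' : ∀ i j k l, q i j k l = q i k j l)
    (hq'' : ∀ i j k l, q i j k l = q i j l k)
    {A : Fin 2 → Fin 2 → Fin 2 → Fin 2 → Fin 2 → Fin 2 → ℝ}
    (hA : ∀ a b l k i j, A a b l k i j = inner ℝ (f a b) (q l k i j) - ∑ m,
      (inner ℝ (f i j) (f l m) * inner ℝ (f k m) (f a b)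
        + inner ℝ (f k i) (f l m) * inner ℝ (f m j) (f a b)
        + inner ℝ (f k j) (f l m) * inner ℝ (f i m) (f a b))) :
    ∑ p, ((∑ i, ∑ j, (A i j p p i j + inner ℝ (c p i j) (c p i j))) -
      ∑ j, ((∑ a, A p j p j a a) + inner ℝ (c p p j) (c j 0 0 + c j 1 1))) =
      simonsZ 1 f + normSq3 1 c - normSq1 1 (gradTrace 1 c) := by
  have h00 : f 0 0 + f 1 1 = (2 : ℝ) • ((1 / 2 : ℝ) • (f 0 0 + f 1 1)) := by module
  have h11 : f 0 0 - f 1 1 = (2 : ℝ) • ((1 / 2 : ℝ) • (f 0 0 - f 1 1)) := by module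
  have h4 : ∀ v : E4, ‖v‖ ^ 4 = (‖v‖ ^ 2) ^ 2 := fun v => by ring
  -- Every multi-index is brought to sorted order. The fourth-order terms ⟨f, q⟩ of the two halves
  -- of the divergence then cancel, and the cubic corrections in A add up to Z.
  have c1 : c 0 1 0 = c 0 0 1 := hc' _ _ _
  have c2 : c 1 0 0 = c 0 0 1 := by rw [hc, hc']
  have c3 : c 1 0 1 = c 0 1 1 := hc _ _ _
  have c4 : c 1 1 0 = c 0 1 1 := by rw [hc', hc]
  have q1 : q 0 0 1 0 = q 0 0 0 1 := hq'' _ _ _ _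
  have q2 : q 0 1 0 0 = q 0 0 0 1 := by rw [hq', hq'']
  have q3 : q 1 0 0 0 = q 0 0 0 1 := by rw [hq, hq', hq'']
  have q8 : q 1 1 0 0 = q 0 0 1 1 := by rw [hq', hq, hq'', hq']
  have q9 : q 1 0 1 1 = q 0 1 1 1 := hq _ _ _ _
  have q10 : q 1 1 0 1 = q 0 1 1 1 := by rw [hq', hq]
  have q11 : q 1 1 1 0 = q 0 1 1 1 := by rw [hq'', hq', hq]
  rw [simonsZ_one hf.symm h00 h11 rfl, normSq3_one, normSq1_one]
  simp only [gradTrace, trace2_one, hA, Fin.sum_univ_two, hf, c1, c2, c3, c4, q1, q2, q3, q8,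
    q9, q10, q11, h4]
  simp only [← real_inner_self_eq_norm_sq, inner_add_left, inner_add_right, inner_sub_left,
    inner_sub_right, real_inner_smul_left, real_inner_smul_right,
    real_inner_comm (f 0 0) (f 0 1), real_inner_comm (f 0 0) (f 1 1),
    real_inner_comm (f 0 1) (f 1 1), real_inner_comm (c 0 0 0) (c 0 1 1),
    real_inner_comm (c 0 0 1) (c 1 1 1)]
  ring

namespace IsGraphAt

variable {v : E2 → E4} {y : E2}

theorem metric_eq (h : IsGraphAt v y) : metric v y = 1 := by
  ext i j
  rw [metric, Matrix.of_apply, h.inner_eq.self_of_nhds, Matrix.one_apply, Matrix.one_apply]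
  simp [eq_comm]

theorem invMetric_eq (h : IsGraphAt v y) : invMetric v y = 1 := by
  rw [invMetric, h.metric_eq, inv_one]

/-- The tangential coordinates of a graph are affine functions of the parameters, so second
derivatives are normal to the tangent plane at the centre. This is kept on a neighbourhood because
it is differentiated again in `inner_pd_pd_pd`. -/
theorem inner_pd_pd (h : IsGraphAt v y) :
    ∀ᶠ z in 𝓝 y, ∀ i j k, inner ℝ (pd i (pd j v) z) (pd k v y) = 0 := by
  filter_upwards [eventually_eventually_nhds.2 h.inner_eq, h.regular.smooth.eventually] with z hz hs i j k
  have e : (fun x => inner ℝ (pd j v x) (pd k v y)) =ᶠ[𝓝 z]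
      fun _ => (1 : Matrix (Fin 2) (Fin 2) ℝ) k j := by
    filter_upwards [hz] with x hx using hx k j
  have := pd_congr e i
  rw [pd_inner (hs.pd j).differentiableAt (differentiableAt_const _), pd_const, pd_const] at this
  simpa using this

theorem inner_pd_pd_pd (h : IsGraphAt v y) :
    ∀ᶠ z in 𝓝 y, ∀ l i j k, inner ℝ (pd l (pd i (pd j v)) z) (pd k v y) = 0 := by
  filter_upwards [eventually_eventually_nhds.2 h.inner_pd_pd, h.regular.smooth.eventually]
    with z hz hs l i j k
  have e : (fun x => inner ℝ (pd i (pd j v) x) (pd k v y)) =ᶠ[𝓝 z] fun _ => (0 : ℝ) := by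
    filter_upwards [hz] with x hx using hx i j k
  have := pd_congr e l
  rw [pd_inner ((hs.pd j).pd i).differentiableAt (differentiableAt_const _), pd_const, pd_const] at this
  simpa using this

theorem pd_metric (h : IsGraphAt v y) (k i j : Fin 2) : pd k (fun z => metric v z i j) y = 0 := by
  have h1 := h.inner_pd_pd.self_of_nhds
  simp only [metric, Matrix.of_apply]
  rw [pd_inner (h.regular.smooth.pd i).differentiableAt (h.regular.smooth.pd j).differentiableAt,
    real_inner_comm, h1, h1, add_zero]

/-- Differentiate g⁻¹g = 1 at the centre, where g = 1 and dg = 0. -/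
theorem pd_invMetric (h : IsGraphAt v y) (k i j : Fin 2) :
    pd k (fun z => invMetric v z i j) y = 0 := by
  have e : (fun z => ∑ l, invMetric v z i l * metric v z l j) =ᶠ[𝓝 y]
      fun _ => (1 : Matrix (Fin 2) (Fin 2) ℝ) i j := by
    filter_upwards [h.regular.eventually] with z hz
    rw [← hz.invMetric_mul, Matrix.mul_apply]
  have := pd_congr e k
  rw [pd_const, pd_sum fun l _ =>
    ((h.regular.smooth_invMetric i l).mul (h.regular.smooth.metric l j)).differentiableAt] at this
  simp only [pd_mul (h.regular.smooth_invMetric i _).differentiableAt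
    (h.regular.smooth.metric _ j).differentiableAt, h.pd_metric, h.metric_eq] at this
  simpa [Matrix.one_apply] using this

theorem sqrt_det (h : IsGraphAt v y) : Real.sqrt (metric v y).det = 1 := by
  simp [h.metric_eq]

theorem pd_sqrt_det (h : IsGraphAt v y) (k : Fin 2) :
    pd k (fun z => Real.sqrt (metric v z).det) y = 0 := by
  have e : (fun z => Real.sqrt (metric v z).det * Real.sqrt (metric v z).det) =ᶠ[𝓝 y]
      fun z => metric v z 0 0 * metric v z 1 1 - metric v z 0 1 * metric v z 1 0 := by
    filter_upwards [h.regular.eventually] with z hz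
    rw [Real.mul_self_sqrt hz.det_pos.le, Matrix.det_fin_two]
  have := pd_congr e k
  have m := h.regular.smooth.metric
  rw [pd_mul h.regular.smooth_sqrt_det.differentiableAt h.regular.smooth_sqrt_det.differentiableAt,
    pd_sub ((m 0 0).mul (m 1 1)).differentiableAt ((m 0 1).mul (m 1 0)).differentiableAt,
    pd_mul (m 0 0).differentiableAt (m 1 1).differentiableAt,
    pd_mul (m 0 1).differentiableAt (m 1 0).differentiableAt, h.sqrt_det] at this
  simp only [h.pd_metric] at this
  linarith

variable {V : Type*} [NormedAddCommGroup V] [NormedSpace ℝ V]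

theorem pd_invMetric_smul (h : IsGraphAt v y) (k i j : Fin 2) {w : E2 → V}
    (hw : DifferentiableAt ℝ w y) : pd k (fun z => invMetric v z i j • w z) y =
      (1 : Matrix (Fin 2) (Fin 2) ℝ) i j • pd k w y := by
  rw [pd_smul (h.regular.smooth_invMetric i j).differentiableAt hw, h.pd_invMetric, h.invMetric_eq,
    zero_smul, add_zero]

/-- At the centre g⁻¹ = 1 and d(g⁻¹) = 0, so differentiation passes through metric contractions and
turns them into plain traces. -/
theorem pd_contract (h : IsGraphAt v y) (k : Fin 2) {w : Fin 2 → Fin 2 → E2 → V}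
    (hw : ∀ i j, SmoothNear (w i j) y) :
    pd k (fun z => ∑ i, ∑ j, invMetric v z i j • w i j z) y = ∑ i, pd k (w i i) y := by
  have d : ∀ i j, SmoothNear (fun z => invMetric v z i j • w i j z) y := fun i j =>
    (h.regular.smooth_invMetric i j).smul (hw i j)
  rw [pd_sum fun i _ => (SmoothNear.sum fun j => d i j).differentiableAt]
  refine Finset.sum_congr rfl fun i _ => ?_
  rw [pd_sum fun j _ => (d i j).differentiableAt]
  simp only [h.pd_invMetric_smul k i _ (hw i _).differentiableAt]
  simp [Matrix.one_apply]

theorem christoffel_eq (h : IsGraphAt v y) (k i j : Fin 2) : christoffel v k i j y = 0 := by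
  simp [SurfaceR4.christoffel_eq h.regular.smooth, h.inner_pd_pd.self_of_nhds]

/-- The Christoffel symbols vanish at the centre but their derivatives do not; these products of
second derivatives are the only source of curvature terms in the identity. -/
theorem pd_christoffel (h : IsGraphAt v y) (l m i j : Fin 2) :
    pd l (christoffel v m i j) y = inner ℝ (pd i (pd j v) y) (pd l (pd m v) y) := by
  have e : christoffel v m i j =ᶠ[𝓝 y] fun z =>
      ∑ n, invMetric v z m n • inner ℝ (pd i (pd j v) z) (pd n v z) := by
    filter_upwards [h.regular.smooth.eventually] with z hz using SurfaceR4.christoffel_eq hz m i j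
  have s := h.regular.smooth
  have d : ∀ n, SmoothNear (fun z => inner ℝ (pd i (pd j v) z) (pd n v z)) y := fun n =>
    ((s.pd j).pd i).inner (s.pd n)
  rw [pd_congr e, pd_sum fun n _ => ((h.regular.smooth_invMetric m n).smul (d n)).differentiableAt]
  simp only [h.pd_invMetric_smul l m _ (d _).differentiableAt,
    pd_inner ((s.pd j).pd i).differentiableAt (s.pd _).differentiableAt,
    h.inner_pd_pd_pd.self_of_nhds]
  simp [Matrix.one_apply]

theorem secondFF_eq (h : IsGraphAt v y) (i j : Fin 2) : secondFF v i j y = pd i (pd j v) y :=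
  normalPart_of_inner_eq_zero fun k => h.inner_pd_pd.self_of_nhds i j k

theorem covSecondFF_eq (h : IsGraphAt v y) (k i j : Fin 2) :
    covSecondFF v k i j y = pd k (pd i (pd j v)) y := by
  rw [h.regular.covSecondFF_eq]
  simp only [h.christoffel_eq, zero_smul, add_zero, Finset.sum_const_zero, sub_zero]
  exact normalPart_of_inner_eq_zero fun l => h.inner_pd_pd_pd.self_of_nhds k i j l

theorem inner_pd_secondFF (h : IsGraphAt v y) {n : E4} (hn : ∀ k, inner ℝ n (pd k v y) = 0)
    (k i j : Fin 2) : inner ℝ n (pd k (secondFF v i j) y) = inner ℝ n (pd k (pd i (pd j v)) y) := by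
  have e : secondFF v i j =ᶠ[𝓝 y] fun z =>
      pd i (pd j v) z - ∑ m, christoffel v m i j z • pd m v z := by
    filter_upwards [h.regular.smooth.eventually] with z hz using SurfaceR4.secondFF_eq hz i j
  have s := h.regular.smooth
  have d : ∀ m, SmoothNear (fun z => christoffel v m i j z • pd m v z) y := fun m =>
    (h.regular.smooth_christoffel m i j).smul (s.pd m)
  rw [pd_congr e, pd_sub ((s.pd j).pd i).differentiableAt (SmoothNear.sum d).differentiableAt,
    pd_sum fun m _ => (d m).differentiableAt]
  simp only [pd_smul (h.regular.smooth_christoffel _ i j).differentiableAt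
    (s.pd _).differentiableAt, h.christoffel_eq]
  simp [inner_sub_right, inner_add_right, real_inner_smul_right, hn]

/-- Only normal components of this derivative are needed, since it is paired with A, which is
normal. The cubic corrections arise when the derivative falls on a Christoffel symbol; otherwise the
term vanishes at the centre. -/
theorem inner_pd_covSecondFF (h : IsGraphAt v y) {n : E4} (hn : ∀ k, inner ℝ n (pd k v y) = 0)
    (l k i j : Fin 2) : inner ℝ n (pd l (covSecondFF v k i j) y) =
      inner ℝ n (pd l (pd k (pd i (pd j v))) y) - ∑ m,
        (inner ℝ (pd i (pd j v) y) (pd l (pd m v) y) * inner ℝ (pd k (pd m v) y) n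
        + inner ℝ (pd k (pd i v) y) (pd l (pd m v) y) * inner ℝ (pd m (pd j v) y) n
        + inner ℝ (pd k (pd j v) y) (pd l (pd m v) y) * inner ℝ (pd i (pd m v) y) n) := by
  have s := h.regular.smooth
  have sg := h.regular.smooth_christoffel
  have sh := h.regular.smooth_secondFF
  have s3 : SmoothNear (pd k (pd i (pd j v))) y := ((s.pd j).pd i).pd k
  have e : covSecondFF v k i j =ᶠ[𝓝 y] fun z => (pd k (pd i (pd j v)) z
      - ∑ a, ∑ b, (invMetric v z a b * inner ℝ (pd k (pd i (pd j v)) z) (pd a v z)) • pd b v z) -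
      ∑ m, (christoffel v m i j z • secondFF v k m z + christoffel v m k i z • secondFF v m j z
        + christoffel v m k j z • secondFF v i m z) := by
    filter_upwards [h.regular.eventually] with z hz using hz.covSecondFF_eq k i j
  have d1 : ∀ a b, SmoothNear
      (fun z => invMetric v z a b * inner ℝ (pd k (pd i (pd j v)) z) (pd a v z)) y := fun a b =>
    (h.regular.smooth_invMetric a b).mul (s3.inner (s.pd a))
  have d2 : ∀ a b, SmoothNear (fun z =>
      (invMetric v z a b * inner ℝ (pd k (pd i (pd j v)) z) (pd a v z)) • pd b v z) y := fun a b =>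
    (d1 a b).smul (s.pd b)
  have d3 : ∀ m i j a b, SmoothNear (fun z => christoffel v m i j z • secondFF v a b z) y :=
    fun m i j a b => (sg m i j).smul (sh a b)
  have d4 : ∀ m, SmoothNear (fun z => christoffel v m i j z • secondFF v k m z
      + christoffel v m k i z • secondFF v m j z + christoffel v m k j z • secondFF v i m z) y :=
    fun m => ((d3 m i j k m).add (d3 m k i m j)).add (d3 m k j i m)
  rw [pd_congr e, pd_sub (s3.sub (.sum fun a => .sum fun b => d2 a b)).differentiableAt
    (SmoothNear.sum d4).differentiableAt,
    pd_sub s3.differentiableAt (SmoothNear.sum fun a => .sum fun b => d2 a b).differentiableAt,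
    pd_sum fun a _ => (SmoothNear.sum fun b => d2 a b).differentiableAt,
    pd_sum fun m _ => (d4 m).differentiableAt]
  have p1 : ∀ a, pd l (fun z => ∑ b, (invMetric v z a b *
      inner ℝ (pd k (pd i (pd j v)) z) (pd a v z)) • pd b v z) y = ∑ b, pd l (fun z =>
      (invMetric v z a b * inner ℝ (pd k (pd i (pd j v)) z) (pd a v z)) • pd b v z) y := fun a =>
    pd_sum fun b _ => (d2 a b).differentiableAt
  -- The correction from the normal projection drops out: its coefficient vanishes at y, and the
  -- derivative of the coefficient multiplies a tangent vector.
  have p2 : ∀ a b, inner ℝ n (pd l (fun z => (invMetric v z a b *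
      inner ℝ (pd k (pd i (pd j v)) z) (pd a v z)) • pd b v z) y) = 0 := by
    intro a b
    rw [pd_smul (d1 a b).differentiableAt (s.pd b).differentiableAt,
      h.inner_pd_pd_pd.self_of_nhds, mul_zero, zero_smul, zero_add, real_inner_smul_right, hn,
      mul_zero]
  have p3 : ∀ m, pd l (fun z => christoffel v m i j z • secondFF v k m z
      + christoffel v m k i z • secondFF v m j z + christoffel v m k j z • secondFF v i m z) y =
      pd l (christoffel v m i j) y • secondFF v k m y
      + pd l (christoffel v m k i) y • secondFF v m j y
      + pd l (christoffel v m k j) y • secondFF v i m y := by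
    intro m
    rw [pd_add ((d3 m i j k m).add (d3 m k i m j)).differentiableAt (d3 m k j i m).differentiableAt,
      pd_add (d3 m i j k m).differentiableAt (d3 m k i m j).differentiableAt]
    simp only [pd_smul (sg _ _ _).differentiableAt (sh _ _).differentiableAt, h.christoffel_eq,
      zero_smul, zero_add]
  simp only [p1, p3, h.pd_christoffel, h.secondFF_eq, inner_sub_right, inner_sum, p2,
    inner_add_right, real_inner_smul_right, Finset.sum_const_zero, sub_zero, real_inner_comm n]

theorem div_simonsFlux (h : IsGraphAt v y) : ∑ i, pd i (simonsFlux v i) y = simonsDiv v y := by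
  have s := h.regular.smooth
  have sh := h.regular.smooth_secondFF
  have sD := h.regular.smooth_covSecondFF
  have sX := h.regular.smooth_simonsField
  have sT := h.regular.smooth_gradTrace
  have hn : ∀ i j k, inner ℝ (pd i (pd j v) y) (pd k v y) = 0 := h.inner_pd_pd.self_of_nhds
  have hn3 : ∀ l i j k, inner ℝ (pd l (pd i (pd j v)) y) (pd k v y) = 0 :=
    h.inner_pd_pd_pd.self_of_nhds
  have e1 : ∀ i, pd i (simonsFlux v i) y = pd i (simonsField v i) y := by
    intro i
    unfold simonsFlux
    have d : ∀ l, SmoothNear (fun z => invMetric v z i l * simonsField v l z) y := fun l =>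
      (h.regular.smooth_invMetric i l).mul (sX l)
    rw [pd_mul h.regular.smooth_sqrt_det.differentiableAt (SmoothNear.sum d).differentiableAt,
      h.pd_sqrt_det, h.sqrt_det, pd_sum fun l _ => (d l).differentiableAt]
    have := fun l => h.pd_invMetric_smul i i l (sX l).differentiableAt
    simp only [smul_eq_mul] at this
    simp only [this]
    simp [Matrix.one_apply]
  have eT : ∀ p k, pd p (fun z => gradTrace (invMetric v z) (fun k i j => covSecondFF v k i j z) k) y =
      ∑ a, pd p (covSecondFF v k a a) y := by
    intro p k
    exact h.pd_contract p fun i j => sD k i j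
  have eT0 : ∀ k, gradTrace (invMetric v y) (fun k i j => covSecondFF v k i j y) k =
      pd k (pd 0 (pd 0 v)) y + pd k (pd 1 (pd 1 v)) y := by
    intro k
    rw [gradTrace, h.invMetric_eq, trace2_one, h.covSecondFF_eq, h.covSecondFF_eq]
  have e2 : ∀ p l, pd p (simonsField v l) y =
      (∑ i, ∑ j, (inner ℝ (pd i (pd j v) y) (pd p (covSecondFF v l i j) y)
        + inner ℝ (pd p (pd i (pd j v)) y) (pd l (pd i (pd j v)) y))) -
      ∑ j, ((∑ a, inner ℝ (pd l (pd j v) y) (pd p (covSecondFF v j a a) y))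
        + inner ℝ (pd p (pd l (pd j v)) y)
          (pd j (pd 0 (pd 0 v)) y + pd j (pd 1 (pd 1 v)) y)) := by
    intro p l
    have d1 : ∀ i j a b, SmoothNear (fun z => inner ℝ (secondFF v i j z) (covSecondFF v l a b z)) y :=
      fun i j a b => (sh i j).inner (sD l a b)
    have d2 : ∀ j k, SmoothNear (fun z => inner ℝ (secondFF v l j z)
        (gradTrace (invMetric v z) (fun k i j => covSecondFF v k i j z) k)) y :=
      fun j k => (sh l j).inner (sT k)
    have f1 : simonsField v l = fun z =>
        (∑ i, ∑ a, invMetric v z i a • ∑ j, ∑ b, invMetric v z j b •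
          inner ℝ (secondFF v i j z) (covSecondFF v l a b z)) -
        ∑ j, ∑ k, invMetric v z j k • inner ℝ (secondFF v l j z)
          (gradTrace (invMetric v z) (fun k i j => covSecondFF v k i j z) k) := by
      funext z
      simp only [simonsField, simonsCovector, Fin.sum_univ_two, smul_eq_mul]
      ring
    have d3 : ∀ i a, SmoothNear (fun z => ∑ j, ∑ b, invMetric v z j b •
          inner ℝ (secondFF v i j z) (covSecondFF v l a b z)) y := fun i a =>
      .sum fun j => .sum fun b => (h.regular.smooth_invMetric j b).smul (d1 i j a b)
    have d4 : SmoothNear (fun z => ∑ j, ∑ k, invMetric v z j k • inner ℝ (secondFF v l j z)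
          (gradTrace (invMetric v z) (fun k i j => covSecondFF v k i j z) k)) y :=
      .sum fun j => .sum fun b => (h.regular.smooth_invMetric j b).smul (d2 j b)
    have d5 : SmoothNear (fun z => ∑ i, ∑ a, invMetric v z i a • ∑ j, ∑ b, invMetric v z j b •
          inner ℝ (secondFF v i j z) (covSecondFF v l a b z)) y :=
      .sum fun j => .sum fun b => (h.regular.smooth_invMetric j b).smul (d3 j b)
    rw [f1, pd_sub d5.differentiableAt d4.differentiableAt, h.pd_contract p d3, h.pd_contract p d2]
    congr 1
    · refine Finset.sum_congr rfl fun i _ => ?_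
      rw [h.pd_contract p fun j b => d1 i j i b]
      refine Finset.sum_congr rfl fun j _ => ?_
      rw [pd_inner (sh i j).differentiableAt (sD l i j).differentiableAt, h.secondFF_eq,
        h.covSecondFF_eq, real_inner_comm _ (pd p (secondFF v i j) y),
        h.inner_pd_secondFF (hn3 l i j), real_inner_comm (pd l (pd i (pd j v)) y)]
    · refine Finset.sum_congr rfl fun j _ => ?_
      rw [pd_inner (sh l j).differentiableAt (sT j).differentiableAt, eT, eT0, h.secondFF_eq,
        inner_sum, real_inner_comm _ (pd p (secondFF v l j) y), h.inner_pd_secondFF,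
        real_inner_comm (pd j (pd 0 (pd 0 v)) y + _)]
      intro k
      rw [inner_add_left, hn3, hn3, add_zero]
  have c3 : ∀ i j k, pd i (pd j (pd k v)) y = pd i (pd k (pd j v)) y := fun i j k =>
    pd_congr (s.eventually.mono fun z hz => pd_comm hz j k) i
  have c4 : ∀ i j k l, pd i (pd j (pd k (pd l v))) y = pd i (pd j (pd l (pd k v))) y :=
    fun i j k l => pd_congr (pd_congr_eventually (s.eventually.mono fun z hz => pd_comm hz k l) j) i
  have c4' : ∀ i j k l, pd i (pd j (pd k (pd l v))) y = pd i (pd k (pd j (pd l v))) y :=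
    fun i j k l => pd_congr ((s.pd l).eventually.mono fun z hz => pd_comm hz j k) i
  have key := simons_algebra (f := fun i j => pd i (pd j v) y)
    (c := fun k i j => pd k (pd i (pd j v)) y) (q := fun l k i j => pd l (pd k (pd i (pd j v))) y)
    (A := fun a b l k i j => inner ℝ (pd a (pd b v) y) (pd l (covSecondFF v k i j) y))
    (pd_comm s 1 0) (fun i j k => pd_comm (s.pd k) i j) c3
    (fun i j k l => pd_comm ((s.pd l).pd k) i j) c4' c4
    (fun a b l k i j => h.inner_pd_covSecondFF (hn a b) l k i j)
  simp only [e1, e2]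
  rw [simonsDiv, h.invMetric_eq]
  simp only [h.secondFF_eq, h.covSecondFF_eq]
  exact key

end IsGraphAt

/-- The contracted Simons identity in divergence form. -/
theorem IsRegularAt.div_simonsFlux {u : E2 → E4} {y : E2} (h : IsRegularAt u y) :
    ∑ i, pd i (simonsFlux u i) y = Real.sqrt (metric u y).det * simonsDiv u y := by
  -- The graph v has unit area density at 0, so √det g of u at φ(0) is 1/|det Dφ|. This is exactly
  -- the factor by which the divergence of the flux transforms.
  obtain ⟨φ, v, rfl, hr, hg⟩ := h.exists_graph
  have h1 := hr.div_simonsFlux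
  have h2 := hr.sqrt_det_metric_eq
  rw [hg.div_simonsFlux, hr.simonsDiv_eq] at h1
  rw [hg.sqrt_det] at h2
  have h3 : |(jac φ 0).det| ≠ 0 := abs_ne_zero.2 hr.det_jac_ne_zero
  apply mul_left_cancel₀ h3
  rw [← h1, ← mul_assoc, ← h2, one_mul]

/-- `½ d|H|² = ⟨H, ∇H⟩`. -/
theorem IsRegularAt.pd_norm_sq_trace {u : E2 → E4} {y : E2} (h : IsRegularAt u y) (l : Fin 2) :
    pd l (fun z => ‖trace2 (invMetric u z) fun i j => secondFF u i j z‖ ^ 2) y =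
      2 * inner ℝ (trace2 (invMetric u y) fun i j => secondFF u i j y)
        (gradTrace (invMetric u y) (fun k i j => covSecondFF u k i j y) l) := by
  obtain ⟨φ, v, rfl, hr, hg⟩ := h.exists_graph
  have sH : ∀ {u : E2 → E4} {y : E2}, IsRegularAt u y →
      SmoothNear (fun z => trace2 (invMetric u z) fun i j => secondFF u i j z) y := fun h =>
    .sum fun i => .sum fun j => (h.smooth_invMetric i j).smul (h.smooth_secondFF i j)
  set Q : E2 → ℝ := fun z => ‖trace2 (invMetric u z) fun i j => secondFF u i j z‖ ^ 2
  have hQ : DifferentiableAt ℝ Q (φ 0) := by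
    simp only [Q, ← real_inner_self_eq_norm_sq]
    exact ((sH h).inner (sH h)).differentiableAt
  have e : (fun z => inner ℝ (trace2 (invMetric v z) fun i j => secondFF v i j z)
      (trace2 (invMetric v z) fun i j => secondFF v i j z)) =ᶠ[𝓝 0] fun z => Q (φ z) := by
    filter_upwards [hr.eventually] with z hz
    rw [real_inner_self_eq_norm_sq, hz.secondFF_fun_eq, ← trace2_pull hz.invMetric_eq]
  -- The identity is first proved after contraction with the Jacobian, that is, for the graph;
  -- invertibility of the Jacobian then isolates each component.
  have key : ∀ k, ∑ a, jac φ 0 a k * pd a Q (φ 0) = ∑ a, jac φ 0 a k *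
      (2 * inner ℝ (trace2 (invMetric u (φ 0)) fun i j => secondFF u i j (φ 0))
        (gradTrace (invMetric u (φ 0)) (fun k i j => covSecondFF u k i j (φ 0)) a)) := by
    intro k
    have e1 := pd_congr e k
    rw [hr.pd_comp hQ, pd_inner (sH hg.regular).differentiableAt (sH hg.regular).differentiableAt] at e1
    simp only [smul_eq_mul] at e1
    rw [← e1, real_inner_comm, ← two_mul]
    have e2 : pd k (fun z => trace2 (invMetric v z) fun i j => secondFF v i j z) 0 =
        ∑ i, pd k (secondFF v i i) 0 := hg.pd_contract k fun i j => hg.regular.smooth_secondFF i j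
    have e3 : trace2 (invMetric u (φ 0)) (fun i j => secondFF u i j (φ 0)) =
        trace2 (invMetric v 0) fun i j => secondFF v i j 0 := by
      rw [hr.secondFF_fun_eq, ← trace2_pull hr.invMetric_eq]
    have hn : ∀ k, inner ℝ (trace2 (invMetric v 0) fun i j => secondFF v i j 0) (pd k v 0) = 0 := by
      intro k
      rw [hg.invMetric_eq, trace2_one, hg.secondFF_eq, hg.secondFF_eq, inner_add_left,
        hg.inner_pd_pd.self_of_nhds, hg.inner_pd_pd.self_of_nhds, add_zero]
    have e4 : ∑ a, jac φ 0 a k * (2 * inner ℝ (trace2 (invMetric v 0) fun i j => secondFF v i j 0)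
        (gradTrace (invMetric u (φ 0)) (fun k i j => covSecondFF u k i j (φ 0)) a)) =
        2 * inner ℝ (trace2 (invMetric v 0) fun i j => secondFF v i j 0)
        (gradTrace (invMetric v 0) (fun k i j => covSecondFF v k i j 0) k) := by
      rw [hr.covSecondFF_fun_eq, gradTrace_pull hr.invMetric_eq]
      simp only [Fin.sum_univ_two, inner_add_right, real_inner_smul_right]
      ring
    rw [e3, e4, real_inner_comm, e2, inner_sum]
    simp only [hg.inner_pd_secondFF hn]
    simp only [gradTrace, hg.invMetric_eq, trace2_one, hg.covSecondFF_eq, inner_add_right,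
      Fin.sum_univ_two]
  have k0 := key 0
  have k1 := key 1
  have hd := hr.det_jac_ne_zero
  rw [Matrix.det_fin_two] at hd
  simp only [Fin.sum_univ_two] at k0 k1
  obtain rfl | rfl := Fin.exists_fin_two.1 ⟨l, rfl⟩
  · apply mul_left_cancel₀ hd
    linear_combination jac φ 0 1 1 * k0 - jac φ 0 1 0 * k1
  · apply mul_left_cancel₀ hd
    linear_combination jac φ 0 0 0 * k1 - jac φ 0 0 1 * k0

end GraphIdentity

/-! ### Independence of the chart -/

section Charts

variable {M : Type*} [TopologicalSpace M] [ChartedSpace E2 M]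

/-- Mean curvature vector of a parametrization. -/
def meanVec (u : E2 → E4) (y : E2) : E4 := trace2 (invMetric u y) fun i j => secondFF u i j y

/-- Squared norm of the second fundamental form of a parametrization. -/
def sqA (u : E2 → E4) (y : E2) : ℝ := normSq2 (invMetric u y) fun i j => secondFF u i j y

/-- Squared norm of `∇A` of a parametrization. -/
def sqGradA (u : E2 → E4) (y : E2) : ℝ :=
  normSq3 (invMetric u y) fun k i j => covSecondFF u k i j y

/-- `|Rm⊥|²` of a parametrization. -/
def sqNormalCurv (u : E2 → E4) (y : E2) : ℝ :=
  normalCurvNormSq (invMetric u y) fun i j => secondFF u i j y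

/-- The derivative of `ψ` in the direction of the vector field dual to `simonsField`. -/
def fieldDeriv (F : M → E4) (ψ : M → ℝ) (x : M) : ℝ :=
  pairing (invMetricAt F x) (fun i => pd i (localRep ψ x) (coord x))
    (fun l => simonsField (localRep F x) l (coord x))

theorem chart_symm_mem_nhds (x₀ x₁ : M) {y : E2} (hy : y ∈ (chartAt E2 x₁).target)
    (h : (chartAt E2 x₁).symm y ∈ (chartAt E2 x₀).source) :
    ∀ᶠ z in 𝓝 y, z ∈ (chartAt E2 x₁).target ∧ (chartAt E2 x₁).symm z ∈ (chartAt E2 x₀).source :=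
  ((chartAt E2 x₁).open_target.eventually_mem hy).and
    (((chartAt E2 x₁).continuousAt_symm hy).eventually_mem
      ((chartAt E2 x₀).open_source.mem_nhds h))

theorem localRep_eventuallyEq {V : Type*} (w : M → V) (x₀ x₁ : M) {y : E2}
    (hy : y ∈ (chartAt E2 x₁).target)
    (h : (chartAt E2 x₁).symm y ∈ (chartAt E2 x₀).source) :
    localRep w x₁ =ᶠ[𝓝 y] fun z => localRep w x₀ (chartAt E2 x₀ ((chartAt E2 x₁).symm z)) := by
  filter_upwards [chart_symm_mem_nhds x₀ x₁ hy h] with z hz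
  simp only [localRep, (chartAt E2 x₀).left_inv hz.2]

variable [IsManifold (𝓡 2) ∞ M]

theorem smoothNear_transition (x₀ x₁ : M) {y : E2} (hy : y ∈ (chartAt E2 x₁).target)
    (h : (chartAt E2 x₁).symm y ∈ (chartAt E2 x₀).source) :
    SmoothNear (fun z => chartAt E2 x₀ ((chartAt E2 x₁).symm z)) y := by
  filter_upwards [chart_symm_mem_nhds x₀ x₁ hy h] with z hz
  have h1 : ContMDiffAt (𝓡 2) (𝓡 2) ∞ (chartAt E2 x₁).symm z :=
    contMDiffOn_chart_symm.contMDiffAt ((chartAt E2 x₁).open_target.mem_nhds hz.1)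
  have h2 : ContMDiffAt (𝓡 2) (𝓡 2) ∞ (chartAt E2 x₀) ((chartAt E2 x₁).symm z) :=
    contMDiffOn_chart.contMDiffAt ((chartAt E2 x₀).open_source.mem_nhds hz.2)
  exact (h2.comp z h1).contDiffAt

theorem smoothNear_localRep {V : Type*} [NormedAddCommGroup V] [NormedSpace ℝ V] {w : M → V}
    (hw : ContMDiff (𝓡 2) 𝓘(ℝ, V) ∞ w) (x₀ : M) {y : E2} (hy : y ∈ (chartAt E2 x₀).target) :
    SmoothNear (localRep w x₀) y := by
  filter_upwards [(chartAt E2 x₀).open_target.eventually_mem hy] with z hz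
  have h1 : ContMDiffAt (𝓡 2) (𝓡 2) ∞ (chartAt E2 x₀).symm z :=
    contMDiffOn_chart_symm.contMDiffAt ((chartAt E2 x₀).open_target.mem_nhds hz)
  exact ((hw _).comp z h1).contDiffAt

theorem IsSmoothImmersion.isRegularAt {F : M → E4} (hF : IsSmoothImmersion F) (x₀ : M) {y : E2}
    (hy : y ∈ (chartAt E2 x₀).target) : IsRegularAt (localRep F x₀) y := by
  refine ⟨smoothNear_localRep hF.1 x₀ hy, ?_⟩
  have h1 : MDifferentiableAt (𝓡 2) (𝓡 2) (chartAt E2 x₀).symm y :=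
    (contMDiffOn_chart_symm.contMDiffAt (n := ∞)
      ((chartAt E2 x₀).open_target.mem_nhds hy)).mdifferentiableAt (by simp)
  have h2 : MDifferentiableAt (𝓡 2) (𝓡 2) (chartAt E2 x₀) ((chartAt E2 x₀).symm y) :=
    (contMDiffOn_chart.contMDiffAt (n := ∞) ((chartAt E2 x₀).open_source.mem_nhds
      ((chartAt E2 x₀).map_target hy))).mdifferentiableAt (by simp)
  have h3 : MDifferentiableAt (𝓡 2) 𝓘(ℝ, E4) F ((chartAt E2 x₀).symm y) :=
    (hF.1 _).mdifferentiableAt (by simp)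
  have e : fderiv ℝ (localRep F x₀) y = (mfderiv (𝓡 2) 𝓘(ℝ, E4) F ((chartAt E2 x₀).symm y)).comp
      (mfderiv (𝓡 2) (𝓡 2) (chartAt E2 x₀).symm y) := by
    rw [← mfderiv_eq_fderiv]
    exact mfderiv_comp y h3 h1
  have e2 : (mfderiv (𝓡 2) (𝓡 2) (chartAt E2 x₀) ((chartAt E2 x₀).symm y)).comp
      (mfderiv (𝓡 2) (𝓡 2) (chartAt E2 x₀).symm y) = ContinuousLinearMap.id ℝ E2 := by
    rw [← mfderiv_comp y h2 h1]
    have : (chartAt E2 x₀ ∘ (chartAt E2 x₀).symm) =ᶠ[𝓝 y] id := by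
      filter_upwards [(chartAt E2 x₀).open_target.eventually_mem hy] with z hz
      exact (chartAt E2 x₀).right_inv hz
    rw [this.mfderiv_eq, mfderiv_id]
    rfl
  have hi : Function.Injective (mfderiv (𝓡 2) (𝓡 2) (chartAt E2 x₀).symm y) := by
    intro a b hab
    have := congrArg (mfderiv (𝓡 2) (𝓡 2) (chartAt E2 x₀) ((chartAt E2 x₀).symm y)) hab
    have ea := DFunLike.congr_fun e2 a
    have eb := DFunLike.congr_fun e2 b
    exact ea.symm.trans (this.trans eb)
  rw [e]
  exact (hF.2 _).comp hi

theorem IsSmoothImmersion.isReparam {F : M → E4} (hF : IsSmoothImmersion F) (x₀ x₁ : M) {y : E2}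
    (hy : y ∈ (chartAt E2 x₁).target)
    (h : (chartAt E2 x₁).symm y ∈ (chartAt E2 x₀).source) :
    IsReparam (localRep F x₀) (localRep F x₁)
      (fun z => chartAt E2 x₀ ((chartAt E2 x₁).symm z)) y :=
  ⟨hF.isRegularAt x₀ ((chartAt E2 x₀).map_source h), smoothNear_transition x₀ x₁ hy h,
    hF.isRegularAt x₁ hy, localRep_eventuallyEq F x₀ x₁ hy h⟩

/-- The chain rule for a change of charts holds without differentiability. -/
theorem pd_localRep (w : M → ℝ) (x₀ x₁ : M) {y : E2}
    (hy : y ∈ (chartAt E2 x₁).target)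
    (h : (chartAt E2 x₁).symm y ∈ (chartAt E2 x₀).source) (i : Fin 2) :
    pd i (localRep w x₁) y = pull1 (jac (fun z => chartAt E2 x₀ ((chartAt E2 x₁).symm z)) y)
      (fun a => pd a (localRep w x₀) (chartAt E2 x₀ ((chartAt E2 x₁).symm y))) i := by
  have hφ := smoothNear_transition x₀ x₁ hy h
  have e := localRep_eventuallyEq w x₀ x₁ hy h
  by_cases hd : DifferentiableAt ℝ (localRep w x₀) (chartAt E2 x₀ ((chartAt E2 x₁).symm y))
  · rw [pd_congr e, pd_comp hd hφ.differentiableAt]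
    rfl
  -- Differentiability passes back through the inverse transition map. Hence at a bad point both
  -- derivatives have the default value 0, and the chain rule reads 0 = 0.
  · have hd' : ¬ DifferentiableAt ℝ (localRep w x₁) y := by
      intro h1
      apply hd
      set z := chartAt E2 x₀ ((chartAt E2 x₁).symm y) with hz
      have hz1 : z ∈ (chartAt E2 x₀).target := (chartAt E2 x₀).map_source h
      have hz2 : (chartAt E2 x₀).symm z = (chartAt E2 x₁).symm y := (chartAt E2 x₀).left_inv h
      have hz3 : (chartAt E2 x₀).symm z ∈ (chartAt E2 x₁).source := by
        rw [hz2]; exact (chartAt E2 x₁).map_target hy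
      have hz4 : chartAt E2 x₁ ((chartAt E2 x₀).symm z) = y := by
        rw [hz2, (chartAt E2 x₁).right_inv hy]
      have e' := localRep_eventuallyEq w x₁ x₀ hz1 hz3
      refine DifferentiableAt.congr_of_eventuallyEq ?_ e'
      have h5 : DifferentiableAt ℝ (localRep w x₁)
          (chartAt E2 x₁ ((chartAt E2 x₀).symm z)) := by rwa [hz4]
      exact DifferentiableAt.comp (g := localRep w x₁) z h5
        (smoothNear_transition x₁ x₀ hz1 hz3).differentiableAt
    simp only [pd, fderiv_zero_of_not_differentiableAt hd, fderiv_zero_of_not_differentiableAt hd',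
      pull1]
    simp

section AtPoint

variable {F : M → E4} (x₀ : M) {y : E2}

/-- The change of charts from the preferred chart at `x` to the chart at `x₀`. -/
theorem IsSmoothImmersion.isReparam_coord (hF : IsSmoothImmersion F) {x₀ x : M}
    (hx : x ∈ (chartAt E2 x₀).source) :
    IsReparam (localRep F x₀) (localRep F x)
      (fun z => chartAt E2 x₀ ((chartAt E2 x).symm z)) (coord x) ∧
    chartAt E2 x₀ ((chartAt E2 x).symm (coord x)) = chartAt E2 x₀ x := by
  have h1 : (chartAt E2 x).symm (coord x) = x := (chartAt E2 x).left_inv (mem_chart_source E2 x)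
  refine ⟨hF.isReparam x₀ x (mem_chart_target E2 x) ?_, by rw [h1]⟩
  rwa [coord, (chartAt E2 x).left_inv (mem_chart_source E2 x)]

variable {x₀} {x : M}

/-- At each point the definition uses the preferred chart of that point, which may jump from point
to point. This and the next lemmas express the invariants in one fixed chart, where regularity can
be seen. -/
theorem IsSmoothImmersion.meanCurv_eq (hF : IsSmoothImmersion F)
    (hx : x ∈ (chartAt E2 x₀).source) :
    meanCurv F x = meanVec (localRep F x₀) (chartAt E2 x₀ x) := by
  obtain ⟨h, e⟩ := hF.isReparam_coord hx
  have : secondFFAt F x = _ := h.secondFF_fun_eq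
  rw [meanCurv, this, meanVec, ← e, trace2_pull h.invMetric_eq]; rfl

theorem IsSmoothImmersion.normSqA_eq (hF : IsSmoothImmersion F)
    (hx : x ∈ (chartAt E2 x₀).source) :
    normSqA F x = sqA (localRep F x₀) (chartAt E2 x₀ x) := by
  obtain ⟨h, e⟩ := hF.isReparam_coord hx
  have : secondFFAt F x = _ := h.secondFF_fun_eq
  rw [normSqA, this, sqA, ← e, normSq2_pull h.invMetric_eq]; rfl

theorem IsSmoothImmersion.normSqGradA_eq (hF : IsSmoothImmersion F)
    (hx : x ∈ (chartAt E2 x₀).source) :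
    normSqGradA F x = sqGradA (localRep F x₀) (chartAt E2 x₀ x) := by
  obtain ⟨h, e⟩ := hF.isReparam_coord hx
  rw [normSqGradA, h.covSecondFF_fun_eq, sqGradA, ← e, normSq3_pull h.invMetric_eq]; rfl

theorem IsSmoothImmersion.absNormalCurv_eq (hF : IsSmoothImmersion F)
    (hx : x ∈ (chartAt E2 x₀).source) :
    absNormalCurv F x = Real.sqrt (sqNormalCurv (localRep F x₀) (chartAt E2 x₀ x)) / 2 := by
  obtain ⟨h, e⟩ := hF.isReparam_coord hx
  have : secondFFAt F x = _ := h.secondFF_fun_eq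
  rw [absNormalCurv, this, sqNormalCurv, ← e, normalCurvNormSq_pull h.invMetric_eq]; rfl

theorem IsSmoothImmersion.simonsDiv_eq (hF : IsSmoothImmersion F)
    (hx : x ∈ (chartAt E2 x₀).source) :
    simonsDiv (localRep F x) (coord x) = simonsDiv (localRep F x₀) (chartAt E2 x₀ x) := by
  obtain ⟨h, e⟩ := hF.isReparam_coord hx
  rw [h.simonsDiv_eq, e]

theorem IsSmoothImmersion.normSqTracelessA_eq (hF : IsSmoothImmersion F) (x : M) :
    normSqTracelessA F x = normSqA F x - 1 / 2 * ‖meanCurv F x‖ ^ 2 := by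
  obtain ⟨C, hC, hG⟩ := (hF.isRegularAt x (mem_chart_target E2 x)).exists_frame
  exact normSq2_traceless hG hC _

theorem IsSmoothImmersion.normSqGrad_eq (hF : IsSmoothImmersion F)
    (hx : x ∈ (chartAt E2 x₀).source) (f : M → ℝ) :
    normSqGrad F f x = pairing (invMetric (localRep F x₀) (chartAt E2 x₀ x))
      (fun i => pd i (localRep f x₀) (chartAt E2 x₀ x))
      (fun i => pd i (localRep f x₀) (chartAt E2 x₀ x)) := by
  obtain ⟨h, e⟩ := hF.isReparam_coord hx
  have hp : (fun i => pd i (localRep f x) (coord x)) = _ := funext fun i =>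
    pd_localRep f x₀ x (mem_chart_target E2 x)
      (by rwa [(chartAt E2 x).left_inv (mem_chart_source E2 x)]) i
  change pairing _ (fun i => pd i (localRep f x) (coord x))
    (fun i => pd i (localRep f x) (coord x)) = _
  rw [hp, ← e, pairing_pull h.invMetric_eq]; rfl

theorem IsSmoothImmersion.fieldDeriv_eq (hF : IsSmoothImmersion F)
    (hx : x ∈ (chartAt E2 x₀).source) (f : M → ℝ) :
    fieldDeriv F f x = pairing (invMetric (localRep F x₀) (chartAt E2 x₀ x))
      (fun i => pd i (localRep f x₀) (chartAt E2 x₀ x))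
      (fun l => simonsField (localRep F x₀) l (chartAt E2 x₀ x)) := by
  obtain ⟨h, e⟩ := hF.isReparam_coord hx
  have hp : (fun i => pd i (localRep f x) (coord x)) = _ := funext fun i =>
    pd_localRep f x₀ x (mem_chart_target E2 x)
      (by rwa [(chartAt E2 x).left_inv (mem_chart_source E2 x)]) i
  have hq : (fun l => simonsField (localRep F x) l (coord x)) = _ := funext fun l =>
    h.simonsField_eq l
  rw [fieldDeriv, hp, hq, ← e, pairing_pull h.invMetric_eq]; rfl

/-- With the area density included, ⟨dψ, X⟩ becomes ∂ᵢψ times the flux, ready for Euclidean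
integration by parts. -/
theorem sqrt_det_mul_pairing (u : E2 → E4) (y : E2) (d : Fin 2 → ℝ) :
    Real.sqrt (metric u y).det * pairing (invMetric u y) d (fun l => simonsField u l y) =
      ∑ i, d i * simonsFlux u i y := by
  simp only [pairing, simonsFlux, Fin.sum_univ_two]
  ring

end AtPoint

end Charts

/-! ### The area measure in a chart -/

theorem det_fderiv_eq (φ : E2 → E2) (y : E2) : (fderiv ℝ φ y).det = (jac φ y).det := by
  rw [ContinuousLinearMap.det, ← LinearMap.det_toMatrix (EuclideanSpace.basisFun (Fin 2) ℝ).toBasis]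
  congr 1

theorem measurable_pd (u : E2 → E4) (i : Fin 2) : Measurable (pd i u) :=
  measurable_fderiv_apply_const ℝ u _

theorem measurable_pd_real (u : E2 → ℝ) (i : Fin 2) : Measurable (pd i u) :=
  measurable_fderiv_apply_const ℝ u _

theorem measurable_sqrt_det (u : E2 → E4) : Measurable fun y => Real.sqrt (metric u y).det := by
  simp only [Matrix.det_fin_two, metric, Matrix.of_apply]
  have := measurable_pd u
  fun_prop

section Area

variable {M : Type*} [TopologicalSpace M] [ChartedSpace E2 M] [MeasurableSpace M] [BorelSpace M]

theorem aemeasurable_chart_symm (x₀ : M) : AEMeasurable (chartAt E2 x₀).symm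
    (volume.restrict (chartAt E2 x₀).target) :=
  (chartAt E2 x₀).continuousOn_symm.aemeasurable (chartAt E2 x₀).open_target.measurableSet

theorem measurableSet_chart_source (x₀ : M) : MeasurableSet (chartAt E2 x₀).source :=
  (chartAt E2 x₀).open_source.measurableSet

theorem measurableSet_inter_preimage_of_continuousOn {X Y : Type*} [TopologicalSpace X]
    [MeasurableSpace X] [BorelSpace X] [TopologicalSpace Y] [MeasurableSpace Y] [BorelSpace Y]
    {f : X → Y} {s : Set X} (hs : MeasurableSet s) (hf : ContinuousOn f s) {A : Set Y}
    (hA : MeasurableSet A) : MeasurableSet (s ∩ f ⁻¹' A) := by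
  have h1 : Measurable fun x : s => f x := (continuousOn_iff_continuous_domRestrict.1 hf).measurable
  have h2 := hs.subtype_image (h1 hA)
  convert h2 using 1
  ext x
  simp [and_comm]

theorem lintegral_chartArea (F : M → E4) (x₀ : M) {g : M → ENNReal} (hg : Measurable g) :
    ∫⁻ x, g x ∂(chartArea F x₀) = ∫⁻ y in (chartAt E2 x₀).target,
      ENNReal.ofReal (Real.sqrt (metric (localRep F x₀) y).det) * g ((chartAt E2 x₀).symm y) := by
  have h := aemeasurable_chart_symm x₀
  have hd := (measurable_sqrt_det (localRep F x₀)).ennreal_ofReal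
  rw [chartArea, lintegral_map' hg.aemeasurable (h.mono_ac (withDensity_absolutelyContinuous _ _))]
  exact lintegral_withDensity_eq_lintegral_mul₀ hd.aemeasurable (hg.comp_aemeasurable h)

theorem chartArea_apply (F : M → E4) (x₀ : M) {A : Set M} (hA : MeasurableSet A) :
    chartArea F x₀ A = ∫⁻ y in (chartAt E2 x₀).target ∩ (chartAt E2 x₀).symm ⁻¹' A,
      ENNReal.ofReal (Real.sqrt (metric (localRep F x₀) y).det) := by
  have hm := measurableSet_inter_preimage_of_continuousOn
    (chartAt E2 x₀).open_target.measurableSet (chartAt E2 x₀).continuousOn_symm hA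
  rw [← lintegral_indicator_one hA, lintegral_chartArea F x₀ (measurable_one.indicator hA),
    ← lintegral_indicator (chartAt E2 x₀).open_target.measurableSet, ← lintegral_indicator hm]
  congr 1
  funext y
  by_cases h1 : y ∈ (chartAt E2 x₀).target <;> by_cases h2 : (chartAt E2 x₀).symm y ∈ A <;>
    simp [Set.indicator, h1, h2]

theorem chartArea_inter_source (F : M → E4) (x₀ : M) {A : Set M} (hA : MeasurableSet A) :
    chartArea F x₀ (A ∩ (chartAt E2 x₀).source) = chartArea F x₀ A := by
  rw [chartArea_apply F x₀ hA, chartArea_apply F x₀ (hA.inter (measurableSet_chart_source x₀))]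
  congr 2
  ext y
  simp only [Set.mem_inter_iff, Set.mem_preimage]
  exact ⟨fun h => ⟨h.1, h.2.1⟩, fun h => ⟨h.1, h.2, (chartAt E2 x₀).map_target h.1⟩⟩

variable [IsManifold (𝓡 2) ∞ M] {F : M → E4}

/-- The change-of-variables formula for the transition map, whose Jacobian factor is matched by
`sqrt_det_metric_eq`. -/
theorem IsSmoothImmersion.chartArea_eq (hF : IsSmoothImmersion F) (x₀ x₁ : M) {A : Set M}
    (hA : MeasurableSet A) (h0 : A ⊆ (chartAt E2 x₀).source) (h1 : A ⊆ (chartAt E2 x₁).source) :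
    chartArea F x₀ A = chartArea F x₁ A := by
  set φ : E2 → E2 := fun z => chartAt E2 x₀ ((chartAt E2 x₁).symm z) with hφ
  set S := (chartAt E2 x₁).target ∩ (chartAt E2 x₁).symm ⁻¹' A with hS
  have hSm : MeasurableSet S := measurableSet_inter_preimage_of_continuousOn
    (chartAt E2 x₁).open_target.measurableSet (chartAt E2 x₁).continuousOn_symm hA
  have him : φ '' S = (chartAt E2 x₀).target ∩ (chartAt E2 x₀).symm ⁻¹' A := by
    ext y
    constructor
    · rintro ⟨z, ⟨hz1, hz2⟩, rfl⟩
      refine ⟨(chartAt E2 x₀).map_source (h0 hz2), ?_⟩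
      simp only [hφ, Set.mem_preimage, (chartAt E2 x₀).left_inv (h0 hz2)]
      exact hz2
    · rintro ⟨hy1, hy2⟩
      refine ⟨chartAt E2 x₁ ((chartAt E2 x₀).symm y), ⟨(chartAt E2 x₁).map_source (h1 hy2), ?_⟩, ?_⟩
      · simp only [Set.mem_preimage, (chartAt E2 x₁).left_inv (h1 hy2)]
        exact hy2
      · simp only [hφ, (chartAt E2 x₁).left_inv (h1 hy2), (chartAt E2 x₀).right_inv hy1]
  have hinj : Set.InjOn φ S := by
    intro a ha b hb hab
    have := (chartAt E2 x₀).injOn (h0 ha.2) (h0 hb.2) hab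
    exact (chartAt E2 x₁).symm.injOn ha.1 hb.1 this
  have hd : ∀ z ∈ S, HasFDerivWithinAt φ (fderiv ℝ φ z) S z := fun z hz =>
    (smoothNear_transition x₀ x₁ hz.1 (h0 hz.2)).differentiableAt.hasFDerivAt.hasFDerivWithinAt
  rw [chartArea_apply F x₀ hA, chartArea_apply F x₁ hA, ← him,
    lintegral_image_eq_lintegral_abs_det_fderiv_mul volume hSm hd hinj]
  refine setLIntegral_congr_fun hSm fun z hz => ?_
  have hr := hF.isReparam x₀ x₁ hz.1 (h0 hz.2)
  rw [hr.sqrt_det_metric_eq, ENNReal.ofReal_mul (abs_nonneg _), det_fderiv_eq]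

theorem IsSmoothImmersion.area_restrict (hF : IsSmoothImmersion F) (x₀ : M) :
    (area F).restrict (chartAt E2 x₀).source = chartArea F x₀ := by
  have hU := measurableSet_chart_source x₀
  have hle : ∀ x, chartArea F x ≤ area F := le_iSup (chartArea F)
  -- A supremum of measures is controlled through a measure dominating all of them. Each chart
  -- measure splits into its part in the chart at x₀, where the two chart measures agree on the
  -- overlap, and its part outside.
  have hub : area F ≤ chartArea F x₀ + (area F).restrict (chartAt E2 x₀).sourceᶜ := by
    refine iSup_le fun x => Measure.le_iff.2 fun A hA => ?_
    rw [← measure_inter_add_sdiff A hU, Measure.add_apply, Measure.restrict_apply hA,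
      ← Set.sdiff_eq]
    refine add_le_add ?_ (hle x _)
    have hAU := hA.inter hU
    rw [← chartArea_inter_source F x hAU, hF.chartArea_eq x x₀
      (hAU.inter (measurableSet_chart_source x)) Set.inter_subset_right
      (Set.inter_subset_left.trans Set.inter_subset_right)]
    exact measure_mono (Set.inter_subset_left.trans Set.inter_subset_left)
  ext A hA
  rw [Measure.restrict_apply hA]
  apply le_antisymm
  · refine (hub _).trans ?_
    rw [Measure.add_apply, Measure.restrict_apply (hA.inter hU), chartArea_inter_source F x₀ hA,
      Set.inter_assoc, Set.inter_compl_self, Set.inter_empty, measure_empty, add_zero]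
  · rw [← chartArea_inter_source F x₀ hA]
    exact hle x₀ _

theorem IsSmoothImmersion.area_apply (hF : IsSmoothImmersion F) (x₀ : M) {A : Set M}
    (hA : MeasurableSet A) (h0 : A ⊆ (chartAt E2 x₀).source) :
    area F A = ∫⁻ y in (chartAt E2 x₀).target ∩ (chartAt E2 x₀).symm ⁻¹' A,
      ENNReal.ofReal (Real.sqrt (metric (localRep F x₀) y).det) := by
  rw [← chartArea_apply F x₀ hA, ← hF.area_restrict, Measure.restrict_apply hA,
    Set.inter_eq_left.2 h0]

/-- Null sets of the plane are null sets of the area measure. -/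
theorem IsSmoothImmersion.area_null (hF : IsSmoothImmersion F) (x₀ : M) {N : Set E2}
    (hN : volume N = 0) : area F ((chartAt E2 x₀).source ∩ chartAt E2 x₀ ⁻¹' N) = 0 := by
  set N' := toMeasurable volume N
  have hN' : volume N' = 0 := by rw [measure_toMeasurable, hN]
  have hm : MeasurableSet ((chartAt E2 x₀).source ∩ chartAt E2 x₀ ⁻¹' N') :=
    measurableSet_inter_preimage_of_continuousOn (measurableSet_chart_source x₀)
      (chartAt E2 x₀).continuousOn (measurableSet_toMeasurable _ _)
  refine measure_mono_null (Set.inter_subset_inter_right _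
    (Set.preimage_mono (subset_toMeasurable volume N))) ?_
  rw [hF.area_apply x₀ hm Set.inter_subset_left]
  refine setLIntegral_measure_zero _ _ (measure_mono_null ?_ hN')
  rintro y ⟨hy1, -, hy3⟩
  simpa [(chartAt E2 x₀).right_inv hy1] using hy3

/-- A property that holds almost everywhere in every chart holds almost everywhere. -/
theorem IsSmoothImmersion.ae_area [CompactSpace M] (hF : IsSmoothImmersion F) {P : M → Prop}
    (h : ∀ x₀ : M, ∀ᵐ y ∂volume, y ∈ (chartAt E2 x₀).target → P ((chartAt E2 x₀).symm y)) :
    ∀ᵐ x ∂(area F), P x := by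
  obtain ⟨t, ht⟩ := isCompact_univ.elim_nhds_subcover (fun x : M => (chartAt E2 x).source)
    fun x _ => (chartAt E2 x).open_source.mem_nhds (mem_chart_source E2 x)
  have hn : area F (⋃ x₀ ∈ t, ((chartAt E2 x₀).source ∩ chartAt E2 x₀ ⁻¹'
      {y | ¬ (y ∈ (chartAt E2 x₀).target → P ((chartAt E2 x₀).symm y))})) = 0 := by
    exact (measure_biUnion_null_iff t.countable_toSet).2 fun x₀ _ => hF.area_null x₀ (h x₀)
  rw [ae_iff]
  refine measure_mono_null (fun x hx => ?_) hn
  obtain ⟨x₀, hx₀, hxs⟩ := Set.mem_iUnion₂.1 (ht.2 (Set.mem_univ x))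
  refine Set.mem_iUnion₂.2 ⟨x₀, hx₀, hxs, ?_⟩
  simp only [Set.mem_preimage, Set.mem_ofPred_eq, (chartAt E2 x₀).map_source hxs,
    (chartAt E2 x₀).left_inv hxs, true_imp_iff]
  exact hx

theorem IsSmoothImmersion.exists_nhds_area_lt_top (hF : IsSmoothImmersion F) (x₀ : M) {V : Set E2}
    (hV : V ∈ 𝓝 (coord x₀)) : ∃ s ∈ 𝓝 x₀, MeasurableSet s ∧ s ⊆ (chartAt E2 x₀).source ∧
      (∀ x ∈ s, chartAt E2 x₀ x ∈ V) ∧ area F s < ⊤ := by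
  obtain ⟨r, hr, hrs⟩ := Metric.nhds_basis_closedBall.mem_iff.1
    (Filter.inter_mem hV ((chartAt E2 x₀).open_target.mem_nhds (mem_chart_target E2 x₀)))
  have hm : MeasurableSet ((chartAt E2 x₀).source ∩ chartAt E2 x₀ ⁻¹' Metric.closedBall (coord x₀) r) :=
    measurableSet_inter_preimage_of_continuousOn (measurableSet_chart_source x₀)
      (chartAt E2 x₀).continuousOn Metric.isClosed_closedBall.measurableSet
  refine ⟨_, ?_, hm, Set.inter_subset_left, fun x hx => (hrs hx.2).1, ?_⟩
  · exact Filter.inter_mem ((chartAt E2 x₀).open_source.mem_nhds (mem_chart_source E2 x₀))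
      (((chartAt E2 x₀).continuousAt (mem_chart_source E2 x₀)).preimage_mem_nhds
        (Metric.closedBall_mem_nhds _ hr))
  · rw [hF.area_apply x₀ hm Set.inter_subset_left]
    have hc : ContinuousOn (fun y => Real.sqrt (metric (localRep F x₀) y).det)
        (Metric.closedBall (coord x₀) r) := fun y hy =>
      (hF.isRegularAt x₀ (hrs hy).2).smooth_sqrt_det.contDiffAt.continuousAt.continuousWithinAt
    have hi := hc.integrableOn_compact (μ := volume) (isCompact_closedBall _ _)
    refine lt_of_le_of_lt ?_ hi.lintegral_lt_top
    refine lintegral_mono_set ?_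
    rintro y ⟨hy1, -, hy3⟩
    simpa [(chartAt E2 x₀).right_inv hy1] using hy3

/-- Functions that are measurable and bounded in charts are integrable on a closed surface. -/
theorem IsSmoothImmersion.integrable_area [CompactSpace M] (hF : IsSmoothImmersion F) {h : M → ℝ}
    (H : ∀ x₀ : M, ∃ V ∈ 𝓝 (coord x₀), ∃ q : E2 → ℝ, ∃ K : ℝ,
      AEMeasurable q (volume.restrict V) ∧
      ∀ y ∈ V, h ((chartAt E2 x₀).symm y) = q y ∧ |q y| ≤ K) : Integrable h (area F) := by
  rw [← integrableOn_univ]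
  refine LocallyIntegrable.integrableOn_isCompact (fun x₀ => ?_) isCompact_univ
  obtain ⟨V, hV, q, K, hq, hK⟩ := H x₀
  obtain ⟨s, hs, hsm, hsU, hsV, hst⟩ := hF.exists_nhds_area_lt_top x₀ hV
  refine ⟨s, hs, ?_⟩
  have hval : ∀ x ∈ s, h x = q (chartAt E2 x₀ x) ∧ |q (chartAt E2 x₀ x)| ≤ K := by
    intro x hx
    have := hK _ (hsV x hx)
    rwa [(chartAt E2 x₀).left_inv (hsU hx)] at this
  have : IsFiniteMeasure ((area F).restrict s) := ⟨by rwa [Measure.restrict_apply_univ]⟩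
  refine Integrable.of_bound ?_ K ?_
  · obtain ⟨V', hV'V, hV'o, hxV'⟩ := mem_nhds_iff.1 hV
    have hqm : Measurable (hq.mk q) := hq.measurable_mk
    have hcm : AEMeasurable (chartAt E2 x₀) ((area F).restrict s) :=
      ((chartAt E2 x₀).continuousOn.mono hsU).aemeasurable hsm
    refine AEMeasurable.aestronglyMeasurable ⟨_, (hqm.comp_aemeasurable hcm).measurable_mk, ?_⟩
    refine EventuallyEq.trans ?_ (hqm.comp_aemeasurable hcm).ae_eq_mk
    -- V need not be measurable, so the exceptional set is enlarged to a measurable null set of the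
    -- plane before it is pulled back by `area_null`.
    have h1 : ∃ W, MeasurableSet W ∧ volume W = 0 ∧ ∀ y ∈ V, y ∉ W → q y = hq.mk q y := by
      have h2 := measure_toMeasurable (μ := (volume : Measure E2).restrict V) {y | ¬ q y = hq.mk q y}
      rw [show (volume.restrict V) {y | ¬ q y = hq.mk q y} = 0 from hq.ae_eq_mk] at h2
      rw [Measure.restrict_apply (measurableSet_toMeasurable _ _)] at h2
      refine ⟨toMeasurable volume (toMeasurable (volume.restrict V) {y | ¬ q y = hq.mk q y} ∩ V),
        measurableSet_toMeasurable _ _, by rw [measure_toMeasurable, h2], ?_⟩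
      intro y hy hyW
      by_contra hne
      exact hyW (subset_toMeasurable _ _ ⟨subset_toMeasurable _ _ hne, hy⟩)
    obtain ⟨W, -, hW0, hW⟩ := h1
    have h3 := hF.area_null x₀ hW0
    rw [EventuallyEq, ae_restrict_iff' hsm]
    refine (measure_eq_zero_iff_ae_notMem.1 h3).mono fun x hx hxs => ?_
    rw [(hval x hxs).1]
    exact hW _ (hsV x hxs) fun hxW => hx ⟨hsU hxs, hxW⟩
  · rw [ae_restrict_iff' hsm]
    exact Eventually.of_forall fun x hx => by rw [(hval x hx).1]; exact (hval x hx).2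

/-- Integration in a chart. -/
theorem IsSmoothImmersion.integral_area (hF : IsSmoothImmersion F) (x₀ : M) {h : M → ℝ}
    (hh : Integrable h (area F)) (h0 : ∀ x ∉ (chartAt E2 x₀).source, h x = 0) :
    ∫ x, h x ∂(area F) = ∫ y in (chartAt E2 x₀).target,
      Real.sqrt (metric (localRep F x₀) y).det * h ((chartAt E2 x₀).symm y) := by
  have hm := hh.aestronglyMeasurable.restrict (s := (chartAt E2 x₀).source)
  rw [← setIntegral_eq_integral_of_forall_compl_eq_zero h0, hF.area_restrict] at *
  rw [chartArea] at hm ⊢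
  rw [integral_map ((aemeasurable_chart_symm x₀).mono_ac (withDensity_absolutelyContinuous _ _)) hm,
    integral_withDensity_eq_integral_toReal_smul
      (measurable_sqrt_det (localRep F x₀)).ennreal_ofReal (by simp)]
  simp [ENNReal.toReal_ofReal (Real.sqrt_nonneg _)]

end Area

/-! ### Locally Lipschitz functions -/

section Lipschitz

variable {V W : Type*} [NormedAddCommGroup V] [NormedSpace ℝ V]
  [NormedAddCommGroup W] [NormedSpace ℝ W] {y : E2}

/-- `w` is Lipschitz in a neighbourhood of `y`. -/
def LipNear (w : E2 → V) (y : E2) : Prop := ∃ K, ∃ t ∈ 𝓝 y, LipschitzOnWith K w t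

theorem SmoothNear.lipNear {w : E2 → V} (h : SmoothNear w y) : LipNear w y :=
  (h.contDiffAt.of_le (by simp)).exists_lipschitzOnWith

theorem LipNear.congr {w v : E2 → V} (h : LipNear w y) (hv : v =ᶠ[𝓝 y] w) : LipNear v y := by
  obtain ⟨K, t, ht, hK⟩ := h
  refine ⟨K, _, Filter.inter_mem ht hv, fun x hx z hz => ?_⟩
  rw [hx.2, hz.2]
  exact hK hx.1 hz.1

theorem LipNear.eventually {w : E2 → V} (h : LipNear w y) : ∀ᶠ z in 𝓝 y, LipNear w z := by
  obtain ⟨K, t, ht, hK⟩ := h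
  filter_upwards [eventually_mem_nhds_iff.2 ht] with z hz using ⟨K, t, hz, hK⟩

theorem LipNear.continuousAt {w : E2 → V} (h : LipNear w y) : ContinuousAt w y := by
  obtain ⟨K, t, ht, hK⟩ := h
  exact hK.continuousOn.continuousAt ht

theorem LipNear.comp {w : E2 → V} (h : LipNear w y) {g : V → W} (hg : ContDiffAt ℝ 1 g (w y)) :
    LipNear (fun z => g (w z)) y := by
  obtain ⟨K', t', ht', hK'⟩ := hg.exists_lipschitzOnWith
  have hc := h.continuousAt.preimage_mem_nhds ht'
  obtain ⟨K, t, ht, hK⟩ := h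
  exact ⟨K' * K, _, Filter.inter_mem ht hc, hK'.comp (hK.mono Set.inter_subset_left)
    fun x hx => hx.2⟩

theorem LipNear.prodMk {w : E2 → V} {v : E2 → W} (hw : LipNear w y) (hv : LipNear v y) :
    LipNear (fun z => (w z, v z)) y := by
  obtain ⟨K, t, ht, hK⟩ := hw
  obtain ⟨K', t', ht', hK'⟩ := hv
  exact ⟨max K K', _, Filter.inter_mem ht ht', (hK.mono Set.inter_subset_left).prodMk
    (hK'.mono Set.inter_subset_right)⟩

theorem LipNear.norm {w : E2 → V} (hw : LipNear w y) : LipNear (fun z => ‖w z‖) y := by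
  obtain ⟨K, t, ht, hK⟩ := hw
  exact ⟨1 * K, t, ht, lipschitzWith_one_norm.comp_lipschitzOnWith hK⟩

theorem LipNear.mul {w v : E2 → ℝ} (hw : LipNear w y) (hv : LipNear v y) :
    LipNear (fun z => w z * v z) y :=
  (hw.prodMk hv).comp (g := fun p : ℝ × ℝ => p.1 * p.2) (contDiffAt_fst.mul contDiffAt_snd)

theorem LipNear.add {w v : E2 → ℝ} (hw : LipNear w y) (hv : LipNear v y) :
    LipNear (fun z => w z + v z) y :=
  (hw.prodMk hv).comp (g := fun p : ℝ × ℝ => p.1 + p.2) (contDiffAt_fst.add contDiffAt_snd)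

/-- Compactness gives a Lipschitz constant on a ball whose radius exceeds that of the support by
one. A point outside this ball has distance at least 1 from the support, so there the sup bound of
|w| serves as the constant. -/
theorem exists_lipschitzWith_of_lipNear {w : E2 → ℝ} (hw : ∀ y, LipNear w y)
    (hc : HasCompactSupport w) : ∃ K, LipschitzWith K w := by
  have hcont : Continuous w := continuous_iff_continuousAt.2 fun y => (hw y).continuousAt
  obtain ⟨C, hC⟩ := hc.exists_bound_of_continuous hcont
  obtain ⟨R, hR⟩ := hc.isCompact.isBounded.subset_closedBall (0 : E2)
  have hloc : LocallyLipschitzOn (Metric.closedBall (0 : E2) (R + 1)) w := fun y _ => by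
    obtain ⟨K, t, ht, hK⟩ := hw y
    exact ⟨K, t, mem_nhdsWithin_of_mem_nhds ht, hK⟩
  obtain ⟨K, hK⟩ := hloc.exists_lipschitzOnWith_of_compact (isCompact_closedBall _ _)
  have hC0 : 0 ≤ C := (norm_nonneg _).trans (hC 0)
  have h0 : ∀ x, x ∉ tsupport w → w x = 0 := fun x hx => image_eq_zero_of_notMem_tsupport hx
  have key : ∀ x z, x ∈ tsupport w → dist (w x) (w z) ≤ max K (Real.toNNReal C) * dist x z := by
    intro x z hx
    by_cases hz : z ∈ Metric.closedBall (0 : E2) (R + 1)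
    · refine (hK.dist_le_mul x ?_ z hz).trans ?_
      · exact Metric.closedBall_subset_closedBall (by linarith) (hR hx)
      · gcongr; exact le_max_left _ _
    · have hz' : z ∉ tsupport w := fun h =>
        hz (Metric.closedBall_subset_closedBall (by linarith) (hR h))
      rw [h0 z hz', dist_zero_right]
      have h1 : 1 ≤ dist x z := by
        have := hR hx
        rw [Metric.mem_closedBall] at this hz
        have := dist_triangle z x 0
        rw [dist_comm z x] at this
        linarith
      have h2 : C ≤ ((max K (Real.toNNReal C) : NNReal) : ℝ) := by
        rw [NNReal.coe_max, Real.coe_toNNReal C hC0]; exact le_max_right _ _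
      calc ‖w x‖ ≤ C * 1 := by rw [mul_one]; exact hC x
        _ ≤ _ := by gcongr
  refine ⟨max K (Real.toNNReal C), LipschitzWith.of_dist_le_mul fun x z => ?_⟩
  by_cases hx : x ∈ tsupport w
  · exact key x z hx
  · by_cases hz : z ∈ tsupport w
    · rw [dist_comm, dist_comm x]; exact key z x hz
    · rw [h0 x hx, h0 z hz, dist_self]; positivity

/-- Rademacher's theorem near each point, globalized because locally null sets are null. -/
theorem ae_differentiableAt_of_lipNear {w : E2 → ℝ} {T : Set E2} (hw : ∀ y ∈ T, LipNear w y) :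
    ∀ᵐ y ∂volume, y ∈ T → DifferentiableAt ℝ w y := by
  rw [ae_iff]
  refine measure_null_of_locally_null _ fun y hy => ?_
  simp only [Set.mem_ofPred_eq, Classical.not_imp] at hy
  obtain ⟨K, t, ht, hK⟩ := hw y hy.1
  refine ⟨interior t ∩ {a | ¬ (a ∈ T → DifferentiableAt ℝ w a)}, ?_, ?_⟩
  · exact Filter.inter_mem (mem_nhdsWithin_of_mem_nhds (interior_mem_nhds.2 ht)) self_mem_nhdsWithin
  · have h1 := (hK.mono interior_subset).ae_differentiableWithinAt (μ := volume)
      isOpen_interior.measurableSet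
    rw [ae_restrict_iff' isOpen_interior.measurableSet, ae_iff] at h1
    refine measure_mono_null ?_ h1
    rintro a ⟨ha, ha'⟩
    simp only [Set.mem_ofPred_eq, Classical.not_imp] at ha' ⊢
    exact ⟨ha, fun h => ha'.2 (h.differentiableAt (isOpen_interior.mem_nhds ha))⟩

/-- `q` is bounded and almost everywhere measurable near `y`. -/
def BddNear (q : E2 → ℝ) (y : E2) : Prop :=
  ∃ V ∈ 𝓝 y, ∃ K : ℝ, AEMeasurable q (volume.restrict V) ∧ ∀ z ∈ V, |q z| ≤ K

theorem BddNear.mul {p q : E2 → ℝ} (hp : BddNear p y) (hq : BddNear q y) :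
    BddNear (fun z => p z * q z) y := by
  obtain ⟨V, hV, K, hm, hK⟩ := hp
  obtain ⟨V', hV', K', hm', hK'⟩ := hq
  refine ⟨_, Filter.inter_mem hV hV', K * K',
    (hm.mono_measure (Measure.restrict_mono Set.inter_subset_left le_rfl)).mul
    (hm'.mono_measure (Measure.restrict_mono Set.inter_subset_right le_rfl)), fun z hz => ?_⟩
  rw [abs_mul]
  exact mul_le_mul (hK z hz.1) (hK' z hz.2) (abs_nonneg _) ((abs_nonneg _).trans (hK z hz.1))

theorem BddNear.add {p q : E2 → ℝ} (hp : BddNear p y) (hq : BddNear q y) :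
    BddNear (fun z => p z + q z) y := by
  obtain ⟨V, hV, K, hm, hK⟩ := hp
  obtain ⟨V', hV', K', hm', hK'⟩ := hq
  exact ⟨_, Filter.inter_mem hV hV', K + K',
    (hm.mono_measure (Measure.restrict_mono Set.inter_subset_left le_rfl)).add
    (hm'.mono_measure (Measure.restrict_mono Set.inter_subset_right le_rfl)), fun z hz =>
    (abs_add_le _ _).trans (add_le_add (hK z hz.1) (hK' z hz.2))⟩

theorem BddNear.congr {p q : E2 → ℝ} (hp : BddNear p y) (h : q =ᶠ[𝓝 y] p) : BddNear q y := by
  obtain ⟨V, hV, K, hm, hK⟩ := hp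
  obtain ⟨U, hUs, hUo, hyU⟩ := mem_nhds_iff.1 (Filter.inter_mem hV h)
  refine ⟨U, hUo.mem_nhds hyU, K, ?_, fun z hz => ?_⟩
  · refine (hm.mono_measure (Measure.restrict_mono (hUs.trans Set.inter_subset_left) le_rfl)).congr ?_
    rw [EventuallyEq, ae_restrict_iff' hUo.measurableSet]
    exact Eventually.of_forall fun z hz => ((hUs hz).2).symm
  · rw [(hUs hz).2]; exact hK z (hUs hz).1

theorem bddNear_of_continuousAt {q : E2 → ℝ} (h : ∀ᶠ z in 𝓝 y, ContinuousAt q z) :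
    BddNear q y := by
  have h1 : ∀ᶠ z in 𝓝 y, |q z| < |q y| + 1 :=
    h.self_of_nhds.abs.eventually_lt continuousAt_const (by simp)
  obtain ⟨V, hVs, hVo, hyV⟩ := mem_nhds_iff.1 (Filter.inter_mem h h1)
  refine ⟨V, hVo.mem_nhds hyV, |q y| + 1, ?_, fun z hz => (hVs hz).2.le⟩
  exact ContinuousOn.aemeasurable (fun z hz => (hVs hz).1.continuousWithinAt) hVo.measurableSet

theorem LipNear.bddNear {q : E2 → ℝ} (h : LipNear q y) : BddNear q y :=
  bddNear_of_continuousAt (h.eventually.mono fun _ hz => hz.continuousAt)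

theorem SmoothNear.bddNear {q : E2 → ℝ} (h : SmoothNear q y) : BddNear q y := h.lipNear.bddNear

theorem LipNear.bddNear_pd {q : E2 → ℝ} (h : LipNear q y) (i : Fin 2) : BddNear (pd i q) y := by
  obtain ⟨K, t, ht, hK⟩ := h
  refine ⟨interior t, interior_mem_nhds.2 ht, K, (measurable_pd_real q i).aemeasurable,
    fun z hz => ?_⟩
  have h1 := norm_fderiv_le_of_lipschitzOn ℝ (mem_interior_iff_mem_nhds.1 hz) hK
  have h2 := (fderiv ℝ q z).le_opNorm (EuclideanSpace.single i 1)
  simp only [PiLp.norm_single, norm_one, mul_one] at h2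
  exact h2.trans h1

/-- Integration by parts against a compactly supported Lipschitz function. -/
theorem integral_pd_mul {ψ : E2 → ℝ} {K : NNReal} (hψ : LipschitzWith K ψ)
    (hc : HasCompactSupport ψ) {T : Set E2} (hT : IsOpen T) (hs : tsupport ψ ⊆ T) {Y : E2 → ℝ}
    (hY : ∀ y ∈ T, SmoothNear Y y) (i : Fin 2) :
    Integrable (fun y => pd i ψ y * Y y) ∧ Integrable (fun y => ψ y * pd i Y y) ∧
      ∫ y, pd i ψ y * Y y = - ∫ y, ψ y * pd i Y y := by
  obtain ⟨R, hR⟩ := hc.isCompact.isBounded.subset_ball (0 : E2)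
  -- Y is smooth only on T. A cutoff equal to 1 near the support of ψ replaces it by a compactly
  -- supported C¹ function, hence a Lipschitz one, without changing either integrand.
  obtain ⟨χ, hχ0, hχ1, -⟩ := exists_contMDiffMap_zero_one_nhds_of_isClosed 𝓘(ℝ, E2) (n := ⊤)
    (s := (T ∩ Metric.ball 0 R)ᶜ) (t := tsupport ψ)
    (hT.inter Metric.isOpen_ball).isClosed_compl (isClosed_tsupport ψ)
    (by rw [Set.disjoint_compl_left_iff_subset]; exact Set.subset_inter hs hR)
  have hχs : ContDiff ℝ ∞ χ := χ.contMDiff.contDiff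
  set f : E2 → ℝ := fun y => χ y * Y y with hf
  have hfs : ContDiff ℝ 1 f := by
    rw [contDiff_iff_contDiffAt]
    intro y
    by_cases hy : y ∈ T
    · exact (hχs.contDiffAt.mul (hY y hy).contDiffAt).of_le (by simp)
    · have h1 : ∀ᶠ z in 𝓝 y, χ z = 0 := hχ0.filter_mono
        (nhds_le_nhdsSet (by simp [hy]))
      refine contDiffAt_const (c := (0 : ℝ)) |>.congr_of_eventuallyEq ?_
      filter_upwards [h1] with z hz
      simp [hf, hz]
  have hfc : HasCompactSupport f := by
    refine HasCompactSupport.intro (isCompact_closedBall (0 : E2) R) fun x hx => ?_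
    have : χ x = 0 := hχ0.self_of_nhdsSet x fun h => hx (Metric.ball_subset_closedBall h.2)
    simp [hf, this]
  obtain ⟨C, hC⟩ := hfs.lipschitzWith_of_hasCompactSupport hfc (by simp)
  have hfY : ∀ y ∈ tsupport ψ, f =ᶠ[𝓝 y] Y := by
    intro y hy
    filter_upwards [hχ1.filter_mono (nhds_le_nhdsSet hy)] with z hz
    simp [hf, hz]
  have hψ0 : ∀ y ∉ tsupport ψ, ψ y = 0 ∧ pd i ψ y = 0 := by
    intro y hy
    have h0 : ψ =ᶠ[𝓝 y] fun _ => 0 := by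
      have := (isClosed_tsupport ψ).isOpen_compl.mem_nhds hy
      filter_upwards [this] with z hz using image_eq_zero_of_notMem_tsupport hz
    exact ⟨h0.self_of_nhds, by rw [pd_congr h0, pd_const]⟩
  have e1 : (fun y => pd i ψ y * Y y) = fun y => pd i ψ y * f y := by
    funext y
    by_cases hy : y ∈ tsupport ψ
    · rw [(hfY y hy).self_of_nhds]
    · rw [(hψ0 y hy).2]; simp
  have e2 : (fun y => ψ y * pd i Y y) = fun y => ψ y * pd i f y := by
    funext y
    by_cases hy : y ∈ tsupport ψ
    · rw [pd_congr (hfY y hy)]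
    · rw [(hψ0 y hy).1]; simp
  have hfcont : Continuous f := hfs.continuous
  have hpd : Continuous (pd i f) := (hfs.continuous_fderiv (by simp)).clm_apply continuous_const
  rw [e1, e2]
  refine ⟨?_, ?_, ?_⟩
  · refine (hfcont.integrable_of_hasCompactSupport hfc).bdd_mul (c := K)
      (measurable_pd_real ψ i).aestronglyMeasurable (Eventually.of_forall fun y => ?_)
    have h1 := norm_fderiv_le_of_lipschitz ℝ (x₀ := y) hψ
    have h2 := (fderiv ℝ ψ y).le_opNorm (EuclideanSpace.single i 1)
    simp only [PiLp.norm_single, norm_one, mul_one] at h2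
    exact h2.trans h1
  · exact (hψ.continuous.mul hpd).integrable_of_hasCompactSupport hc.mul_right
  · have h := LipschitzWith.integral_lineDeriv_mul_eq (μ := (volume : Measure E2)) hC hψ hc
      (EuclideanSpace.single i 1)
    have l1 : ∀ x, lineDeriv ℝ f x (EuclideanSpace.single i 1) = pd i f x := fun x =>
      ((hfs.differentiable (by simp)) x).lineDeriv_eq_fderiv
    have l2 : ∀ᵐ x ∂(volume : Measure E2),
        lineDeriv ℝ ψ x (-EuclideanSpace.single i 1) * f x = - (pd i ψ x * f x) := by
      filter_upwards [hψ.ae_differentiableAt] with x hx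
      rw [hx.lineDeriv_eq_fderiv, map_neg, pd]; ring
    rw [integral_congr_ae l2, integral_neg] at h
    simp only [l1] at h
    rw [← neg_eq_iff_eq_neg, ← h]
    congr 1
    funext y
    ring

end Lipschitz

/-! ### Lipschitz functions on the closed surface and integration by parts in one chart -/

section Closed

variable {M : Type*} [TopologicalSpace M] [ChartedSpace E2 M]

/-- `ψ` is locally Lipschitz in every chart. -/
def LipInCharts (ψ : M → ℝ) : Prop :=
  ∀ x₀ : M, ∀ y ∈ (chartAt E2 x₀).target, LipNear (localRep ψ x₀) y

theorem LipInCharts.mul {ψ χ : M → ℝ} (hψ : LipInCharts ψ) (hχ : LipInCharts χ) :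
    LipInCharts fun x => ψ x * χ x := fun x₀ y hy => (hψ x₀ y hy).mul (hχ x₀ y hy)

theorem lipInCharts_of_chart {ψ : M → ℝ} {q : M → E2 → ℝ}
    (hq : ∀ x₀ : M, ∀ x ∈ (chartAt E2 x₀).source, ψ x = q x₀ (chartAt E2 x₀ x))
    (hs : ∀ x₀ : M, ∀ y ∈ (chartAt E2 x₀).target, LipNear (q x₀) y) : LipInCharts ψ := by
  intro x₀ y hy
  refine (hs x₀ y hy).congr ?_
  filter_upwards [(chartAt E2 x₀).open_target.mem_nhds hy] with z hz
  rw [localRep, hq x₀ _ ((chartAt E2 x₀).map_target hz), (chartAt E2 x₀).right_inv hz]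

theorem coord_mem_target (x : M) : coord x ∈ (chartAt E2 x).target := mem_chart_target E2 x

theorem chart_symm_coord (x : M) : (chartAt E2 x).symm (coord x) = x :=
  (chartAt E2 x).left_inv (mem_chart_source E2 x)

variable [IsManifold (𝓡 2) ∞ M] {F : M → E4}

theorem bddNear_pairing {G : E2 → Matrix (Fin 2) (Fin 2) ℝ} {p q : Fin 2 → E2 → ℝ} {y : E2}
    (hG : ∀ i j, BddNear (fun z => G z i j) y) (hp : ∀ i, BddNear (p i) y)
    (hq : ∀ i, BddNear (q i) y) :
    BddNear (fun z => pairing (G z) (fun i => p i z) fun i => q i z) y := by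
  simp only [pairing, Fin.sum_univ_two]
  have := fun i j => (hG i j).mul ((hp i).mul (hq j))
  exact ((this 0 0).add (this 0 1)).add ((this 1 0).add (this 1 1))

theorem IsSmoothImmersion.bddNear_fieldDeriv (hF : IsSmoothImmersion F) {ψ : M → ℝ}
    (hψ : LipInCharts ψ) (x₀ : M) : BddNear (localRep (fieldDeriv F ψ) x₀) (coord x₀) := by
  have hr := hF.isRegularAt x₀ (coord_mem_target x₀)
  refine (bddNear_pairing (fun i j => (hr.smooth_invMetric i j).bddNear)
    (fun i => (hψ x₀ _ (coord_mem_target x₀)).bddNear_pd i)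
    (fun l => (hr.smooth_simonsField l).bddNear)).congr ?_
  filter_upwards [(chartAt E2 x₀).open_target.mem_nhds (coord_mem_target x₀)] with y hy
  rw [localRep, hF.fieldDeriv_eq ((chartAt E2 x₀).map_target hy), (chartAt E2 x₀).right_inv hy]

theorem IsSmoothImmersion.bddNear_normSqGrad (hF : IsSmoothImmersion F) {ψ : M → ℝ}
    (hψ : LipInCharts ψ) (x₀ : M) : BddNear (localRep (normSqGrad F ψ) x₀) (coord x₀) := by
  have hr := hF.isRegularAt x₀ (coord_mem_target x₀)
  refine (bddNear_pairing (fun i j => (hr.smooth_invMetric i j).bddNear)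
    (fun i => (hψ x₀ _ (coord_mem_target x₀)).bddNear_pd i)
    (fun i => (hψ x₀ _ (coord_mem_target x₀)).bddNear_pd i)).congr ?_
  filter_upwards [(chartAt E2 x₀).open_target.mem_nhds (coord_mem_target x₀)] with y hy
  rw [localRep, hF.normSqGrad_eq ((chartAt E2 x₀).map_target hy), (chartAt E2 x₀).right_inv hy]

theorem IsRegularAt.smooth_meanVec {u : E2 → E4} {y : E2} (h : IsRegularAt u y) :
    SmoothNear (meanVec u) y := by
  unfold meanVec trace2
  exact .sum fun i => .sum fun j => (h.smooth_invMetric i j).smul (h.smooth_secondFF i j)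

theorem IsRegularAt.smooth_sqA {u : E2 → E4} {y : E2} (h : IsRegularAt u y) :
    SmoothNear (sqA u) y := by
  unfold sqA normSq2
  exact .sum fun i => .sum fun j => .sum fun k => .sum fun l =>
    ((h.smooth_invMetric i k).mul (h.smooth_invMetric j l)).mul
      ((h.smooth_secondFF i j).inner (h.smooth_secondFF k l))

theorem IsRegularAt.smooth_sqGradA {u : E2 → E4} {y : E2} (h : IsRegularAt u y) :
    SmoothNear (sqGradA u) y := by
  unfold sqGradA normSq3
  exact .sum fun i => .sum fun j => .sum fun k => .sum fun a => .sum fun b => .sum fun c =>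
    (((h.smooth_invMetric i a).mul (h.smooth_invMetric j b)).mul (h.smooth_invMetric k c)).mul
      ((h.smooth_covSecondFF i j k).inner (h.smooth_covSecondFF a b c))

/-- `Z + |∇A|² - |∇H|²` as a function on the surface. -/
def simonsDivAt (F : M → E4) (x : M) : ℝ := simonsDiv (localRep F x) (coord x)

/-- Smoothness is read off from the Simons identity itself: the expression equals the divergence of
the smooth flux divided by √det g. -/
theorem IsRegularAt.smooth_simonsDiv {u : E2 → E4} {y : E2} (h : IsRegularAt u y) :
    SmoothNear (simonsDiv u) y := by
  have e : simonsDiv u =ᶠ[𝓝 y] fun z => (Real.sqrt (metric u z).det)⁻¹ *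
      ∑ i, pd i (simonsFlux u i) z := by
    filter_upwards [h.eventually] with z hz
    rw [hz.div_simonsFlux, inv_mul_cancel_left₀ (Real.sqrt_pos.2 hz.det_pos).ne']
  exact ((h.smooth_sqrt_det.inv (Real.sqrt_pos.2 h.det_pos).ne').mul
    (.sum fun i => (h.smooth_simonsFlux i).pd i)).congr e

theorem IsSmoothImmersion.lipInCharts_simonsDivAt (hF : IsSmoothImmersion F) :
    LipInCharts (simonsDivAt F) :=
  lipInCharts_of_chart (q := fun x₀ => simonsDiv (localRep F x₀)) (fun _ _ hx => hF.simonsDiv_eq hx)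
    fun x₀ _ hy => (hF.isRegularAt x₀ hy).smooth_simonsDiv.lipNear

variable [MeasurableSpace M] [BorelSpace M] [CompactSpace M]

theorem IsSmoothImmersion.integrable_of_bddNear (hF : IsSmoothImmersion F) {h : M → ℝ}
    (H : ∀ x₀ : M, BddNear (localRep h x₀) (coord x₀)) : Integrable h (area F) := by
  refine hF.integrable_area fun x₀ => ?_
  obtain ⟨V, hV, K, hm, hK⟩ := H x₀
  exact ⟨V, hV, localRep h x₀, K, hm, fun y hy => ⟨rfl, hK y hy⟩⟩

theorem LipInCharts.integrable {h : M → ℝ} (hh : LipInCharts h) (hF : IsSmoothImmersion F) :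
    Integrable h (area F) :=
  hF.integrable_of_bddNear fun x₀ => (hh x₀ _ (coord_mem_target x₀)).bddNear

theorem IsSmoothImmersion.integrable_fieldDeriv (hF : IsSmoothImmersion F) {ψ : M → ℝ}
    (hψ : LipInCharts ψ) : Integrable (fieldDeriv F ψ) (area F) :=
  hF.integrable_of_bddNear (hF.bddNear_fieldDeriv hψ)

/-- Integration of the Simons identity against a function supported in a chart domain. -/
theorem IsSmoothImmersion.integral_mul_simonsDivAt_of_tsupport [T2Space M]
    (hF : IsSmoothImmersion F) {ψ : M → ℝ} (hψ : LipInCharts ψ) (x₀ : M)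
    (hs : tsupport ψ ⊆ (chartAt E2 x₀).source) :
    ∫ x, ψ x * simonsDivAt F x ∂(area F) = - ∫ x, fieldDeriv F ψ x ∂(area F) := by
  set T := (chartAt E2 x₀).target with hT
  have hTo : IsOpen T := (chartAt E2 x₀).open_target
  set u := localRep F x₀ with hu
  -- Extension by zero from the chart to the plane. It stays locally Lipschitz across the boundary
  -- of T because the image of the support is a compact subset of T.
  set ψ' : E2 → ℝ := T.indicator (localRep ψ x₀) with hψ'
  have hψ0 : ∀ x ∉ tsupport ψ, ψ x = 0 := fun x hx => image_eq_zero_of_notMem_tsupport hx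
  set K := chartAt E2 x₀ '' tsupport ψ with hK
  have hKc : IsCompact K := (isClosed_tsupport ψ).isCompact.image_of_continuousOn
    ((chartAt E2 x₀).continuousOn.mono hs)
  have hKT : K ⊆ T := by
    rintro _ ⟨x, hx, rfl⟩; exact (chartAt E2 x₀).map_source (hs hx)
  have hψ'0 : ∀ y ∉ K, ψ' y = 0 := by
    intro y hy
    by_cases hyT : y ∈ T
    · rw [hψ', Set.indicator_of_mem hyT]
      refine hψ0 _ fun hx => hy ⟨_, hx, (chartAt E2 x₀).right_inv hyT⟩
    · rw [hψ', Set.indicator_of_notMem hyT]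
  have hloc : ∀ y ∈ T, ψ' =ᶠ[𝓝 y] localRep ψ x₀ := fun y hy => by
    filter_upwards [hTo.mem_nhds hy] with z hz
    rw [hψ', Set.indicator_of_mem hz]
  have hlip : ∀ y, LipNear ψ' y := by
    intro y
    by_cases hyT : y ∈ T
    · exact (hψ x₀ y hyT).congr (hloc y hyT)
    · refine (smoothNear_const (0 : ℝ)).lipNear.congr ?_
      filter_upwards [hKc.isClosed.isOpen_compl.mem_nhds fun h => hyT (hKT h)] with z hz
      exact hψ'0 z hz
  have hcs : HasCompactSupport ψ' := HasCompactSupport.intro hKc hψ'0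
  have hts : tsupport ψ' ⊆ T :=
    (closure_minimal (fun y hy => by_contra fun h => (Function.mem_support.1 hy) (hψ'0 y h)) hKc.isClosed).trans hKT
  obtain ⟨L, hL⟩ := exists_lipschitzWith_of_lipNear hlip hcs
  have ibp := fun i => integral_pd_mul hL hcs hTo hts
    (fun y hy => (hF.isRegularAt x₀ hy).smooth_simonsFlux i) i
  have hout : ∀ x ∉ (chartAt E2 x₀).source, ψ x * simonsDivAt F x = 0 := fun x hx => by
    rw [hψ0 x fun h => hx (hs h), zero_mul]
  have hout' : ∀ x ∉ (chartAt E2 x₀).source, fieldDeriv F ψ x = 0 := fun x hx => by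
    have h1 : ∀ᶠ z in 𝓝 x, ψ z = 0 := by
      filter_upwards [(isClosed_tsupport ψ).isOpen_compl.mem_nhds fun h => hx (hs h)] with z hz
      exact hψ0 z hz
    have h2 : localRep ψ x =ᶠ[𝓝 (coord x)] fun _ => 0 :=
      ((chartAt E2 x).continuousAt_symm (coord_mem_target x)).eventually (p := fun z => ψ z = 0)
        (by rwa [chart_symm_coord])
    simp only [fieldDeriv, pd_congr h2, pd_const]
    simp [pairing]
  rw [hF.integral_area x₀ ((hψ.mul hF.lipInCharts_simonsDivAt).integrable hF) hout,
    hF.integral_area x₀ (hF.integrable_fieldDeriv hψ) hout']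
  have e1 : ∫ y in T, Real.sqrt (metric u y).det * (ψ ((chartAt E2 x₀).symm y) *
      simonsDivAt F ((chartAt E2 x₀).symm y)) = ∫ y, ∑ i, ψ' y * pd i (simonsFlux u i) y := by
    rw [← setIntegral_eq_integral_of_forall_compl_eq_zero (s := T) (f := fun y => ∑ i, ψ' y * _)]
    · refine setIntegral_congr_fun hTo.measurableSet fun y hy => ?_
      have h1 : simonsDivAt F ((chartAt E2 x₀).symm y) = simonsDiv u y := by
        rw [simonsDivAt, hF.simonsDiv_eq ((chartAt E2 x₀).map_target hy),
          (chartAt E2 x₀).right_inv hy]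
      change Real.sqrt (metric u y).det * (ψ ((chartAt E2 x₀).symm y) *
        simonsDivAt F ((chartAt E2 x₀).symm y)) = ∑ i, ψ' y * pd i (simonsFlux u i) y
      rw [h1, ← Finset.mul_sum, (hF.isRegularAt x₀ hy).div_simonsFlux, hψ',
        Set.indicator_of_mem hy, localRep]
      ring
    · intro y hy
      simp [hψ', hy]
  have e2 : ∫ y in T, Real.sqrt (metric u y).det * fieldDeriv F ψ ((chartAt E2 x₀).symm y) =
      ∫ y, ∑ i, pd i ψ' y * simonsFlux u i y := by
    rw [← setIntegral_eq_integral_of_forall_compl_eq_zero (s := T)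
      (f := fun y => ∑ i, pd i ψ' y * _)]
    · refine setIntegral_congr_fun hTo.measurableSet fun y hy => ?_
      rw [hF.fieldDeriv_eq ((chartAt E2 x₀).map_target hy), (chartAt E2 x₀).right_inv hy,
        sqrt_det_mul_pairing]
      refine Finset.sum_congr rfl fun i _ => ?_
      rw [pd_congr (hloc y hy)]
    · intro y hy
      have h0 : ψ' =ᶠ[𝓝 y] fun _ => 0 := by
        filter_upwards [hKc.isClosed.isOpen_compl.mem_nhds fun h => hy (hKT h)] with z hz
        exact hψ'0 z hz
      simp [pd_congr h0, pd_const]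
  rw [e1, e2, integral_finsetSum _ fun i _ => (ibp i).2.1,
    integral_finsetSum _ fun i _ => (ibp i).1, ← Finset.sum_neg_distrib]
  exact Finset.sum_congr rfl fun i _ => by rw [(ibp i).2.2, neg_neg]

end Closed

section Global

variable {M : Type*} [TopologicalSpace M] [ChartedSpace E2 M] [IsManifold (𝓡 2) ∞ M] {F : M → E4}

theorem lipInCharts_of_contMDiff {ψ : M → ℝ} (hψ : ContMDiff (𝓡 2) 𝓘(ℝ, ℝ) ∞ ψ) :
    LipInCharts ψ := fun x₀ _ hy => (smoothNear_localRep hψ x₀ hy).lipNear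

/-! ### Regularity of the geometric quantities -/

/-- R⊥ is antisymmetric in its tangent indices, and in dimension two a 2-form has one component,
whose square is contracted with 2 det G. -/
theorem normalCurvNormSq_eq_det_mul (G : Matrix (Fin 2) (Fin 2) ℝ) (h : Fin 2 → Fin 2 → E4) :
    normalCurvNormSq G h = 2 * G.det * ∑ α, ∑ β, normalCurv G h 0 1 α β ^ 2 := by
  have h00 : ∀ i α β, normalCurv G h i i α β = 0 := by
    intro i α β; simp [normalCurv]
  have h10 : ∀ α β, normalCurv G h 1 0 α β = - normalCurv G h 0 1 α β := by
    intro α β; simp only [normalCurv, Fin.sum_univ_two]; ring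
  have key : ∀ R : Fin 4 → Fin 4 → ℝ,
      (∑ α, ∑ β, R α β * R α β = ∑ α, ∑ β, R α β ^ 2) ∧
      (∑ α, ∑ β, R α β * -R α β = -∑ α, ∑ β, R α β ^ 2) ∧
      (∑ α, ∑ β, -R α β * R α β = -∑ α, ∑ β, R α β ^ 2) ∧
      (∑ α, ∑ β, -R α β * -R α β = ∑ α, ∑ β, R α β ^ 2) := by
    intro R
    simp only [← Finset.sum_neg_distrib]
    refine ⟨?_, ?_, ?_, ?_⟩ <;>
      exact Finset.sum_congr rfl fun _ _ => Finset.sum_congr rfl fun _ _ => by ring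
  obtain ⟨k1, k2, k3, k4⟩ := key (normalCurv G h 0 1)
  have e2 : ∀ f : Fin 2 → ℝ, ∑ i, f i = f 0 + f 1 := Fin.sum_univ_two
  simp only [normalCurvNormSq, e2, h00, h10, zero_mul, mul_zero, Finset.sum_const_zero, k1, k2, k3,
    k4, Matrix.det_fin_two]
  ring

/-- The square root of a smooth nonnegative function is not obviously Lipschitz at its zeros. Here
it factors as √(2 det g⁻¹) times the Euclidean norm of the smooth vector R⊥₁₂, and a norm is
1-Lipschitz. -/
theorem IsRegularAt.lipNear_sqrt_sqNormalCurv {u : E2 → E4} {y : E2} (h : IsRegularAt u y) :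
    LipNear (fun z => Real.sqrt (sqNormalCurv u z)) y := by
  set R : E2 → EuclideanSpace ℝ (Fin 4 × Fin 4) := fun z => WithLp.toLp 2 fun αβ =>
    normalCurv (invMetric u z) (fun i j => secondFF u i j z) 0 1 αβ.1 αβ.2 with hR
  have hRs : SmoothNear R y := by
    have : ∀ αβ : Fin 4 × Fin 4, SmoothNear (fun z =>
        normalCurv (invMetric u z) (fun i j => secondFF u i j z) 0 1 αβ.1 αβ.2) y := by
      intro αβ
      unfold normalCurv
      have hs := fun i j α => (h.smooth_secondFF i j).apply α
      exact .sum fun p => .sum fun q => (h.smooth_invMetric p q).mul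
        (((hs 0 p _).mul (hs 1 q _)).sub ((hs 1 p _).mul (hs 0 q _)))
    filter_upwards [eventually_all.2 this] with z hz
    exact contDiffAt_euclidean.2 hz
  have hdet : SmoothNear (fun z => 2 * (invMetric u z).det) y := by
    simp only [Matrix.det_fin_two]
    have g := h.smooth_invMetric
    exact (smoothNear_const 2).mul (((g 0 0).mul (g 1 1)).sub ((g 0 1).mul (g 1 0)))
  have hpos : ∀ z, IsRegularAt u z → 0 < 2 * (invMetric u z).det := fun z hz => by
    rw [invMetric, Matrix.det_nonsing_inv, Ring.inverse_eq_inv']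
    have := hz.det_pos
    positivity
  refine ((hdet.sqrt (hpos y h).ne').lipNear.mul hRs.lipNear.norm).congr ?_
  filter_upwards [h.eventually] with z hz
  rw [sqNormalCurv, normalCurvNormSq_eq_det_mul, Real.sqrt_mul (hpos z hz).le]
  congr 1
  rw [EuclideanSpace.norm_eq, Fintype.sum_prod_type]
  simp [hR]

theorem IsSmoothImmersion.meanVec_ne_zero (hF : IsSmoothImmersion F)
    (hH : ∀ x, meanCurv F x ≠ 0) (x₀ : M) {y : E2} (hy : y ∈ (chartAt E2 x₀).target) :
    meanVec (localRep F x₀) y ≠ 0 := by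
  have := hH ((chartAt E2 x₀).symm y)
  rwa [hF.meanCurv_eq ((chartAt E2 x₀).map_target hy), (chartAt E2 x₀).right_inv hy] at this

theorem smoothNear_norm_sq {u : E2 → E4} {y : E2} (h : SmoothNear u y) :
    SmoothNear (fun z => ‖u z‖ ^ 2) y := by
  simp only [← real_inner_self_eq_norm_sq]
  exact h.inner h

theorem IsSmoothImmersion.lipInCharts_meanCurv_rpow (hF : IsSmoothImmersion F)
    (hH : ∀ x, meanCurv F x ≠ 0) (q : ℝ) : LipInCharts fun x => (‖meanCurv F x‖ ^ 2) ^ q :=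
  lipInCharts_of_chart (q := fun x₀ y => (‖meanVec (localRep F x₀) y‖ ^ 2) ^ q)
    (fun _ _ hx => by rw [hF.meanCurv_eq hx])
    fun x₀ _ hy => ((smoothNear_norm_sq (hF.isRegularAt x₀ hy).smooth_meanVec).rpow
      (pow_ne_zero 2 (norm_ne_zero_iff.2 (hF.meanVec_ne_zero hH x₀ hy))) q).lipNear

theorem IsSmoothImmersion.lipInCharts_normSqGradA (hF : IsSmoothImmersion F) :
    LipInCharts (normSqGradA F) :=
  lipInCharts_of_chart (q := fun x₀ y => sqGradA (localRep F x₀) y)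
    (fun _ _ hx => hF.normSqGradA_eq hx)
    fun x₀ _ hy => (hF.isRegularAt x₀ hy).smooth_sqGradA.lipNear

theorem IsSmoothImmersion.lipInCharts_pinchQ (hF : IsSmoothImmersion F) (γ : ℝ) :
    LipInCharts (pinchQ F γ) :=
  lipInCharts_of_chart (q := fun x₀ y => (sqA (localRep F x₀) y
      - 1 / 2 * ‖meanVec (localRep F x₀) y‖ ^ 2) + γ * Real.sqrt (sqNormalCurv (localRep F x₀) y))
    (fun x₀ x hx => by
      rw [pinchQ, hF.normSqTracelessA_eq, hF.normSqA_eq hx, hF.meanCurv_eq hx,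
        hF.absNormalCurv_eq hx]; ring)
    fun x₀ y hy => by
      have hr := hF.isRegularAt x₀ hy
      exact (hr.smooth_sqA.sub
        ((smoothNear_const _).mul (smoothNear_norm_sq hr.smooth_meanVec))).lipNear.add
        ((smoothNear_const γ).lipNear.mul hr.lipNear_sqrt_sqNormalCurv)

theorem norm_rpow_two_mul (v : E4) (s : ℝ) : ‖v‖ ^ (2 * s) = (‖v‖ ^ 2) ^ s := by
  rw [Real.rpow_mul (norm_nonneg v), Real.rpow_two]

theorem fSigma_eq (F : M → E4) (γ σ : ℝ) (x : M) :
    fSigma F γ σ x = pinchQ F γ x * (‖meanCurv F x‖ ^ 2) ^ (-(1 - σ)) := by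
  rw [fSigma, norm_rpow_two_mul, Real.rpow_neg (sq_nonneg _), div_eq_mul_inv]

theorem IsSmoothImmersion.lipInCharts_fSigma (hF : IsSmoothImmersion F)
    (hH : ∀ x, meanCurv F x ≠ 0) (γ σ : ℝ) : LipInCharts (fSigma F γ σ) := by
  have e : fSigma F γ σ = fun x => pinchQ F γ x * (‖meanCurv F x‖ ^ 2) ^ (-(1 - σ)) :=
    funext (fSigma_eq F γ σ)
  rw [e]
  exact (hF.lipInCharts_pinchQ γ).mul (hF.lipInCharts_meanCurv_rpow hH _)

/-- For q ≥ 1 the power is C¹ even at 0, where f_σ may vanish; the condition p ≥ 2 makes this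
available for f_σ^{p−1}. -/
theorem LipInCharts.rpow {f : M → ℝ} (hf : LipInCharts f) {q : ℝ} (hq : 1 ≤ q) :
    LipInCharts fun x => f x ^ q := fun x₀ y hy =>
  (hf x₀ y hy).comp (g := fun t : ℝ => t ^ q)
    (Real.contDiff_rpow_const_of_le (n := 1) (by simpa using hq)).contDiffAt

theorem IsSmoothImmersion.normSqTracelessA_nonneg (hF : IsSmoothImmersion F) (x : M) :
    0 ≤ normSqTracelessA F x := by
  obtain ⟨C, -, hG⟩ := (hF.isRegularAt x (coord_mem_target x)).exists_frame
  rw [hF.normSqTracelessA_eq]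
  exact normSq2_sub_trace_nonneg hG _

theorem normSqTracelessA_le_pinchQ (F : M → E4) {γ : ℝ} (hγ : 0 ≤ γ) (x : M) :
    normSqTracelessA F x ≤ pinchQ F γ x := by
  have : 0 ≤ absNormalCurv F x := div_nonneg (Real.sqrt_nonneg _) two_pos.le
  rw [pinchQ]
  nlinarith

theorem IsSmoothImmersion.isSimonsConstant (hF : IsSmoothImmersion F) {κ γ : ℝ} (hκ : κ < 5 / 6)
    (hγ : 0 ≤ γ) (hP : IsPinched F κ) :
    IsSimonsConstant F γ ((5 / 2 - 3 * κ) / (2 * (1 + γ))) := by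
  refine ⟨by apply div_pos <;> linarith, fun x => ?_⟩
  have hr := hF.isRegularAt x (coord_mem_target x)
  obtain ⟨C, -, hG⟩ := hr.exists_frame
  have := simonsZ_ge hG (secondFF_comm hr.smooth 0 1) hκ hγ (hP x).2
  rw [pinchQ, hF.normSqTracelessA_eq]
  exact this

/-! ### The Simons identity tested with Lipschitz functions -/

variable [MeasurableSpace M] [BorelSpace M] [CompactSpace M]

theorem LipInCharts.ae_differentiableAt {ψ : M → ℝ} (hψ : LipInCharts ψ)
    (hF : IsSmoothImmersion F) :
    ∀ᵐ x ∂(area F), DifferentiableAt ℝ (localRep ψ x) (coord x) := by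
  refine hF.ae_area fun x₀ => ?_
  filter_upwards [ae_differentiableAt_of_lipNear (hψ x₀)] with y hy hyT
  set x := (chartAt E2 x₀).symm y with hx
  have hxs : x ∈ (chartAt E2 x₀).source := (chartAt E2 x₀).map_target hyT
  have hxs' : (chartAt E2 x).symm (coord x) ∈ (chartAt E2 x₀).source := by rwa [chart_symm_coord]
  refine DifferentiableAt.congr_of_eventuallyEq ?_
    (localRep_eventuallyEq ψ x₀ x (coord_mem_target x) hxs')
  refine DifferentiableAt.comp (g := localRep ψ x₀) (coord x) ?_
    (smoothNear_transition x₀ x (coord_mem_target x) hxs').differentiableAt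
  rw [chart_symm_coord, hx, (chartAt E2 x₀).right_inv hyT]
  exact hy hyT

theorem IsSmoothImmersion.integral_mul_simonsDivAt [T2Space M] (hF : IsSmoothImmersion F)
    {w : M → ℝ} (hw : LipInCharts w) :
    ∫ x, w x * simonsDivAt F x ∂(area F) = - ∫ x, fieldDeriv F w x ∂(area F) := by
  obtain ⟨t, ht⟩ := isCompact_univ.elim_nhds_subcover (fun x : M => (chartAt E2 x).source)
    fun x _ => (chartAt E2 x).open_source.mem_nhds (mem_chart_source E2 x)
  obtain ⟨χ, hχ⟩ := SmoothPartitionOfUnity.exists_isSubordinate (𝓡 2) (isClosed_univ (X := M))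
    (fun k : t => (chartAt E2 (k : M)).source) (fun k => (chartAt E2 (k : M)).open_source)
    (fun x hx => by
      obtain ⟨k, hk, hkx⟩ := Set.mem_iUnion₂.1 (ht.2 hx)
      exact Set.mem_iUnion.2 ⟨⟨k, hk⟩, hkx⟩)
  have hsum : ∀ x, ∑ k, χ k x = 1 := fun x => by
    rw [← finsum_eq_sum_of_fintype]; exact χ.sum_eq_one (Set.mem_univ x)
  have hχl : ∀ k, LipInCharts (χ k) := fun k => lipInCharts_of_contMDiff (χ k).contMDiff
  have hχw : ∀ k, LipInCharts fun x => χ k x * w x := fun k => (hχl k).mul hw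
  have hk : ∀ k, ∫ x, χ k x * w x * simonsDivAt F x ∂(area F) =
      - ∫ x, fieldDeriv F (fun x => χ k x * w x) x ∂(area F) := fun k =>
    hF.integral_mul_simonsDivAt_of_tsupport (hχw k) k
      ((tsupport_mul_subset_left).trans (hχ k))
  have e1 : ∫ x, w x * simonsDivAt F x ∂(area F) =
      ∑ k, ∫ x, χ k x * w x * simonsDivAt F x ∂(area F) := by
    rw [← integral_finsetSum _ fun k _ =>
      ((hχw k).mul hF.lipInCharts_simonsDivAt).integrable hF]
    congr 1
    funext x
    rw [← Finset.sum_mul, ← Finset.sum_mul, hsum, one_mul]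
  have e2 : ∫ x, fieldDeriv F w x ∂(area F) =
      ∑ k, ∫ x, fieldDeriv F (fun x => χ k x * w x) x ∂(area F) := by
    rw [← integral_finsetSum _ fun k _ => hF.integrable_fieldDeriv (hχw k)]
    -- The derivative of a sum splits only where every summand is differentiable, hence the
    -- almost-everywhere statement.
    refine integral_congr_ae ?_
    filter_upwards [hw.ae_differentiableAt hF] with x hx
    have hd : ∀ k, DifferentiableAt ℝ (localRep (fun x => χ k x * w x) x) (coord x) := fun k =>
      (smoothNear_localRep (χ k).contMDiff x (coord_mem_target x)).differentiableAt.mul hx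
    have e3 : localRep w x = fun z => ∑ k, localRep (fun x => χ k x * w x) x z := by
      funext z
      simp only [localRep]
      rw [← Finset.sum_mul, hsum, one_mul]
    have e4 : ∀ i, pd i (localRep w x) (coord x) =
        ∑ k, pd i (localRep (fun x => χ k x * w x) x) (coord x) := fun i => by
      rw [e3, pd_sum fun k _ => hd k]
    simp only [fieldDeriv, e4, pairing, Fin.sum_univ_two, Finset.sum_add_distrib, Finset.mul_sum,
      Finset.sum_mul]
  rw [e1, e2, ← Finset.sum_neg_distrib]
  exact Finset.sum_congr rfl fun k _ => hk k

end Global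

/-! ### The test function and the final estimate -/

/-- The letters stand for s = 1 − σ, f = f_σ, h = |H|², D = |∇A|², g = |∇f_σ|², a = |Å|², k =
|H|^{−2(1−σ)}, P = ⟨∇f_σ, X⟩ and P' = ⟨½∇|H|², X⟩. The left side is −⟨∇w, X⟩. -/
theorem weight_derivative_bound {p η s f h D g a k P P' : ℝ} (hp : 2 ≤ p) (hη : 0 < η)
    (hs : 0 < s) (hs1 : s < 1) (hf : 0 ≤ f) (hh : 0 < h) (hD : 0 ≤ D) (hg : 0 ≤ g)
    (hk : 0 ≤ k) (ha : a ≤ h / 3) (haf : a * k ≤ f) (hP : P ^ 2 ≤ g * (6 * a * D))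
    (hP' : P' ^ 2 ≤ (h * (2 * D)) * (6 * a * D)) :
    -((p - 1) * f ^ (p - 2) * k * P - 2 * s * f ^ (p - 1) * (k / h) * P') ≤
      3 * (p - 1) / η * (f ^ (p - 2) * g) + ((p - 1) * η / 2 + 4) * (f ^ (p - 1) * k * D) := by
  have e : f ^ (p - 1) = f ^ (p - 2) * f := by
    rw [← Real.rpow_add_one' hf (by linarith)]; congr 1; ring
  set F := f ^ (p - 2)
  have hF : 0 ≤ F := Real.rpow_nonneg hf _
  -- Young's inequality: (kP)² ≤ 6gDk·(ak) ≤ 6gDkf, which is four times the product of the two terms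
  -- on the right.
  have b1 : -(k * P) ≤ 3 / η * g + η / 2 * (f * k * D) := by
    refine (neg_le_abs _).trans (abs_le_of_sq_le_sq ?_ (by positivity))
    have h1 : (k * P) ^ 2 ≤ k ^ 2 * (g * (6 * a * D)) := by
      rw [mul_pow]; exact mul_le_mul_of_nonneg_left hP (sq_nonneg k)
    have h2 : k ^ 2 * (g * (6 * a * D)) ≤ 6 * g * D * k * f := by
      have := mul_le_mul_of_nonneg_left haf (show 0 ≤ 6 * g * D * k by positivity)
      linarith
    have h3 : 4 * ((3 / η * g) * (η / 2 * (f * k * D))) = 6 * g * D * k * f := by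
      field_simp; ring
    nlinarith [sq_nonneg (3 / η * g - η / 2 * (f * k * D))]
  -- From P'² ≤ 12haD² and a ≤ h/3.
  have b2 : P' ≤ 2 * h * D := by
    refine (le_abs_self _).trans (abs_le_of_sq_le_sq (hP'.trans ?_) (by positivity))
    have := mul_le_mul_of_nonneg_left ha (show 0 ≤ 12 * h * D ^ 2 by positivity)
    linarith
  have b3 : k / h * P' ≤ 2 * k * D := by
    rw [div_mul_eq_mul_div, div_le_iff₀ hh]
    linarith [mul_le_mul_of_nonneg_left b2 hk]
  have c1 := mul_le_mul_of_nonneg_left b1 (show 0 ≤ (p - 1) * F by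
    have : 0 ≤ p - 1 := by linarith
    positivity)
  have c2 := mul_le_mul_of_nonneg_left b3 (show 0 ≤ 2 * s * (F * f) by positivity)
  have c3 := mul_le_mul_of_nonneg_right hs1.le (show 0 ≤ 4 * (F * f) * k * D by positivity)
  have e2 : (p - 1) * F * (3 / η * g) = 3 * (p - 1) / η * (F * g) := by ring
  rw [e]
  linarith

theorem pd_rpow {f : E2 → ℝ} {y : E2} (hf : DifferentiableAt ℝ f y) {q : ℝ}
    (h : f y ≠ 0 ∨ 1 ≤ q) (i : Fin 2) :
    pd i (fun z => f z ^ q) y = q * f y ^ (q - 1) * pd i f y := by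
  have := (hf.hasFDerivAt.rpow_const h).fderiv
  simp only [pd, this]
  simp

section Weight

variable {M : Type*} [TopologicalSpace M] [ChartedSpace E2 M] [IsManifold (𝓡 2) ∞ M] {F : M → E4}

/-- The test function `f_σ^{p-1} / |H|^{2(1-σ)}`. -/
def weight (F : M → E4) (γ σ p : ℝ) (x : M) : ℝ :=
  fSigma F γ σ x ^ (p - 1) * (‖meanCurv F x‖ ^ 2) ^ (-(1 - σ))

theorem weight_eq (F : M → E4) (γ σ p : ℝ) (x : M) :
    weight F γ σ p x = fSigma F γ σ x ^ (p - 1) / ‖meanCurv F x‖ ^ (2 * (1 - σ)) := by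
  rw [weight, norm_rpow_two_mul, Real.rpow_neg (sq_nonneg _), div_eq_mul_inv]

theorem IsSmoothImmersion.lipInCharts_weight (hF : IsSmoothImmersion F)
    (hH : ∀ x, meanCurv F x ≠ 0) (γ σ : ℝ) {p : ℝ} (hp : 2 ≤ p) :
    LipInCharts (weight F γ σ p) :=
  ((hF.lipInCharts_fSigma hH γ σ).rpow (by linarith)).mul (hF.lipInCharts_meanCurv_rpow hH _)

theorem IsSmoothImmersion.normSqGradA_nonneg (hF : IsSmoothImmersion F) (x : M) :
    0 ≤ normSqGradA F x := by
  obtain ⟨C, -, hG⟩ := (hF.isRegularAt x (coord_mem_target x)).exists_frame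
  exact normSq3_nonneg hG _

/-- The gradient terms satisfy |∇H|² − |∇A|² ≤ |∇A|². -/
theorem IsSmoothImmersion.simonsZAt_le (hF : IsSmoothImmersion F) (x : M) :
    simonsZAt F x ≤ simonsDivAt F x + normSqGradA F x := by
  obtain ⟨C, -, hG⟩ := (hF.isRegularAt x (coord_mem_target x)).exists_frame
  have h : normSq1 (invMetric (localRep F x) (coord x)) _ ≤ 2 * normSqGradA F x :=
    normSq1_gradTrace_le hG fun k i j => covSecondFF (localRep F x) k i j (coord x)
  have e : simonsDivAt F x = simonsZAt F x + normSqGradA F x - normSq1 _ _ := rfl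
  rw [e]
  linarith

theorem IsSmoothImmersion.fSigma_nonneg (hF : IsSmoothImmersion F) {γ : ℝ} (hγ : 0 ≤ γ) (σ : ℝ)
    (x : M) : 0 ≤ fSigma F γ σ x :=
  div_nonneg ((hF.normSqTracelessA_nonneg x).trans (normSqTracelessA_le_pinchQ F hγ x))
    (Real.rpow_nonneg (norm_nonneg _) _)

/-- The derivative of the weight, in terms of those of `f_σ` and `|H|²`. -/
theorem IsSmoothImmersion.pd_weight (hF : IsSmoothImmersion F) (hH : ∀ x, meanCurv F x ≠ 0)
    (γ σ : ℝ) {p : ℝ} (hp : 2 ≤ p) {x : M}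
    (hx : DifferentiableAt ℝ (localRep (fSigma F γ σ) x) (coord x)) (i : Fin 2) :
    pd i (localRep (weight F γ σ p) x) (coord x) =
      (p - 1) * fSigma F γ σ x ^ (p - 2) * (‖meanCurv F x‖ ^ 2) ^ (-(1 - σ)) *
        pd i (localRep (fSigma F γ σ) x) (coord x)
      - 2 * (1 - σ) * fSigma F γ σ x ^ (p - 1) *
        ((‖meanCurv F x‖ ^ 2) ^ (-(1 - σ)) / ‖meanCurv F x‖ ^ 2) *
        inner ℝ (meanCurv F x) (gradTrace (invMetricAt F x)
          (fun k i j => covSecondFF (localRep F x) k i j (coord x)) i) := by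
  have hr := hF.isRegularAt x (coord_mem_target x)
  have e : localRep (weight F γ σ p) x =ᶠ[𝓝 (coord x)] fun z =>
      localRep (fSigma F γ σ) x z ^ (p - 1) * (‖meanVec (localRep F x) z‖ ^ 2) ^ (-(1 - σ)) := by
    filter_upwards [(chartAt E2 x).open_target.mem_nhds (coord_mem_target x)] with z hz
    rw [localRep, weight, hF.meanCurv_eq ((chartAt E2 x).map_target hz),
      (chartAt E2 x).right_inv hz, localRep]
  have h0 : ‖meanVec (localRep F x) (coord x)‖ ^ 2 ≠ 0 :=
    pow_ne_zero 2 (norm_ne_zero_iff.2 (hH x))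
  have hd := (smoothNear_norm_sq hr.smooth_meanVec).differentiableAt
  have e1 : pd i (fun z => ‖meanVec (localRep F x) z‖ ^ 2) (coord x) = _ := hr.pd_norm_sq_trace i
  have hxv : localRep (fSigma F γ σ) x (coord x) = fSigma F γ σ x := by
    rw [localRep, chart_symm_coord]
  have hmv : meanVec (localRep F x) (coord x) = meanCurv F x := rfl
  rw [pd_congr e, pd_mul (hx.rpow_const (.inr (by linarith))) (hd.rpow_const (.inl h0)),
    pd_rpow hx (.inr (by linarith)), pd_rpow hd (.inl h0), e1, hxv,
    Real.rpow_sub_one h0, hmv, show p - 1 - 1 = p - 2 by ring]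
  change _ + _ = _ - _ * inner ℝ (trace2 (invMetric (localRep F x) (coord x)) fun i j =>
    secondFF (localRep F x) i j (coord x)) (gradTrace (invMetric (localRep F x) (coord x)) _ i)
  ring

theorem IsSmoothImmersion.neg_fieldDeriv_weight_le (hF : IsSmoothImmersion F) {κ γ : ℝ}
    (hκ : κ < 5 / 6) (hγ : 0 ≤ γ) (hP : IsPinched F κ) {σ : ℝ} (hσ : σ ∈ Set.Ioo (0 : ℝ) 1)
    {p η : ℝ} (hp : 2 ≤ p) (hη : 0 < η) {x : M}
    (hx : DifferentiableAt ℝ (localRep (fSigma F γ σ) x) (coord x)) :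
    -fieldDeriv F (weight F γ σ p) x ≤
      3 * (p - 1) / η * (fSigma F γ σ x ^ (p - 2) * normSqGrad F (fSigma F γ σ) x) +
        ((p - 1) * η / 2 + 4) * (weight F γ σ p x * normSqGradA F x) := by
  obtain ⟨C, -, hG⟩ := (hF.isRegularAt x (coord_mem_target x)).exists_frame
  set T := fun k i j => covSecondFF (localRep F x) k i j (coord x) with hT
  set df := fun i => pd i (localRep (fSigma F γ σ) x) (coord x) with hdf
  set X := simonsCovector (invMetricAt F x) (secondFFAt F x) T with hX
  set Y := fun i => inner ℝ (meanCurv F x) (gradTrace (invMetricAt F x) T i) with hY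
  have hD := hF.normSqGradA_nonneg x
  have ha := hF.normSqTracelessA_nonneg x
  have hh : 0 < ‖meanCurv F x‖ ^ 2 := pow_pos (norm_pos_iff.2 (hP x).1) 2
  have hXX : pairing (invMetricAt F x) X X ≤ 6 * normSqTracelessA F x * normSqGradA F x := by
    rw [hF.normSqTracelessA_eq]
    exact pairing_simonsCovector_le hG _ _
  have hYY : pairing (invMetricAt F x) Y Y ≤ ‖meanCurv F x‖ ^ 2 * (2 * normSqGradA F x) :=
    (pairing_inner_le hG _ _).trans
      (mul_le_mul_of_nonneg_left (normSq1_gradTrace_le hG T) hh.le)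
  have hg : 0 ≤ normSqGrad F (fSigma F γ σ) x := pairing_self_nonneg hG df
  have e : fieldDeriv F (weight F γ σ p) x =
      (p - 1) * fSigma F γ σ x ^ (p - 2) * (‖meanCurv F x‖ ^ 2) ^ (-(1 - σ)) *
        pairing (invMetricAt F x) df X
      - 2 * (1 - σ) * fSigma F γ σ x ^ (p - 1) *
        ((‖meanCurv F x‖ ^ 2) ^ (-(1 - σ)) / ‖meanCurv F x‖ ^ 2) *
        pairing (invMetricAt F x) Y X := by
    simp only [fieldDeriv, hF.pd_weight (fun x => (hP x).1) γ σ hp hx]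
    change pairing (invMetricAt F x) _ X = _
    simp only [pairing, Fin.sum_univ_two, hdf, hY]
    ring
  rw [e, weight]
  refine weight_derivative_bound hp hη (by linarith [hσ.2]) (by linarith [hσ.1])
    (hF.fSigma_nonneg hγ σ x) hh hD hg (Real.rpow_nonneg hh.le _) (a := normSqTracelessA F x)
    ?_ ?_ ?_ ?_
  -- |Å|² = |A|² − ½|H|² ≤ (κ − ½)|H|², and κ < 5/6 makes the factor less than 1/3.
  · rw [hF.normSqTracelessA_eq]
    nlinarith [(hP x).2]
  · rw [fSigma_eq]
    exact mul_le_mul_of_nonneg_right (normSqTracelessA_le_pinchQ F hγ x) (Real.rpow_nonneg hh.le _)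
  · exact (pairing_sq_le hG _ _).trans (mul_le_mul_of_nonneg_left hXX hg)
  · exact (pairing_sq_le hG _ _).trans (mul_le_mul hYY hXX (pairing_self_nonneg hG X)
      (by positivity))

/-- The weight is chosen so that w(|Å|² + 2γ|K⊥|) = f_σ^p; multiplying (∗) by w ≥ 0 gives the left
side. -/
theorem IsSmoothImmersion.mul_fSigma_rpow_le (hF : IsSmoothImmersion F) {γ ε : ℝ} (hγ : 0 ≤ γ)
    (hε : IsSimonsConstant F γ ε) (σ : ℝ) {p : ℝ} (hp : 2 ≤ p) (x : M) :
    ε * (fSigma F γ σ x ^ p * ‖meanCurv F x‖ ^ 2) ≤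
      weight F γ σ p x * simonsDivAt F x + weight F γ σ p x * normSqGradA F x := by
  have hf := hF.fSigma_nonneg hγ σ x
  have hw : 0 ≤ weight F γ σ p x :=
    mul_nonneg (Real.rpow_nonneg hf _) (Real.rpow_nonneg (sq_nonneg _) _)
  have e : fSigma F γ σ x ^ p = weight F γ σ p x * pinchQ F γ x := by
    rw [weight, mul_assoc, mul_comm (_ ^ (-(1 - σ))), ← fSigma_eq,
      ← Real.rpow_add_one' hf (by linarith), sub_add_cancel]
  have := mul_le_mul_of_nonneg_left ((hε.2 x).trans (hF.simonsZAt_le x)) hw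
  rw [e]
  linarith

variable [MeasurableSpace M] [BorelSpace M] [CompactSpace M]

theorem IsSmoothImmersion.integrable_rpow_mul_normSqGrad (hF : IsSmoothImmersion F) {f : M → ℝ}
    (hf : LipInCharts f) {q : ℝ} (hq : 0 ≤ q) :
    Integrable (fun x => f x ^ q * normSqGrad F f x) (area F) :=
  hF.integrable_of_bddNear fun x₀ => BddNear.mul
    (bddNear_of_continuousAt ((hf x₀ _ (coord_mem_target x₀)).eventually.mono fun _ hz =>
      hz.continuousAt.rpow_const (.inr hq)))
    (hF.bddNear_normSqGrad hf x₀)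

theorem IsSmoothImmersion.integral_fSigma_le [T2Space M] (hF : IsSmoothImmersion F) {κ γ ε : ℝ}
    (hκ : κ < 5 / 6) (hγ : 0 ≤ γ) (hP : IsPinched F κ) (hε : IsSimonsConstant F γ ε)
    {σ : ℝ} (hσ : σ ∈ Set.Ioo (0 : ℝ) 1) {p η : ℝ} (hp : 2 ≤ p) (hη : 0 < η) :
    Integrable (fun x => fSigma F γ σ x ^ p * ‖meanCurv F x‖ ^ 2) (area F) ∧
    Integrable (fun x => weight F γ σ p x * normSqGradA F x) (area F) ∧
    Integrable (fun x => fSigma F γ σ x ^ (p - 2) * normSqGrad F (fSigma F γ σ) x) (area F) ∧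
    ∫ x, fSigma F γ σ x ^ p * ‖meanCurv F x‖ ^ 2 ∂(area F) ≤
      (4 * p * η + 10) / ε * ∫ x, weight F γ σ p x * normSqGradA F x ∂(area F)
      + 3 * (p - 1) / (ε * η) *
        ∫ x, fSigma F γ σ x ^ (p - 2) * normSqGrad F (fSigma F γ σ) x ∂(area F) := by
  have hH : ∀ x, meanCurv F x ≠ 0 := fun x => (hP x).1
  have hf := hF.lipInCharts_fSigma hH γ σ
  have hw := hF.lipInCharts_weight hH γ σ hp
  have i1 : Integrable (fun x => fSigma F γ σ x ^ p * ‖meanCurv F x‖ ^ 2) (area F) := by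
    have h := hF.lipInCharts_meanCurv_rpow hH 1
    simp only [Real.rpow_one] at h
    exact ((hf.rpow (by linarith)).mul h).integrable hF
  have i2 : Integrable (fun x => weight F γ σ p x * normSqGradA F x) (area F) :=
    (hw.mul hF.lipInCharts_normSqGradA).integrable hF
  have i3 := hF.integrable_rpow_mul_normSqGrad hf (show 0 ≤ p - 2 by linarith)
  refine ⟨i1, i2, i3, ?_⟩
  set I := ∫ x, weight F γ σ p x * normSqGradA F x ∂(area F)
  set J := ∫ x, fSigma F γ σ x ^ (p - 2) * normSqGrad F (fSigma F γ σ) x ∂(area F)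
  have i4 := (hw.mul hF.lipInCharts_simonsDivAt).integrable hF
  have hI : 0 ≤ I := integral_nonneg fun x => mul_nonneg
    (mul_nonneg (Real.rpow_nonneg (hF.fSigma_nonneg hγ σ x) _) (Real.rpow_nonneg (sq_nonneg _) _))
    (hF.normSqGradA_nonneg x)
  have b1 : ε * ∫ x, fSigma F γ σ x ^ p * ‖meanCurv F x‖ ^ 2 ∂(area F) ≤
      -(∫ x, fieldDeriv F (weight F γ σ p) x ∂(area F)) + I := by
    rw [← integral_const_mul, ← hF.integral_mul_simonsDivAt hw, ← integral_add i4 i2]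
    exact integral_mono (i1.const_mul ε) (i4.add i2) fun x => hF.mul_fSigma_rpow_le hγ hε σ hp x
  have b2 : -(∫ x, fieldDeriv F (weight F γ σ p) x ∂(area F)) ≤
      3 * (p - 1) / η * J + ((p - 1) * η / 2 + 4) * I := by
    rw [← integral_neg, ← integral_const_mul, ← integral_const_mul,
      ← integral_add (i3.const_mul _) (i2.const_mul _)]
    refine integral_mono_ae (hF.integrable_fieldDeriv hw).neg
      ((i3.const_mul _).add (i2.const_mul _)) ?_
    filter_upwards [hf.ae_differentiableAt hF] with x hx
    exact hF.neg_fieldDeriv_weight_le hκ hγ hP hσ hp hη hx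
  -- The argument yields the smaller constant (p − 1)η/2 + 5, where 5 is 4 from ∇|H|² and 1 from
  -- |∇H|² ≤ 2|∇A|².
  have b3 : ((p - 1) * η / 2 + 5) * I ≤ (4 * p * η + 10) * I :=
    mul_le_mul_of_nonneg_right (by nlinarith) hI
  have e : (4 * p * η + 10) / ε * I + 3 * (p - 1) / (ε * η) * J =
      ((4 * p * η + 10) * I + 3 * (p - 1) / η * J) / ε := by
    have := hε.1.ne'
    field_simp
  rw [e, le_div_iff₀ hε.1]
  linarith

end Weight

end SurfaceR4

end

theorem proposition5p5 (κ γ : ℝ) (hκ : κ < 5 / 6) (hγ : 0 ≤ γ) :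
    (∃ εZ : ℝ, ∀ (M : Type*) [TopologicalSpace M] [T2Space M] [CompactSpace M]
      [ChartedSpace E2 M] [IsManifold (𝓡 2) ∞ M] (F : M → E4),
      IsSmoothImmersion F → IsPinched F κ → IsSimonsConstant F γ εZ) ∧
    (∀ (M : Type*) [TopologicalSpace M] [T2Space M] [CompactSpace M]
      [ChartedSpace E2 M] [IsManifold (𝓡 2) ∞ M] [MeasurableSpace M] [BorelSpace M] (F : M → E4),
      IsSmoothImmersion F → IsPinched F κ →
      ∀ εZ : ℝ, IsSimonsConstant F γ εZ →
      ∀ σ ∈ Set.Ioo (0 : ℝ) 1, ∀ p : ℝ, 2 ≤ p → ∀ η : ℝ, 0 < η →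
        Integrable (fun x => fSigma F γ σ x ^ p * ‖meanCurv F x‖ ^ 2) (area F) ∧
        Integrable (fun x => fSigma F γ σ x ^ (p - 1) / ‖meanCurv F x‖ ^ (2 * (1 - σ)) *
          normSqGradA F x) (area F) ∧
        Integrable (fun x => fSigma F γ σ x ^ (p - 2) * normSqGrad F (fSigma F γ σ) x) (area F) ∧
        ∫ x, fSigma F γ σ x ^ p * ‖meanCurv F x‖ ^ 2 ∂(area F) ≤
          (4 * p * η + 10) / εZ *
            ∫ x, fSigma F γ σ x ^ (p - 1) / ‖meanCurv F x‖ ^ (2 * (1 - σ)) *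
              normSqGradA F x ∂(area F)
          + 3 * (p - 1) / (εZ * η) *
            ∫ x, fSigma F γ σ x ^ (p - 2) * normSqGrad F (fSigma F γ σ) x ∂(area F)) := by
  refine ⟨⟨(5 / 2 - 3 * κ) / (2 * (1 + γ)), ?_⟩, ?_⟩
  · intro M _ _ _ _ _ F hF hP
    exact hF.isSimonsConstant hκ hγ hP
  · intro M _ _ _ _ _ _ _ F hF hP εZ hε σ hσ p hp η hη
    simp only [← weight_eq]
    exact hF.integral_fSigma_le hκ hγ hP hε hσ hp hη
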